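/- All manifolds are finite-dimensional, Hausdorff, $\sigma$-compact, without boundary, and everything is smooth. **Extended manifolds.** An *extended tangent bundle* $\mathcal{T}M$ over $M$ is an exact Courant algebroid: a vector bundle with a non-degenerate symmetric pairing $\langle\,,\rangle$, an anchor $a:\mathcal{T}M\to TM$ and a Loday bracket $*$ on sections with $a(\mathfrak X)\langle\mathfrak Y,\mathfrak Z\rangle=\langle\mathfrak X,\mathfrak Y*\mathfrak Z+\mathfrak Z*\mathfrak Y\rangle=\langle\mathfrak X*\mathfrak Y,\mathfrak Z\rangle+\langle\mathfrak Y,\mathfrak X*\mathfrak Z\rangle$, such that $0\to T^*M\to\mathcal{T}M\to TM\to0$ is exact; the covector $\xi$ is identified with the element satisfying $2\langle\xi,e\rangle=\xi(a(e))$. An isotropic splitting $s$ of $a$ has the twisting form $H(X,Y,Z)=2\langle s(X),s(Y)*s(Z)\rangle$, and every section is $\mathfrak X=s(X)+\xi$ with a vector field $X$ and a $1$-form $\xi$. A *spinor* $\rho\in\mathcal S(M)$ is a family of (inhomogeneous, $\mathbb Z/2$-graded) differential forms $\rho_s$, one for each isotropic splitting $s$, with $\rho_{s+\iota_\bullet B}=e^{B}\wedge\rho_s$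 for $B\in\Omega^2(M)$. On spinors one has, in terms of any $s$, $$d_{\mathcal T}\rho=d\rho-H\wedge\rho,\qquad \iota_{\mathfrak X}\rho=\iota_X\rho+\xi\wedge\rho,\qquad \mathcal L^{\mathcal T}_{\mathfrak X}\rho=\mathcal L_X\rho+(d\xi-\iota_XH)\wedge\rho .$$ **Extended actions.** Let $G$ be a Lie group with Lie algebra $\mathfrak g$. An (isotropic) *extended $G$-action* on $\mathcal{T}M$ is a smooth action of $G$ on $M$, lifted to $\mathcal{T}M$ by automorphisms of the extended tangent bundle, together with a linear map $\delta=\delta_M:\mathfrak g\to\Gamma(\mathcal{T}M)$ with isotropic image such that $\tau\mapsto(\delta(\tau)*\cdot)$ is a homomorphism of Lie algebras and is the infinitesimal action of $\mathfrak g$ on $\Gamma(\mathcal{T}M)$. The *extended equivariant Cartan complex* is $$C_{\mathfrak g}(\mathcal{T}M;\delta)=\{\rho\in\mathcal S(M)\otimes\widehat S(\mathfrak g^*)\;:\;\mathcal L^{\mathcal T}_{\delta(\tau)}\rho(\tau)=0\text{ for all }\tau\in\mathfrak g\},\qquad (d_{\mathcal T,\delta}\rho)(\tau)=d_{\mathcal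 T}\rho(\tau)-\iota_{\delta(\tau)}\rho(\tau),$$ where $\mathcal S(M)\otimes\widehat S(\mathfrak g^*)$ is the space of formal power series on $\mathfrak g$ with values in $\mathcal S(M)$; it is $\mathbb Z/2$-graded by the parity of forms, and its cohomology is $H_G^\bullet(\mathcal{T}M;\delta)$. **Morphisms.** A *morphism* $\tilde f=(f,\tilde{\mathcal E}):(M,\mathcal{T}M)\to(N,\mathcal{T}N)$ is a smooth map $f:M\to N$ with a maximally isotropic involutive subbundle $\tilde{\mathcal E}\subset-\mathcal{T}M\oplus f^*\mathcal{T}N$ along the graph of $f$ whose image under the anchor is the tangent bundle of the graph; here $-\mathcal{T}M$ is $\mathcal{T}M$ with the pairing $-\langle\,,\rangle$. Isotropic splittings of $\mathcal{T}M$ and $\mathcal{T}N$ determine $b\in\Omega^2(M)$ such that $\tilde{\mathcal E}$ consists of the pairs $(s_M(X)+f^*\eta+\iota_Xb,\;s_N(f_*X)+\eta)$, with $X\in TM$ and $\eta\in f^*T^*N$. Let $\delta_M,\delta_N$ define extended $G$-actions. The morphism is *extended $G$-equivariant* if $f$ is $G$-equivariant, $\tilde{\mathcal E}$ is preserved by the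 diagonal $G$-action, and $(\delta_M(\tau),f^*\delta_N(\tau))\in\Gamma(\tilde{\mathcal E})$ for all $\tau\in\mathfrak g$; that is, in terms of splittings, $\xi_\tau=f^*\eta_\tau+\iota_{X_\tau}b$ (and $Y_\tau=f_*X_\tau$) where $\delta_M(\tau)=X_\tau+\xi_\tau$ and $\delta_N(\tau)=Y_\tau+\eta_\tau$. **Corollary.** Let $\tilde f:(M,\mathcal{T}M)\to(N,\mathcal{T}N)$ be an extended $G$-equivariant morphism. Then there is a linear map $\tilde f^\bullet:\mathcal S(N)\to\mathcal S(M)$ which in terms of any isotropic splittings of $\mathcal{T}M$ and $\mathcal{T}N$, with corresponding $2$-form $b$, is $$\tilde f^\bullet(\rho)=e^{-b}\wedge f^*\rho .$$ It satisfies $\mathcal L^{\mathcal T}_{\delta_M(\tau)}\tilde f^\bullet(\rho)=\tilde f^\bullet(\mathcal L^{\mathcal T}_{\delta_N(\tau)}\rho)$ for all $\tau\in\mathfrak g$. Extended to formal series coefficient by coefficient, it satisfies $d_{\mathcal T,\delta_M}\tilde f^\bullet(\rho)=\tilde f^\bullet(d_{\mathcal T,\delta_N}\rho)$ for all $\rho\in\mathcal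 S(N)\otimes\widehat S(\mathfrak g^*)$. It maps $C_{\mathfrak g}(\mathcal{T}N;\delta_N)$ to $C_{\mathfrak g}(\mathcal{T}M;\delta_M)$, preserving the $\mathbb Z/2$-grading, and so it is a chain map and induces linear maps $$\tilde f^\bullet:H_G^p(\mathcal{T}N;\delta_N)\to H_G^p(\mathcal{T}M;\delta_M),\quad p\in\mathbb Z/2,\qquad [\rho]\mapsto[\tilde f^\bullet(\rho)].$$ -/

import Mathlib

open Bundle Filter Topology
open scoped Manifold ContDiff Nat

noncomputable section

namespace Courant

/-! ## The exterior algebra of a finite-dimensional vector space -/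

section Exterior

/-- Inhomogeneous alternating forms on `E`: the algebra `Λ E*`, written as the product of its
homogeneous components (which vanish in degrees above the dimension of `E`). -/
abbrev Forms (E : Type*) [NormedAddCommGroup E] [NormedSpace ℝ E] : Type _ :=
  (k : ℕ) → E [⋀^Fin k]→L[ℝ] ℝ

variable {E E' : Type*} [NormedAddCommGroup E] [NormedSpace ℝ E]
  [NormedAddCommGroup E'] [NormedSpace ℝ E']

/-- `(v₁, …, vₙ) ↦ α (v₁, …, v_p) * β (v_{p+1}, …, vₙ)`, where `n = p + q`. -/
def tensorForm {p q n : ℕ} (h : p + q = n) (α : E [⋀^Fin p]→L[ℝ] ℝ) (β : E [⋀^Fin q]→L[ℝ] ℝ) :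
    ContinuousMultilinearMap ℝ (fun _ : Fin n => E) ℝ where
  toMultilinearMap := (LinearMap.mul' ℝ ℝ).compMultilinearMap
    ((α.toAlternatingMap.toMultilinearMap.domCoprod
      β.toAlternatingMap.toMultilinearMap).domDomCongr (finSumFinEquiv.trans (finCongr h)))
  cont := by
    simp [Function.comp_def]
    fun_prop

theorem tensorForm_apply {p q n : ℕ} (h : p + q = n) (α : E [⋀^Fin p]→L[ℝ] ℝ)
    (β : E [⋀^Fin q]→L[ℝ] ℝ) (v : Fin n → E) :
    tensorForm h α β v = α (fun i => v (Fin.cast h (Fin.castAdd q i))) *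
      β (fun i => v (Fin.cast h (Fin.natAdd p i))) := by
  simp [tensorForm]
  rfl

/-- The wedge product `α ∧ β = (p! q!)⁻¹ ∑_σ sign(σ) (α ⊗ β) ∘ σ`, so that
`(λ ∧ μ)(u, v) = λ(u) μ(v) - λ(v) μ(u)` for covectors. -/
def wedge {p q n : ℕ} (h : p + q = n) (α : E [⋀^Fin p]→L[ℝ] ℝ) (β : E [⋀^Fin q]→L[ℝ] ℝ) :
    E [⋀^Fin n]→L[ℝ] ℝ :=
  ((p ! : ℝ) * (q ! : ℝ))⁻¹ • ContinuousMultilinearMap.alternatization (tensorForm h α β)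

namespace Forms

/-- A homogeneous form as an inhomogeneous one. -/
def ofDegree (k : ℕ) (α : E [⋀^Fin k]→L[ℝ] ℝ) : Forms E := Pi.single k α

/-- A covector as a form of degree one. -/
def ofCovector (ξ : E →L[ℝ] ℝ) : Forms E :=
  ofDegree 1 (ContinuousAlternatingMap.ofSubsingleton ℝ E ℝ (0 : Fin 1) ξ)

/-- The wedge product of inhomogeneous forms. -/
def mul (α β : Forms E) : Forms E := fun n =>
  ∑ c : Finset.HasAntidiagonal.antidiagonal n,
    wedge (Finset.HasAntidiagonal.mem_antidiagonal.1 c.2) (α c.1.1) (β c.1.2)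

/-- Powers with respect to the wedge product. -/
def pow (α : Forms E) : ℕ → Forms E
  | 0 => ofDegree 0 (ContinuousAlternatingMap.constOfIsEmpty ℝ E (Fin 0) 1)
  | j + 1 => mul α (pow α j)

/-- The exponential `∑ⱼ αʲ / j!` of a form `α` without component of degree zero: in degree `n`
only the powers with `j ≤ n` contribute. -/
def exp (α : Forms E) : Forms E := fun n =>
  ∑ j ∈ Finset.range (n + 1), ((j ! : ℝ)⁻¹) • pow α j n

/-- The interior product `ι_v ρ = ρ(v, ·, …, ·)`. -/
def contract (v : E) (ρ : Forms E) : Forms E := fun k => (ρ (k + 1)).curryLeft v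

/-- Pull-back along a linear map. -/
def comap (L : E →L[ℝ] E') (ρ : Forms E') : Forms E := fun k => (ρ k).compContinuousLinearMap L

theorem mul_add (α β γ : Forms E) : mul α (β + γ) = mul α β + mul α γ := by
  have key : ∀ {p q n : ℕ} (h : p + q = n) (a : E [⋀^Fin p]→L[ℝ] ℝ) (b c : E [⋀^Fin q]→L[ℝ] ℝ),
      wedge h a (b + c) = wedge h a b + wedge h a c := by
    intro p q n h a b c
    have : tensorForm h a (b + c) = tensorForm h a b + tensorForm h a c := by
      ext v; simp [tensorForm_apply, _root_.mul_add]
    simp [wedge, this]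
  funext n
  simp [mul, key, Finset.sum_add_distrib]

theorem mul_smul (r : ℝ) (α β : Forms E) : mul α (r • β) = r • mul α β := by
  have key : ∀ {p q n : ℕ} (h : p + q = n) (a : E [⋀^Fin p]→L[ℝ] ℝ) (b : E [⋀^Fin q]→L[ℝ] ℝ),
      wedge h a (r • b) = r • wedge h a b := by
    intro p q n h a b
    ext v
    simp only [wedge, ContinuousAlternatingMap.smul_apply,
      ContinuousMultilinearMap.alternatization_apply_apply, tensorForm_apply, Finset.smul_sum]
    refine Finset.sum_congr rfl fun σ _ => ?_
    rcases Int.units_eq_one_or (Equiv.Perm.sign σ) with hσ | hσ <;> simp [hσ] <;> ring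
  funext n
  simp [mul, key, Finset.smul_sum]

theorem contract_add (v : E) (α β : Forms E) :
    contract v (α + β) = contract v α + contract v β := by
  funext k; ext w; simp [contract]

theorem contract_smul (r : ℝ) (v : E) (α : Forms E) :
    contract v (r • α) = r • contract v α := by
  funext k; ext w; simp [contract]

theorem curryLeft_comp {k : ℕ} (α : E' [⋀^Fin (k + 1)]→L[ℝ] ℝ) (L : E →L[ℝ] E') (v : E) (w : E')
    (h : L v = w) : (α.compContinuousLinearMap L).curryLeft v =
      (α.curryLeft w).compContinuousLinearMap L := by
  subst h
  exact ContinuousAlternatingMap.curryLeft_compContinuousLinearMap α L v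

end Forms

end Exterior

/-! ## Differential forms on a manifold

The tangent space `T_x M` of a manifold modelled on `E` is, by definition, the vector space `E`,
with the differential of the preferred chart at `x` as the identification. -/

section DifferentialForms

/-- A (not necessarily smooth) field of inhomogeneous forms `ρ x ∈ Λ T_x^* M`. -/
abbrev FormField (E M : Type*) [NormedAddCommGroup E] [NormedSpace ℝ E] : Type _ := M → Forms E

section Algebra

variable {E M : Type*} [NormedAddCommGroup E] [NormedSpace ℝ E]

namespace FormField

/-- The wedge product. -/
def mul (α β : FormField E M) : FormField E M := fun x => Forms.mul (α x) (β x)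

theorem mul_add (α β γ : FormField E M) : mul α (β + γ) = mul α β + mul α γ := by
  funext x; simp [mul, Forms.mul_add]

theorem mul_smul (r : ℝ) (α β : FormField E M) : mul α (r • β) = r • mul α β := by
  funext x; simp [mul, Forms.mul_smul]

end FormField

end Algebra

variable {E M : Type*} [NormedAddCommGroup E] [NormedSpace ℝ E]
  [TopologicalSpace M] [ChartedSpace E M]

/-- The differential `T_x M → T_{f x} N` of `f`, as a map between the model spaces. -/
def diff {E' N : Type*} [NormedAddCommGroup E'] [NormedSpace ℝ E'] [TopologicalSpace N]
    [ChartedSpace E' N] (f : M → N) (x : M) : E →L[ℝ] E' :=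
  mfderiv 𝓘(ℝ, E) 𝓘(ℝ, E') f x

namespace FormField

/-- The degree `k` part of `ρ`, pulled back to the model space by the inverse of the preferred chart
at `x₀`. -/
def inChart (ρ : FormField E M) (x₀ : M) (k : ℕ) : E → E [⋀^Fin k]→L[ℝ] ℝ := fun y =>
  (ρ ((chartAt E x₀).symm y) k).compContinuousLinearMap
    (diff (E := E) (E' := E) (chartAt E x₀).symm y)

/-- Smooth differential forms. -/
def IsSmooth (ρ : FormField E M) : Prop :=
  ∀ (x₀ : M) (k : ℕ), ContDiffOn ℝ ∞ (inChart ρ x₀ k) (chartAt E x₀).target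

/-- The exterior derivative, computed at `x` in the preferred chart at `x`. -/
def extD (ρ : FormField E M) : FormField E M := fun x k =>
  match k with
  | 0 => 0
  | k + 1 => (extDeriv (inChart ρ x k) (chartAt E x x)).compContinuousLinearMap
      (diff (E := E) (E' := E) (chartAt E x) x)

/-- The interior product with a vector field. -/
def contract (X : Π x : M, TangentSpace 𝓘(ℝ, E) x) (ρ : FormField E M) : FormField E M :=
  fun x => Forms.contract (X x) (ρ x)

/-- The Lie derivative `L_X = d ι_X + ι_X d` along a vector field. -/
def lieD (X : Π x : M, TangentSpace 𝓘(ℝ, E) x) (ρ : FormField E M) : FormField E M :=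
  extD (contract X ρ) + contract X (extD ρ)

/-- The pull-back along a map `f : M → N`. -/
def pullback {E' N : Type*} [NormedAddCommGroup E'] [NormedSpace ℝ E'] [TopologicalSpace N]
    [ChartedSpace E' N] (f : M → N) (ρ : FormField E' N) : FormField E M := fun x =>
  Forms.comap (diff f x) (ρ (f x))

theorem inChart_add (α β : FormField E M) (x₀ : M) (k : ℕ) :
    inChart (α + β) x₀ k = inChart α x₀ k + inChart β x₀ k := by
  funext y; ext v; simp [inChart]

theorem inChart_smul (r : ℝ) (α : FormField E M) (x₀ : M) (k : ℕ) :
    inChart (r • α) x₀ k = r • inChart α x₀ k := by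
  funext y; ext v; simp [inChart]

theorem IsSmooth.add {α β : FormField E M} (hα : IsSmooth α) (hβ : IsSmooth β) :
    IsSmooth (α + β) := fun x₀ k => by
  rw [inChart_add]; exact (hα x₀ k).add (hβ x₀ k)

theorem IsSmooth.smul (r : ℝ) {α : FormField E M} (hα : IsSmooth α) : IsSmooth (r • α) :=
  fun x₀ k => by rw [inChart_smul]; exact contDiffOn_const.smul (hα x₀ k)

theorem isSmooth_zero : IsSmooth (0 : FormField E M) := fun x₀ k => by
  have : inChart (0 : FormField E M) x₀ k = 0 := by
    funext y; ext v; simp [inChart]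
  rw [this]; exact contDiffOn_const

theorem IsSmooth.differentiableAt {α : FormField E M} (hα : IsSmooth α) (x : M) (k : ℕ) :
    DifferentiableAt ℝ (inChart α x k) (chartAt E x x) :=
  ((hα x k).contDiffAt ((chartAt E x).open_target.mem_nhds
    (mem_chart_target E x))).differentiableAt (by simp)

theorem extD_add {α β : FormField E M} (hα : IsSmooth α) (hβ : IsSmooth β) :
    extD (α + β) = extD α + extD β := by
  funext x k
  cases k with
  | zero => simp [extD]
  | succ k =>
    simp only [extD, Pi.add_apply, inChart_add]
    rw [extDeriv_add (hα.differentiableAt x k) (hβ.differentiableAt x k)]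
    ext v; simp

theorem extD_smul (r : ℝ) (α : FormField E M) : extD (r • α) = r • extD α := by
  funext x k
  cases k with
  | zero => simp [extD]
  | succ k =>
    simp only [extD, Pi.smul_apply, inChart_smul]
    have : extDeriv (r • inChart α x k) (chartAt E x x)
        = r • extDeriv (inChart α x k) (chartAt E x x) := extDeriv_smul r _
    rw [this]
    ext v; simp

theorem extD_zero : extD (0 : FormField E M) = 0 := by
  simpa using extD_smul 0 (0 : FormField E M)

theorem contract_add (X : Π x : M, TangentSpace 𝓘(ℝ, E) x) (α β : FormField E M) :
    contract X (α + β) = contract X α + contract X β := by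
  funext x; exact Forms.contract_add (E := E) (X x) (α x) (β x)

theorem contract_smul (r : ℝ) (X : Π x : M, TangentSpace 𝓘(ℝ, E) x) (α : FormField E M) :
    contract X (r • α) = r • contract X α := by
  funext x; exact Forms.contract_smul (E := E) r (X x) (α x)

theorem isSmooth_contract [IsManifold 𝓘(ℝ, E) ∞ M] [CompleteSpace E]
    {X : Π x : M, TangentSpace 𝓘(ℝ, E) x}
    (hX : ContMDiff 𝓘(ℝ, E) 𝓘(ℝ, E).tangent ∞ fun x => (⟨x, X x⟩ : TangentBundle 𝓘(ℝ, E) M))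
    {α : FormField E M} (hα : IsSmooth α) : IsSmooth (contract X α) := by
  intro x₀ k
  set e := chartAt E x₀ with he
  have hmd : e.MDifferentiable 𝓘(ℝ, E) 𝓘(ℝ, E) := mdifferentiable_chart x₀
  have hsymm : ContMDiffOn 𝓘(ℝ, E) 𝓘(ℝ, E) ∞ e.symm e.target := contMDiffOn_chart_symm
  have hinv : ∀ y ∈ e.target, (mfderiv 𝓘(ℝ, E) 𝓘(ℝ, E) e.symm y).IsInvertible := fun y hy =>
    ⟨hmd.symm.mfderiv hy, rfl⟩
  have hXc : ContDiffOn ℝ ∞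
      (fun y => (VectorField.mpullback 𝓘(ℝ, E) 𝓘(ℝ, E) e.symm X y : E)) e.target := by
    intro y hy
    have h1 := ContMDiffAt.mpullback_vectorField_preimage (m := ∞) (n := ∞)
      (I := 𝓘(ℝ, E)) (I' := 𝓘(ℝ, E)) (V := X) (f := e.symm) (x₀ := y) (hX (e.symm y))
      ((hsymm y hy).contMDiffAt (e.open_target.mem_nhds hy)) (hinv y hy) (by simp)
    rw [contMDiffAt_section] at h1
    exact (contMDiffAt_iff_contDiffAt.1 (by simpa using h1)).contDiffWithinAt
  have heq : ∀ y ∈ e.target, inChart (contract X α) x₀ k y =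
      (inChart α x₀ (k + 1) y).curryLeft
        (VectorField.mpullback 𝓘(ℝ, E) 𝓘(ℝ, E) e.symm X y : E) := by
    intro y hy
    have hX' : (diff (E := E) (E' := E) e.symm y)
        (VectorField.mpullback 𝓘(ℝ, E) 𝓘(ℝ, E) e.symm X y : E) = (X (e.symm y) : E) := by
      have h := (hinv y hy).self_apply_inverse (X (e.symm y))
      exact h
    exact (Forms.curryLeft_comp (α (e.symm y) (k + 1)) _ _ _ hX').symm
  refine ContDiffOn.congr (f := fun y => ContinuousAlternatingMap.curryLeftLI (𝕜 := ℝ) (E := E)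
    (F := ℝ) (n := k) (inChart α x₀ (k + 1) y)
      (VectorField.mpullback 𝓘(ℝ, E) 𝓘(ℝ, E) e.symm X y : E)) ?_ heq
  exact ((ContinuousAlternatingMap.curryLeftLI (𝕜 := ℝ) (E := E) (F := ℝ)
    (n := k)).toContinuousLinearMap.contDiff.comp_contDiffOn (hα x₀ (k + 1))).clm_apply hXc

end FormField

end DifferentialForms
/-! ## Extended tangent bundles -/

section ExtendedTangentBundle

/-- Smooth vector fields. -/
abbrev VField (E M : Type*) [NormedAddCommGroup E] [NormedSpace ℝ E] [TopologicalSpace M]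
    [ChartedSpace E M] [IsManifold 𝓘(ℝ, E) ∞ M] : Type _ :=
  ContMDiffSection 𝓘(ℝ, E) E ∞ (TangentSpace 𝓘(ℝ, E) : M → Type _)

/-- An extended tangent bundle (exact Courant algebroid) over `M`: a smooth vector bundle `V → M`
with a smooth non-degenerate symmetric pairing, a smooth anchor `V → TM` and a Loday bracket on its
smooth sections, such that `0 → T^*M → V → TM → 0` is exact. Here the covector `ξ` is mapped to
the element `ξ̂` of `V` with `2⟨ξ̂, e⟩ = ξ(anchor e)` for all `e`. -/
structure ExtendedTangentBundle (E F : Type*) {M : Type*} [NormedAddCommGroup E] [NormedSpace ℝ E]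
    [TopologicalSpace M] [ChartedSpace E M] [IsManifold 𝓘(ℝ, E) ∞ M]
    [NormedAddCommGroup F] [NormedSpace ℝ F] (V : M → Type*) [TopologicalSpace (TotalSpace F V)]
    [∀ x, TopologicalSpace (V x)] [∀ x, AddCommGroup (V x)] [∀ x, Module ℝ (V x)]
    [FiberBundle F V] [VectorBundle ℝ F V] where
  /-- the pairing `⟨ , ⟩` -/
  pairing : ∀ x, V x →ₗ[ℝ] V x →ₗ[ℝ] ℝ
  pairing_smooth : ∀ 𝔛 𝔜 : ContMDiffSection 𝓘(ℝ, E) F ∞ V,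
    ContMDiff 𝓘(ℝ, E) 𝓘(ℝ, ℝ) ∞ fun x => pairing x (𝔛 x) (𝔜 x)
  pairing_symm : ∀ x e e', pairing x e e' = pairing x e' e
  pairing_nondegenerate : ∀ x e, (∀ e', pairing x e e' = 0) → e = 0
  /-- the anchor `V → TM` -/
  anchor : ∀ x, V x →ₗ[ℝ] TangentSpace 𝓘(ℝ, E) x
  anchor_smooth : ∀ 𝔛 : ContMDiffSection 𝓘(ℝ, E) F ∞ V,
    ContMDiff 𝓘(ℝ, E) 𝓘(ℝ, E).tangent ∞
      fun x => (⟨x, anchor x (𝔛 x)⟩ : TangentBundle 𝓘(ℝ, E) M)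
  /-- the Loday bracket `𝔛 * 𝔜` -/
  bracket : ContMDiffSection 𝓘(ℝ, E) F ∞ V →ₗ[ℝ]
    ContMDiffSection 𝓘(ℝ, E) F ∞ V →ₗ[ℝ] ContMDiffSection 𝓘(ℝ, E) F ∞ V
  jacobi : ∀ 𝔛 𝔜 ℨ, bracket 𝔛 (bracket 𝔜 ℨ) =
    bracket (bracket 𝔛 𝔜) ℨ + bracket 𝔜 (bracket 𝔛 ℨ)
  anchor_pairing_symm : ∀ (𝔛 𝔜 ℨ : ContMDiffSection 𝓘(ℝ, E) F ∞ V) (x : M),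
    mfderiv 𝓘(ℝ, E) 𝓘(ℝ, ℝ) (fun y => pairing y (𝔜 y) (ℨ y)) x (anchor x (𝔛 x)) =
      pairing x (𝔛 x) (bracket 𝔜 ℨ x + bracket ℨ 𝔜 x)
  anchor_pairing : ∀ (𝔛 𝔜 ℨ : ContMDiffSection 𝓘(ℝ, E) F ∞ V) (x : M),
    mfderiv 𝓘(ℝ, E) 𝓘(ℝ, ℝ) (fun y => pairing y (𝔜 y) (ℨ y)) x (anchor x (𝔛 x)) =
      pairing x (bracket 𝔛 𝔜 x) (ℨ x) + pairing x (𝔜 x) (bracket 𝔛 ℨ x)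
  anchor_surjective : ∀ x, Function.Surjective (anchor x)
  exact : ∀ x e, anchor x e = 0 ↔
    ∃ ξ : TangentSpace 𝓘(ℝ, E) x →ₗ[ℝ] ℝ, ∀ e', 2 * pairing x e e' = ξ (anchor x e')

variable {E F M : Type*} [NormedAddCommGroup E] [NormedSpace ℝ E]
  [TopologicalSpace M] [ChartedSpace E M] [IsManifold 𝓘(ℝ, E) ∞ M]
  [NormedAddCommGroup F] [NormedSpace ℝ F] {V : M → Type*} [TopologicalSpace (TotalSpace F V)]
  [∀ x, TopologicalSpace (V x)] [∀ x, AddCommGroup (V x)] [∀ x, Module ℝ (V x)]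
  [FiberBundle F V] [VectorBundle ℝ F V]

/-- An isotropic splitting `s : TM → V` of the anchor. -/
structure IsotropicSplitting (𝒯 : ExtendedTangentBundle E F V) where
  /-- the underlying bundle map -/
  toFun : ∀ x, TangentSpace 𝓘(ℝ, E) x →ₗ[ℝ] V x
  smooth : ∀ X : VField E M, ContMDiff 𝓘(ℝ, E) (𝓘(ℝ, E).prod 𝓘(ℝ, F)) ∞
    fun x => TotalSpace.mk' F x (toFun x (X x))
  anchor_toFun : ∀ x u, 𝒯.anchor x (toFun x u) = u
  isotropic : ∀ x u v, 𝒯.pairing x (toFun x u) (toFun x v) = 0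

variable {𝒯 : ExtendedTangentBundle E F V}

namespace IsotropicSplitting

/-- The section `s(X)` for a vector field `X`. -/
def apply (s : IsotropicSplitting 𝒯) (X : VField E M) : ContMDiffSection 𝓘(ℝ, E) F ∞ V where
  toFun x := s.toFun x (X x)
  contMDiff_toFun := s.smooth X

/-- The `3`-form `H` represents the twisting of `s`: `H(X, Y, Z) = 2⟨s(X), s(Y) * s(Z)⟩`. -/
def IsTwisting (s : IsotropicSplitting 𝒯) (H : M → E [⋀^Fin 3]→L[ℝ] ℝ) : Prop :=
  ∀ (X Y Z : VField E M) (x : M), H x ![X x, Y x, Z x] =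
    2 * 𝒯.pairing x (s.apply X x) (𝒯.bracket (s.apply Y) (s.apply Z) x)

/-- The twisting form of an isotropic splitting: the unique `3`-form `H` with
`H(X, Y, Z) = 2⟨s(X), s(Y) * s(Z)⟩`. -/
def twist (s : IsotropicSplitting 𝒯) : M → E [⋀^Fin 3]→L[ℝ] ℝ :=
  Classical.epsilon s.IsTwisting

variable [FiniteDimensional ℝ E]

/-- The covector `ξ` in the decomposition `e = s(anchor e) + ξ̂`: by isotropy,
`ξ(v) = 2⟨e - s(anchor e), s(v)⟩ = 2⟨e, s(v)⟩`. -/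
def covector (s : IsotropicSplitting 𝒯) (x : M) (e : V x) : E →L[ℝ] ℝ :=
  LinearMap.toContinuousLinearMap
    ((2 : ℝ) • (𝒯.pairing x e ∘ₗ (s.toFun x : E →ₗ[ℝ] V x)) : E →ₗ[ℝ] ℝ)

/-- The `1`-form `ξ` in the decomposition `𝔛 = s(X) + ξ̂` of a section. -/
def formPart (s : IsotropicSplitting 𝒯) (𝔛 : ContMDiffSection 𝓘(ℝ, E) F ∞ V) : FormField E M :=
  fun x => Forms.ofCovector (s.covector x (𝔛 x))

end IsotropicSplitting

/-- The vector field `anchor 𝔛`. -/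
def ExtendedTangentBundle.vectorPart (𝒯 : ExtendedTangentBundle E F V)
    (𝔛 : ContMDiffSection 𝓘(ℝ, E) F ∞ V) : Π x : M, TangentSpace 𝓘(ℝ, E) x :=
  fun x => 𝒯.anchor x (𝔛 x)

/-! ## Abstract spinors and the Cartan operators -/

/-- A form field for every isotropic splitting. -/
abbrev SpinorField (𝒯 : ExtendedTangentBundle E F V) : Type _ :=
  IsotropicSplitting 𝒯 → FormField E M

/-- The abstract spinor space `𝓘(M) ×_{Ω²(M)} Ω(M)`. The class of `(s, ρ)` is recorded by its
representatives in all splittings: the identity `[s + ι_• B, e^B ∧ ρ] = [s, ρ]` of the quotient by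
the anti-diagonal action of `Ω²(M)` says that the representative in the splitting `s' = s + ι_• B`
is `e^B ∧ ρ`. -/
def spinors (𝒯 : ExtendedTangentBundle E F V) : Submodule ℝ (SpinorField 𝒯) where
  carrier := {ρ | (∀ s, (ρ s).IsSmooth) ∧
    ∀ (s s' : IsotropicSplitting 𝒯) (B : M → E [⋀^Fin 2]→L[ℝ] ℝ),
      (∀ (x : M) (u : E) (e : V x),
        2 * 𝒯.pairing x (s'.toFun x u - s.toFun x u) e = B x ![u, 𝒯.anchor x e]) →
      ∀ x, ρ s' x = Forms.mul (Forms.exp (Forms.ofDegree 2 (B x))) (ρ s x)}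
  zero_mem' := ⟨fun _ => FormField.isSmooth_zero, fun s s' B _ x => by
    have := Forms.mul_smul (0 : ℝ) (Forms.exp (Forms.ofDegree 2 (B x))) 0
    simpa using this.symm⟩
  add_mem' := fun ha hb => ⟨fun s => (ha.1 s).add (hb.1 s), fun s s' B h x => by
    simp only [Pi.add_apply, Forms.mul_add]
    rw [ha.2 s s' B h x, hb.2 s s' B h x]⟩
  smul_mem' := fun r _ ha => ⟨fun s => (ha.1 s).smul r, fun s s' B h x => by
    simp only [Pi.smul_apply, Forms.mul_smul]
    rw [ha.2 s s' B h x]⟩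

instance instAddCommGroupSpinors (𝒯 : ExtendedTangentBundle E F V) : AddCommGroup (spinors 𝒯) :=
  Submodule.addCommGroup _

/-- The differential `d_𝒯 = d - H ∧`, where `H` is the twisting form of the splitting. -/
def dT (ρ : SpinorField 𝒯) : SpinorField 𝒯 := fun s =>
  (ρ s).extD - FormField.mul (fun x => Forms.ofDegree 3 (s.twist x)) (ρ s)

theorem dT_add {ρ η : SpinorField 𝒯} (hρ : ρ ∈ spinors 𝒯) (hη : η ∈ spinors 𝒯) :
    dT (ρ + η) = dT ρ + dT η := by
  funext s
  simp only [dT, Pi.add_apply, FormField.extD_add (hρ.1 s) (hη.1 s), FormField.mul_add]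
  abel

theorem dT_smul (r : ℝ) (ρ : SpinorField 𝒯) : dT (r • ρ) = r • dT ρ := by
  funext s
  simp only [dT, Pi.smul_apply, FormField.extD_smul, FormField.mul_smul, smul_sub]

variable [FiniteDimensional ℝ E]

/-- The Clifford action `ι_𝔛 ρ = ι_X ρ + ξ ∧ ρ`, where `𝔛 = s(X) + ξ̂`. -/
def cliff (𝔛 : ContMDiffSection 𝓘(ℝ, E) F ∞ V) (ρ : SpinorField 𝒯) : SpinorField 𝒯 := fun s =>
  FormField.contract (𝒯.vectorPart 𝔛) (ρ s) + FormField.mul (s.formPart 𝔛) (ρ s)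

/-- The operator `L_𝔛 ρ = L_X ρ + (dξ - ι_X H) ∧ ρ`, where `𝔛 = s(X) + ξ̂`. -/
def lieT (𝔛 : ContMDiffSection 𝓘(ℝ, E) F ∞ V) (ρ : SpinorField 𝒯) : SpinorField 𝒯 := fun s =>
  FormField.lieD (𝒯.vectorPart 𝔛) (ρ s) +
    FormField.mul ((s.formPart 𝔛).extD -
      FormField.contract (𝒯.vectorPart 𝔛) (fun x => Forms.ofDegree 3 (s.twist x))) (ρ s)

theorem cliff_add (𝔛 : ContMDiffSection 𝓘(ℝ, E) F ∞ V) (ρ η : SpinorField 𝒯) :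
    cliff 𝔛 (ρ + η) = cliff 𝔛 ρ + cliff 𝔛 η := by
  funext s
  simp only [cliff, Pi.add_apply, FormField.contract_add, FormField.mul_add]
  abel

theorem cliff_smul (r : ℝ) (𝔛 : ContMDiffSection 𝓘(ℝ, E) F ∞ V) (ρ : SpinorField 𝒯) :
    cliff 𝔛 (r • ρ) = r • cliff 𝔛 ρ := by
  funext s
  simp only [cliff, Pi.smul_apply, FormField.contract_smul, FormField.mul_smul, smul_add]

theorem lieT_add (𝔛 : ContMDiffSection 𝓘(ℝ, E) F ∞ V) {ρ η : SpinorField 𝒯}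
    (hρ : ρ ∈ spinors 𝒯) (hη : η ∈ spinors 𝒯) :
    lieT 𝔛 (ρ + η) = lieT 𝔛 ρ + lieT 𝔛 η := by
  have : CompleteSpace E := FiniteDimensional.complete ℝ E
  have hX := 𝒯.anchor_smooth 𝔛
  funext s
  have h1 := FormField.isSmooth_contract (X := 𝒯.vectorPart 𝔛) hX (hρ.1 s)
  have h2 := FormField.isSmooth_contract (X := 𝒯.vectorPart 𝔛) hX (hη.1 s)
  simp only [lieT, FormField.lieD, Pi.add_apply, FormField.contract_add,
    FormField.extD_add (hρ.1 s) (hη.1 s), FormField.extD_add h1 h2, FormField.mul_add]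
  abel

theorem lieT_smul (r : ℝ) (𝔛 : ContMDiffSection 𝓘(ℝ, E) F ∞ V) (ρ : SpinorField 𝒯) :
    lieT 𝔛 (r • ρ) = r • lieT 𝔛 ρ := by
  funext s
  simp only [lieT, FormField.lieD, Pi.smul_apply, FormField.contract_smul, FormField.extD_smul,
    FormField.mul_smul, smul_add]

/-! ## Extended actions and the extended equivariant Cartan complex -/

/-- An isotropic extended action of a Lie algebra `𝔤`: a linear map `δ : 𝔤 → Γ(V)` with isotropic
image, such that `τ ↦ (δ(τ) * ·)` is a homomorphism of Lie algebras from `𝔤` to the infinitesimal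
symmetries of the extended tangent bundle. -/
structure ExtendedAction (𝔤 : Type*) [LieRing 𝔤] [LieAlgebra ℝ 𝔤]
    (𝒯 : ExtendedTangentBundle E F V) where
  /-- the generating sections -/
  δ : 𝔤 →ₗ[ℝ] ContMDiffSection 𝓘(ℝ, E) F ∞ V
  map_lie : ∀ τ τ' 𝔜, 𝒯.bracket (δ ⁅τ, τ'⁆) 𝔜 =
    𝒯.bracket (δ τ) (𝒯.bracket (δ τ') 𝔜) - 𝒯.bracket (δ τ') (𝒯.bracket (δ τ) 𝔜)
  isotropic : ∀ τ τ' x, 𝒯.pairing x (δ τ x) (δ τ' x) = 0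

/-- The space of formal power series on `𝔤` with values in the spinors: sequences of
homogeneous polynomial maps `ρ k : 𝔤 → 𝓢` of degree `k`, i.e. of the form
`τ ↦ P (τ, …, τ)` with `P` multilinear. -/
def formalSeries (𝔤 : Type*) [AddCommGroup 𝔤] [Module ℝ 𝔤] (𝒯 : ExtendedTangentBundle E F V) :
    Submodule ℝ (ℕ → 𝔤 → spinors 𝒯) where
  carrier := {ρ | ∀ k, ∃ P : MultilinearMap ℝ (fun _ : Fin k => 𝔤) (spinors 𝒯),
    ∀ τ, ρ k τ = P fun _ => τ}
  zero_mem' := fun _ => ⟨0, fun _ => rfl⟩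
  add_mem' := fun ha hb k => by
    obtain ⟨P, hP⟩ := ha k
    obtain ⟨Q, hQ⟩ := hb k
    exact ⟨P + Q, fun τ => by simp [hP, hQ]⟩
  smul_mem' := fun r _ ha k => by
    obtain ⟨P, hP⟩ := ha k
    exact ⟨r • P, fun τ => by simp [hP]⟩

/-- A linear map of spinors, applied to the coefficients of a formal series. -/
def mapSeries {𝔤 S S' : Type*} [AddCommGroup S] [Module ℝ S] [AddCommGroup S'] [Module ℝ S']
    (T : S →ₗ[ℝ] S') (ρ : ℕ → 𝔤 → S) : ℕ → 𝔤 → S' := fun k τ => T (ρ k τ)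

namespace ExtendedAction

variable {𝔤 : Type*} [LieRing 𝔤] [LieAlgebra ℝ 𝔤] (σ : ExtendedAction 𝔤 𝒯)

/-- The Cartan differential `(d_{𝒯,δ} ρ)(τ) = d_𝒯 ρ(τ) - ι_{δ(τ)} ρ(τ)`, degree by degree. -/
def cartanD (ρ : ℕ → 𝔤 → spinors 𝒯) : ℕ → 𝔤 → SpinorField 𝒯 := fun k τ =>
  match k with
  | 0 => dT (ρ 0 τ : SpinorField 𝒯)
  | k + 1 => dT (ρ (k + 1) τ : SpinorField 𝒯) - cliff (σ.δ τ) (ρ k τ : SpinorField 𝒯)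

theorem cartanD_add (ρ η : ℕ → 𝔤 → spinors 𝒯) :
    σ.cartanD (ρ + η) = σ.cartanD ρ + σ.cartanD η := by
  funext k τ
  cases k with
  | zero =>
    simp only [cartanD, Pi.add_apply, Submodule.coe_add]
    exact dT_add (ρ 0 τ).2 (η 0 τ).2
  | succ k =>
    simp only [cartanD, Pi.add_apply, Submodule.coe_add,
      dT_add (ρ (k + 1) τ).2 (η (k + 1) τ).2, cliff_add]
    abel

theorem cartanD_smul (r : ℝ) (ρ : ℕ → 𝔤 → spinors 𝒯) :
    σ.cartanD (r • ρ) = r • σ.cartanD ρ := by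
  funext k τ
  cases k with
  | zero => simp only [cartanD, Pi.smul_apply, Submodule.coe_smul, dT_smul]
  | succ k =>
    simp only [cartanD, Pi.smul_apply, Submodule.coe_smul, dT_smul, cliff_smul, smul_sub]

/-- The part of parity `p` of the extended equivariant Cartan complex: formal series `ρ` on `𝔤` with
values in the spinors of parity `p` such that `L_{δ(τ)} ρ(τ) = 0` for all `τ`. -/
def cartanComplex (p : ZMod 2) : Submodule ℝ (ℕ → 𝔤 → spinors 𝒯) where
  carrier := {ρ | ρ ∈ formalSeries 𝔤 𝒯 ∧
    (∀ k τ, lieT (σ.δ τ) (ρ k τ : SpinorField 𝒯) = 0) ∧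
    ∀ (k : ℕ) (τ : 𝔤) (s : IsotropicSplitting 𝒯) (x : M) (n : ℕ),
      (n : ZMod 2) ≠ p → (ρ k τ : SpinorField 𝒯) s x n = 0}
  zero_mem' := ⟨zero_mem _, fun k τ => by
    simpa using lieT_smul (0 : ℝ) (σ.δ τ) (0 : SpinorField 𝒯), fun _ _ _ _ _ _ => rfl⟩
  add_mem' := fun {a b} ha hb => ⟨add_mem ha.1 hb.1, fun k τ => by
    simp only [Pi.add_apply, Submodule.coe_add, lieT_add _ (a k τ).2 (b k τ).2, ha.2.1, hb.2.1,
      add_zero], fun k τ s x n h => by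
    simp only [Pi.add_apply, Submodule.coe_add, ha.2.2 k τ s x n h, hb.2.2 k τ s x n h, add_zero]⟩
  smul_mem' := fun r _ ha => ⟨Submodule.smul_mem _ r ha.1, fun k τ => by
    simp only [Pi.smul_apply, Submodule.coe_smul, lieT_smul, ha.2.1, smul_zero],
    fun k τ s x n h => by
    simp only [Pi.smul_apply, Submodule.coe_smul, ha.2.2 k τ s x n h, smul_zero]⟩

/-- The closed elements of parity `p` of the Cartan complex. -/
def cocycles (p : ZMod 2) : Submodule ℝ (ℕ → 𝔤 → spinors 𝒯) where
  carrier := {ρ | ρ ∈ σ.cartanComplex p ∧ σ.cartanD ρ = 0}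
  zero_mem' := ⟨zero_mem _, by simpa using σ.cartanD_smul 0 0⟩
  add_mem' := fun ha hb => ⟨add_mem ha.1 hb.1, by rw [cartanD_add, ha.2, hb.2, add_zero]⟩
  smul_mem' := fun r _ ha => ⟨Submodule.smul_mem _ r ha.1, by
    rw [cartanD_smul, ha.2, smul_zero]⟩

/-- The exact elements of parity `p`: differentials of elements of the opposite parity `p + 1`. -/
def coboundaries (p : ZMod 2) : Submodule ℝ (ℕ → 𝔤 → spinors 𝒯) where
  carrier := {η | ∃ ρ ∈ σ.cartanComplex (p + 1),
    ∀ k τ, (η k τ : SpinorField 𝒯) = σ.cartanD ρ k τ}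
  zero_mem' := ⟨0, zero_mem _, fun k τ => by
    have : σ.cartanD (0 : ℕ → 𝔤 → spinors 𝒯) = 0 := by simpa using σ.cartanD_smul 0 0
    rw [this]; rfl⟩
  add_mem' := by
    rintro a b ⟨ρ, hρ, h⟩ ⟨ρ', hρ', h'⟩
    exact ⟨ρ + ρ', add_mem hρ hρ', fun k τ => by
      rw [cartanD_add]; simp only [Pi.add_apply, Submodule.coe_add, h, h']⟩
  smul_mem' := by
    rintro r a ⟨ρ, hρ, h⟩
    exact ⟨r • ρ, Submodule.smul_mem _ r hρ, fun k τ => by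
      rw [cartanD_smul]; simp only [Pi.smul_apply, Submodule.coe_smul, h]⟩

/-- The extended equivariant de Rham cohomology in degree `p : ℤ/2`. -/
abbrev Cohomology (p : ZMod 2) : Type _ :=
  σ.cocycles p ⧸ (σ.coboundaries p).submoduleOf (σ.cocycles p)

end ExtendedAction

/-! ## Group actions -/

instance instCompleteSpaceOfFiniteDimensional (E : Type*) [NormedAddCommGroup E] [NormedSpace ℝ E]
    [FiniteDimensional ℝ E] : CompleteSpace E := FiniteDimensional.complete ℝ E

instance instLieGroupMinSmoothness (E G : Type*) [NormedAddCommGroup E] [NormedSpace ℝ E]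
    [TopologicalSpace G] [ChartedSpace E G] [Group G] [LieGroup 𝓘(ℝ, E) ∞ G] :
    LieGroup 𝓘(ℝ, E) (minSmoothness ℝ 3) G :=
  LieGroup.of_le (m := minSmoothness ℝ 3) (n := ∞) (by simpa using ENat.LEInfty.out)

/-- An extended action of a Lie group `G` on an extended manifold: a smooth action by automorphisms
of the extended tangent bundle, lifting a smooth action on `M`, whose infinitesimal action is the
isotropic extended action `τ ↦ (δ(τ) * ·)` of the Lie algebra. -/
structure ExtendedGroupAction (EG G : Type*) [NormedAddCommGroup EG] [NormedSpace ℝ EG]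
    [FiniteDimensional ℝ EG] [TopologicalSpace G] [ChartedSpace EG G] [Group G]
    [LieGroup 𝓘(ℝ, EG) ∞ G] [MulAction G M] [ContMDiffSMul 𝓘(ℝ, EG) 𝓘(ℝ, E) ∞ G M]
    (𝒯 : ExtendedTangentBundle E F V) extends
    ExtendedAction (GroupLieAlgebra 𝓘(ℝ, EG) G) 𝒯 where
  /-- the action on the fibres -/
  lift : ∀ (g : G) (x : M), V x ≃ₗ[ℝ] V (g • x)
  lift_one : ∀ (x : M) (e : V x),
    TotalSpace.mk' F ((1 : G) • x) (lift 1 x e) = TotalSpace.mk' F x e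
  lift_mul : ∀ (g h : G) (x : M) (e : V x),
    TotalSpace.mk' F ((g * h) • x) (lift (g * h) x e) =
      TotalSpace.mk' F (g • h • x) (lift g (h • x) (lift h x e))
  lift_smooth : ContMDiff (𝓘(ℝ, EG).prod (𝓘(ℝ, E).prod 𝓘(ℝ, F))) (𝓘(ℝ, E).prod 𝓘(ℝ, F)) ∞
    fun q : G × TotalSpace F V => TotalSpace.mk' F (q.1 • q.2.proj) (lift q.1 q.2.proj q.2.snd)
  lift_pairing : ∀ (g : G) (x : M) (e e' : V x),
    𝒯.pairing (g • x) (lift g x e) (lift g x e') = 𝒯.pairing x e e'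
  lift_anchor : ∀ (g : G) (x : M) (e : V x),
    𝒯.anchor (g • x) (lift g x e) =
      mfderiv 𝓘(ℝ, E) 𝓘(ℝ, E) (fun y : M => g • y) x (𝒯.anchor x e)
  lift_bracket : ∀ (g : G) (𝔛 𝔜 𝔛' 𝔜' : ContMDiffSection 𝓘(ℝ, E) F ∞ V),
    (∀ x, 𝔛' (g • x) = lift g x (𝔛 x)) → (∀ x, 𝔜' (g • x) = lift g x (𝔜 x)) →
      ∀ x, 𝒯.bracket 𝔛' 𝔜' (g • x) = lift g x (𝒯.bracket 𝔛 𝔜 x)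
  /-- The derivative of `(exp(tτ) · 𝔜)(x)` at `t = 0` is `(δ(τ) * 𝔜)(x)`. It is expressed through
  `(γ(t)⁻¹ · 𝔜)(x)` for the curves `γ` in `G` with `γ(0) = 1` and `γ'(0) = -τ`. -/
  lift_infinitesimal : ∀ (τ : GroupLieAlgebra 𝓘(ℝ, EG) G) (γ : ℝ → G),
    ContMDiff 𝓘(ℝ, ℝ) 𝓘(ℝ, EG) ∞ γ → γ 0 = 1 →
    (diff (E := ℝ) (E' := EG) γ 0 1 : EG) = -τ →
    ∀ (𝔜 : ContMDiffSection 𝓘(ℝ, E) F ∞ V) (x : M),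
      Tendsto (fun t : ℝ => t⁻¹ • ((lift (γ t) x).symm (𝔜 (γ t • x)) - 𝔜 x)) (𝓝[≠] 0)
        (𝓝 (𝒯.bracket (toExtendedAction.δ τ) 𝔜 x))

end ExtendedTangentBundle

/-! ## Morphisms of extended manifolds -/

section Morphism

variable {E F M : Type*} [NormedAddCommGroup E] [NormedSpace ℝ E]
  [TopologicalSpace M] [ChartedSpace E M] [IsManifold 𝓘(ℝ, E) ∞ M]
  [NormedAddCommGroup F] [NormedSpace ℝ F] {V : M → Type*} [TopologicalSpace (TotalSpace F V)]
  [∀ x, TopologicalSpace (V x)] [∀ x, AddCommGroup (V x)] [∀ x, Module ℝ (V x)]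
  [FiberBundle F V] [VectorBundle ℝ F V]
  {E' F' N : Type*} [NormedAddCommGroup E'] [NormedSpace ℝ E']
  [TopologicalSpace N] [ChartedSpace E' N] [IsManifold 𝓘(ℝ, E') ∞ N]
  [NormedAddCommGroup F'] [NormedSpace ℝ F'] {W : N → Type*} [TopologicalSpace (TotalSpace F' W)]
  [∀ y, TopologicalSpace (W y)] [∀ y, AddCommGroup (W y)] [∀ y, Module ℝ (W y)]
  [FiberBundle F' W] [VectorBundle ℝ F' W]

/-- Smooth sections over `M × N` of the bundle with fibre `V x × W y` at `(x, y)`. -/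
structure ProdSection (E F : Type*) {M : Type*} [NormedAddCommGroup E] [NormedSpace ℝ E]
    [TopologicalSpace M] [ChartedSpace E M]
    [NormedAddCommGroup F] [NormedSpace ℝ F] (V : M → Type*) [TopologicalSpace (TotalSpace F V)]
    [∀ x, TopologicalSpace (V x)] [FiberBundle F V]
    (E' F' : Type*) {N : Type*} [NormedAddCommGroup E'] [NormedSpace ℝ E']
    [TopologicalSpace N] [ChartedSpace E' N]
    [NormedAddCommGroup F'] [NormedSpace ℝ F'] (W : N → Type*) [TopologicalSpace (TotalSpace F' W)]
    [∀ y, TopologicalSpace (W y)] [FiberBundle F' W] where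
  /-- the component in `V` -/
  fst : ∀ q : M × N, V q.1
  /-- the component in `W` -/
  snd : ∀ q : M × N, W q.2
  smooth_fst : ContMDiff (𝓘(ℝ, E).prod 𝓘(ℝ, E')) (𝓘(ℝ, E).prod 𝓘(ℝ, F)) ∞
    fun q : M × N => TotalSpace.mk' F q.1 (fst q)
  smooth_snd : ContMDiff (𝓘(ℝ, E).prod 𝓘(ℝ, E')) (𝓘(ℝ, E').prod 𝓘(ℝ, F')) ∞
    fun q : M × N => TotalSpace.mk' F' q.2 (snd q)

namespace ProdSection

/-- The restriction of the first component to `M × {y}`. -/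
def sliceFst (𝔛 : ProdSection E F V E' F' W) (y : N) : ContMDiffSection 𝓘(ℝ, E) F ∞ V where
  toFun x := 𝔛.fst (x, y)
  contMDiff_toFun := 𝔛.smooth_fst.comp (contMDiff_id.prodMk contMDiff_const)

/-- The restriction of the second component to `{x} × N`. -/
def sliceSnd (𝔛 : ProdSection E F V E' F' W) (x : M) : ContMDiffSection 𝓘(ℝ, E') F' ∞ W where
  toFun y := 𝔛.snd (x, y)
  contMDiff_toFun := 𝔛.smooth_snd.comp (contMDiff_const.prodMk contMDiff_id)

end ProdSection

variable (𝒯M : ExtendedTangentBundle E F V) (𝒯N : ExtendedTangentBundle E' F' W)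

/-- The derivative of the function `g` in the direction of the tangent vector `v` at `x`. -/
def dirDeriv {E M : Type*} [NormedAddCommGroup E] [NormedSpace ℝ E] [TopologicalSpace M]
    [ChartedSpace E M] (g : M → ℝ) (x : M) (v : TangentSpace 𝓘(ℝ, E) x) : ℝ :=
  mfderiv 𝓘(ℝ, E) 𝓘(ℝ, ℝ) g x v

/-- The pairing `-⟨ , ⟩_M + ⟨ , ⟩_N` of the product of the reversed extended tangent bundle of
`M` with the extended tangent bundle of `N`. -/
def prodPairing (x : M) (y : N) (e e' : V x × W y) : ℝ :=
  -𝒯M.pairing x e.1 e'.1 + 𝒯N.pairing y e.2 e'.2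

/-- The number `⟨(𝔛 * 𝔜)(x, y), e⟩`, where `*` is the Loday bracket of the product of the reversed
extended tangent bundle of `M` with the extended tangent bundle of `N`, i.e. the one that extends the
brackets of sections pulled back from the factors, and vanishes between the two factors.
Sections of the product are families of sections of the factors depending on a parameter in the
other factor; the first two terms are the brackets on the factors for a fixed parameter, and the
others are the derivatives with respect to the parameters, which come from the Leibniz rules
`𝔛 * (g𝔜) = g(𝔛 * 𝔜) + (anchor(𝔛) g)𝔜` and
`(g𝔛) * 𝔜 = g(𝔛 * 𝔜) - (anchor(𝔜) g)𝔛 + 2⟨𝔛, 𝔜⟩ \widehat{dg}`. -/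
def prodBracketPairing (𝔛 𝔜 : ProdSection E F V E' F' W) (x : M) (y : N) (e : V x × W y) : ℝ :=
  -𝒯M.pairing x (𝒯M.bracket (𝔛.sliceFst y) (𝔜.sliceFst y) x) e.1
  + 𝒯N.pairing y (𝒯N.bracket (𝔛.sliceSnd x) (𝔜.sliceSnd x) y) e.2
  + dirDeriv (fun y' => -𝒯M.pairing x (𝔜.fst (x, y')) e.1) y
      (𝒯N.anchor y (𝔛.snd (x, y)))
  - dirDeriv (fun y' => -𝒯M.pairing x (𝔛.fst (x, y')) e.1) y
      (𝒯N.anchor y (𝔜.snd (x, y)))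
  + dirDeriv (fun y' => -𝒯M.pairing x (𝔛.fst (x, y')) (𝔜.fst (x, y))) y
      (𝒯N.anchor y e.2)
  + dirDeriv (fun x' => 𝒯N.pairing y (𝔜.snd (x', y)) e.2) x
      (𝒯M.anchor x (𝔛.fst (x, y)))
  - dirDeriv (fun x' => 𝒯N.pairing y (𝔛.snd (x', y)) e.2) x
      (𝒯M.anchor x (𝔜.fst (x, y)))
  + dirDeriv (fun x' => 𝒯N.pairing y (𝔛.snd (x', y)) (𝔜.snd (x, y))) x
      (𝒯M.anchor x e.1)

/-- `S` is an isotropic extension of the tangent space of the graph of `f` at `x`, contained in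
`V x × W (f x)`: it is isotropic and the anchor maps it onto the graph of the differential. -/
def IsIsotropicOver (f : M → N) (x : M) (S : Submodule ℝ (V x × W (f x))) : Prop :=
  (∀ e ∈ S, ∀ e' ∈ S, prodPairing 𝒯M 𝒯N x (f x) e e' = 0) ∧
  (∀ e ∈ S, 𝒯N.anchor (f x) e.2 = mfderiv 𝓘(ℝ, E) 𝓘(ℝ, E') f x (𝒯M.anchor x e.1)) ∧
  ∀ u : TangentSpace 𝓘(ℝ, E) x, ∃ e ∈ S, 𝒯M.anchor x e.1 = u

/-- A morphism of extended manifolds: a smooth map `f : M → N` with a maximally isotropic involutive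
extended structure on its graph, with respect to the product of the reversed extended tangent bundle
of `M` and the extended tangent bundle of `N`. -/
structure Morphism where
  /-- the underlying map -/
  toFun : M → N
  smooth : ContMDiff 𝓘(ℝ, E) 𝓘(ℝ, E') ∞ toFun
  /-- the extended structure, a subbundle of the restriction to the graph -/
  str : ∀ x, Submodule ℝ (V x × W (toFun x))
  isotropic : ∀ x, IsIsotropicOver 𝒯M 𝒯N toFun x (str x)
  maximal : ∀ x S, IsIsotropicOver 𝒯M 𝒯N toFun x S → str x ≤ S → S = str x
  /-- smoothness of the subbundle: it is spanned by smooth sections -/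
  exists_section : ∀ x, ∀ e ∈ str x,
    ∃ (α : ContMDiffSection 𝓘(ℝ, E) F ∞ V) (β : ∀ x', W (toFun x')),
      ContMDiff 𝓘(ℝ, E) (𝓘(ℝ, E').prod 𝓘(ℝ, F')) ∞
        (fun x' => TotalSpace.mk' F' (toFun x') (β x')) ∧
      (∀ x', (α x', β x') ∈ str x') ∧ (α x, β x) = e
  /-- if two sections over `M × N` lie in the subbundle along the graph, so does their bracket -/
  involutive : ∀ 𝔛 𝔜 : ProdSection E F V E' F' W,
    (∀ x, (𝔛.fst (x, toFun x), 𝔛.snd (x, toFun x)) ∈ str x) →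
    (∀ x, (𝔜.fst (x, toFun x), 𝔜.snd (x, toFun x)) ∈ str x) →
    ∀ x, ∃ z ∈ str x, ∀ e : V x × W (toFun x),
      prodPairing 𝒯M 𝒯N x (toFun x) z e = prodBracketPairing 𝒯M 𝒯N 𝔛 𝔜 x (toFun x) e

variable {𝒯M 𝒯N}

namespace Morphism

/-- In the splittings `sM` and `sN` the morphism is given by the `2`-form `b`: the extended
structure at `x` consists of the pairs
`(sM(u) + (f^*η + ι_u b)^, sN(f_* u) + η^)` with `u ∈ T_x M` and `η ∈ T_{f(x)}^* N`. -/
def Represents (f : Morphism 𝒯M 𝒯N) (sM : IsotropicSplitting 𝒯M) (sN : IsotropicSplitting 𝒯N)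
    (b : M → E [⋀^Fin 2]→L[ℝ] ℝ) : Prop :=
  ∀ (x : M) (e : V x × W (f.toFun x)), e ∈ f.str x ↔
    𝒯N.anchor (f.toFun x) e.2 = diff (E := E) (E' := E') f.toFun x (𝒯M.anchor x e.1) ∧
    ∀ v : E, 2 * 𝒯M.pairing x e.1 (sM.toFun x v) =
      2 * 𝒯N.pairing (f.toFun x) e.2 (sN.toFun (f.toFun x) (diff (E := E) (E' := E') f.toFun x v)) +
        b x ![(𝒯M.anchor x e.1 : E), v]

variable [FiniteDimensional ℝ E] [FiniteDimensional ℝ E']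
  {EG G : Type*} [NormedAddCommGroup EG] [NormedSpace ℝ EG]
  [FiniteDimensional ℝ EG] [TopologicalSpace G] [ChartedSpace EG G] [Group G]
  [LieGroup 𝓘(ℝ, EG) ∞ G] [MulAction G M] [ContMDiffSMul 𝓘(ℝ, EG) 𝓘(ℝ, E) ∞ G M]
  [MulAction G N] [ContMDiffSMul 𝓘(ℝ, EG) 𝓘(ℝ, E') ∞ G N]

/-- Extended `G`-equivariant morphisms. -/
structure IsEquivariant (f : Morphism 𝒯M 𝒯N) (σM : ExtendedGroupAction EG G 𝒯M)
    (σN : ExtendedGroupAction EG G 𝒯N) : Prop where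
  /-- the underlying map is equivariant -/
  map_smul : ∀ (g : G) (x : M), f.toFun (g • x) = g • f.toFun x
  /-- the extended structure is preserved by the diagonal action of `G` -/
  lift_mem : ∀ (g : G) (x : M), ∀ e ∈ f.str x, ∀ e' : W (f.toFun (g • x)),
    TotalSpace.mk' F' (f.toFun (g • x)) e' =
      TotalSpace.mk' F' (g • f.toFun x) (σN.lift g (f.toFun x) e.2) →
    (σM.lift g x e.1, e') ∈ f.str (g • x)
  /-- the extended structure contains the generating sections of the diagonal action -/
  generator_mem : ∀ (τ : GroupLieAlgebra 𝓘(ℝ, EG) G) (x : M),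
    (σM.δ τ x, σN.δ τ (f.toFun x)) ∈ f.str x

end Morphism

end Morphism

end Courant

end

open Bundle Filter Topology
open scoped Manifold ContDiff Nat

set_option linter.unusedSectionVars false

noncomputable section

/-! Everything reduces to one good pair of splittings, in which the morphism has `b = 0` and the map
of spinors is the ordinary pull-back of forms.

The representing form. For splittings `sM`, `sN` and a pair `e = (e₁, e₂)` in the structure at `x`,
let `Morphism.defect` send `v` to `2⟨e₁, sM v⟩ - 2⟨e₂, sN (f_* v)⟩`. By `prodPairing_eq`, isotropy
says exactly that this expression is skew in `v` and the anchor of `e₁`. Hence it depends on `e`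
only through the anchor and is a `2`-form `b` (`exists_form`). Maximality says conversely that every
pair over the graph satisfying the equation lies in the structure (`represents_of_forall`).
Smoothness of `b` comes from local sections of the structure whose anchors form a frame
(`Represents.isSmooth`).

Normalization. Shifting `sM` by `b` gives `s₀` for which the representing form vanishes
(`exists_represents_zero`). The structure then contains all pairs `(s₀ u, t₀ (f_* u))`, and pairing
the involutivity condition with a third such pair gives `H_{s₀} = f^* H_{t₀}` (`Represents.twist`).
For sections related by the morphism one has `Y = f_* X` along `f` and `ξ = f^* η`. Since `f^*`
commutes with `d`, wedge products and interior products along related fields, it intertwines `d_𝒯`,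
the Clifford action and the Lie operators, all written in `s₀` and `t₀`.

Independence of splittings. A spinor is determined by one representative, which can be any smooth
form (`spinor_ext`, `exists_spinor`), so `f^*` from representatives in `t₀` to representatives in
`s₀` defines the map `T`. The operators preserve spinors because `H_{s+B} = H_s + dB` and `ξ_{s+B} =
ξ_s - ι_X B` cancel what conjugation by `e^B` adds to `d`, `ι_X` and `L_X`. Operator identities
therefore need checking only in `s₀`. In splittings `sM = s₀ + B` and `sN = t₀ + C` the representing
form is `f^*C - B`, and `T` becomes `e^B f^* e^{-C} = e^{-(f^*C - B)} f^*`.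

The law for `H` must be extracted from the axioms: `⟨s(X) * s(Y), s(Z)⟩` is totally skew, hence
tensorial, and `anchor_bracket_eq_zero` replaces the statement that the anchor is a homomorphism.
The exterior algebra is developed by induction on the degree: a form of positive degree is
determined by its interior products, and `ι_v` is an antiderivation (`apply_succ_eq`,
`contract_mul`).

For the Cartan complexes, the generating sections of the two actions are related, so `T` intertwines
the Cartan differentials coefficient by coefficient; it preserves parity because `e^B` is even. -/

namespace Courant

/-! ### Interior products of wedge products, via permutations. -/

section Exterior

/-- The permutation of `Fin (n + 1)` which sends `i` to `0` and induces `e` on the complements. -/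
def permInsert {n : ℕ} (x : Fin (n + 1) × Equiv.Perm (Fin n)) : Equiv.Perm (Fin (n + 1)) :=
  Equiv.Perm.decomposeFin.symm (0, x.2) * Fin.cycleRange x.1

theorem permInsert_self {n : ℕ} (i : Fin (n + 1)) (e : Equiv.Perm (Fin n)) :
    permInsert (i, e) i = 0 := by
  simp [permInsert]

theorem permInsert_succAbove {n : ℕ} (i : Fin (n + 1)) (e : Equiv.Perm (Fin n)) (j : Fin n) :
    permInsert (i, e) (i.succAbove j) = (e j).succ := by
  simp [permInsert, Fin.cycleRange_succAbove]

theorem sign_permInsert {n : ℕ} (i : Fin (n + 1)) (e : Equiv.Perm (Fin n)) :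
    Equiv.Perm.sign (permInsert (i, e)) = (-1) ^ (i : ℕ) * Equiv.Perm.sign e := by
  simp [permInsert, Fin.sign_cycleRange, mul_comm]

theorem permInsert_bijective (n : ℕ) :
    Function.Bijective (permInsert : Fin (n + 1) × Equiv.Perm (Fin n) → _) := by
  rw [Fintype.bijective_iff_injective_and_card]
  refine ⟨?_, by simp [Fintype.card_perm, Nat.factorial_succ]⟩
  rintro ⟨i, e⟩ ⟨j, e'⟩ h
  have hij : i = j := by
    apply (permInsert (j, e')).injective
    rw [permInsert_self, ← h, permInsert_self]
  subst hij
  refine Prod.ext rfl (Equiv.ext fun k => ?_)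
  have := permInsert_succAbove i e k
  rw [h, permInsert_succAbove] at this
  exact (Fin.succ_injective _ this).symm

theorem cons_permInsert {E : Type*} {n : ℕ} (i : Fin (n + 1)) (e : Equiv.Perm (Fin n))
    (v : E) (w : Fin n → E)
    (j : Fin (n + 1)) : (Fin.cons v w : Fin (n + 1) → E) (permInsert (i, e) j) =
      (i.insertNth v (w ∘ e) : Fin (n + 1) → E) j := by
  rcases Fin.eq_self_or_eq_succAbove i j with rfl | ⟨k, rfl⟩
  · simp [permInsert_self]
  · simp [permInsert_succAbove]

/-- Inserting a slot in one of the two blocks of arguments inserts it in that block's factor and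
merely renumbers the other block. This and the next three lemmas are the index bookkeeping for
`curryLeft_wedge`. -/
theorem insertNth_castAdd_castAdd {E : Type*} {p q n : ℕ} (h : p + 1 + q = n + 1) (h' : p + q = n)
    (i : Fin (p + 1)) (v : E) (u : Fin n → E) :
    (fun j : Fin (p + 1) => ((Fin.cast h (Fin.castAdd q i)).insertNth v u : Fin (n + 1) → E)
      (Fin.cast h (Fin.castAdd q j))) =
    (i.insertNth v (fun j => u (Fin.cast h' (Fin.castAdd q j))) : Fin (p + 1) → E) := by
  funext j
  rcases Fin.eq_self_or_eq_succAbove i j with rfl | ⟨k, rfl⟩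
  · simp
  · have : Fin.cast h (Fin.castAdd q (i.succAbove k)) =
        (Fin.cast h (Fin.castAdd q i)).succAbove (Fin.cast h' (Fin.castAdd q k)) := by
      ext; simp [Fin.succAbove, Fin.lt_def]; split_ifs <;> simp
    rw [this]; simp

theorem insertNth_castAdd_natAdd {E : Type*} {p q n : ℕ} (h : p + 1 + q = n + 1) (h' : p + q = n)
    (i : Fin (p + 1)) (v : E) (u : Fin n → E) (j : Fin q) :
    ((Fin.cast h (Fin.castAdd q i)).insertNth v u : Fin (n + 1) → E)
      (Fin.cast h (Fin.natAdd (p + 1) j)) = u (Fin.cast h' (Fin.natAdd p j)) := by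
  have : Fin.cast h (Fin.natAdd (p + 1) j) =
      (Fin.cast h (Fin.castAdd q i)).succAbove (Fin.cast h' (Fin.natAdd p j)) := by
    ext; simp only [Fin.val_cast, Fin.val_natAdd, Fin.val_castAdd, Fin.succAbove, Fin.lt_def,
        Fin.val_castSucc]
    split_ifs <;> simp <;> omega
  rw [this]; simp

theorem insertNth_natAdd_natAdd {E : Type*} {p q n : ℕ} (h : p + (q + 1) = n + 1) (h' : p + q = n)
    (i : Fin (q + 1)) (v : E) (u : Fin n → E) :
    (fun j : Fin (q + 1) => ((Fin.cast h (Fin.natAdd p i)).insertNth v u : Fin (n + 1) → E)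
      (Fin.cast h (Fin.natAdd p j))) =
    (i.insertNth v (fun j => u (Fin.cast h' (Fin.natAdd p j))) : Fin (q + 1) → E) := by
  funext j
  rcases Fin.eq_self_or_eq_succAbove i j with rfl | ⟨k, rfl⟩
  · simp
  · have : Fin.cast h (Fin.natAdd p (i.succAbove k)) =
        (Fin.cast h (Fin.natAdd p i)).succAbove (Fin.cast h' (Fin.natAdd p k)) := by
      ext; simp only [Fin.val_cast, Fin.val_natAdd, Fin.succAbove, Fin.lt_def, Fin.val_castSucc]
      split_ifs <;> simp <;> omega
    rw [this]; simp

theorem insertNth_natAdd_castAdd {E : Type*} {p q n : ℕ} (h : p + (q + 1) = n + 1) (h' : p + q = n)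
    (i : Fin (q + 1)) (v : E) (u : Fin n → E) (j : Fin p) :
    ((Fin.cast h (Fin.natAdd p i)).insertNth v u : Fin (n + 1) → E)
      (Fin.cast h (Fin.castAdd (q + 1) j)) = u (Fin.cast h' (Fin.castAdd q j)) := by
  have : Fin.cast h (Fin.castAdd (q + 1) j) =
      (Fin.cast h (Fin.natAdd p i)).succAbove (Fin.cast h' (Fin.castAdd q j)) := by
    ext; simp only [Fin.val_cast, Fin.val_natAdd, Fin.val_castAdd, Fin.succAbove, Fin.lt_def,
        Fin.val_castSucc]
    split_ifs <;> simp <;> omega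
  rw [this]; simp

variable {E E' : Type*} [NormedAddCommGroup E] [NormedSpace ℝ E]
  [NormedAddCommGroup E'] [NormedSpace ℝ E']

theorem wedge_apply {p q n : ℕ} (h : p + q = n) (α : E [⋀^Fin p]→L[ℝ] ℝ) (β : E [⋀^Fin q]→L[ℝ] ℝ)
    (v : Fin n → E) :
    wedge h α β v = ((p ! : ℝ) * (q ! : ℝ))⁻¹ * ∑ σ : Equiv.Perm (Fin n),
      ((Equiv.Perm.sign σ : ℤ) : ℝ) * (α (fun i => v (σ (Fin.cast h (Fin.castAdd q i)))) *
        β (fun i => v (σ (Fin.cast h (Fin.natAdd p i))))) := by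
  simp only [wedge, ContinuousAlternatingMap.smul_apply,
    ContinuousMultilinearMap.alternatization_apply_apply, tensorForm_apply, smul_eq_mul]
  congr 1
  refine Finset.sum_congr rfl fun σ _ => ?_
  rcases Int.units_eq_one_or (Equiv.Perm.sign σ) with hσ | hσ <;> simp [hσ]

theorem map_insertNth {p : ℕ} (α : E [⋀^Fin (p + 1)]→L[ℝ] ℝ) (i : Fin (p + 1)) (v : E)
    (u : Fin p → E) : α (i.insertNth v u) = (-1) ^ (i : ℕ) * α (Fin.cons v u) := by
  have := α.toAlternatingMap.map_insertNth i v u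
  simpa [Matrix.vecCons] using this

/-- The wedge product of forms of degrees `p` and `q` as a form of degree `n`, zero unless
`p + q = n`. -/
def wedgeOr (n p q : ℕ) (α : E [⋀^Fin p]→L[ℝ] ℝ) (β : E [⋀^Fin q]→L[ℝ] ℝ) : E [⋀^Fin n]→L[ℝ] ℝ :=
  if h : p + q = n then wedge h α β else 0

/-- The interior product of the form `α` in degree `p`, wedged with `β`. -/
def contractWedge (n : ℕ) (v : E) (α β : Forms E) : ℕ → ℕ → E [⋀^Fin n]→L[ℝ] ℝ
  | 0, _ => 0
  | p + 1, q => wedgeOr n p q ((α (p + 1)).curryLeft v) (β q)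

/-- The form `α` in degree `p`, wedged with the interior product of `β`. -/
def wedgeContract (n : ℕ) (v : E) (α β : Forms E) : ℕ → ℕ → E [⋀^Fin n]→L[ℝ] ℝ
  | _, 0 => 0
  | p, q + 1 => wedgeOr n p q (α p) ((β (q + 1)).curryLeft v)

/-- Group the permutations by the argument position that receives `v`. A position `i` in the first
block contributes to `ι_v α ∧ β`, a position `p + i` to `α ∧ ι_v β`. Moving `v` to the front of its
factor costs `(-1)^i`, which cancels against the sign of the permutation and leaves `(-1)^p` in the
second case. -/
theorem curryLeft_wedge {p q n : ℕ} (h : p + q = n + 1) (α β : Forms E) (v : E) :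
    (wedge h (α p) (β q)).curryLeft v =
      contractWedge n v α β p q + (-1 : ℝ) ^ p • wedgeContract n v α β p q := by
  ext w
  have hc : (wedge h (α p) (β q)).curryLeft v w = wedge h (α p) (β q) (Fin.cons v w) := rfl
  rw [hc, wedge_apply, ← (permInsert_bijective n).sum_comp, Fintype.sum_prod_type]
  simp only [cons_permInsert, sign_permInsert]
  rw [← (finCongr h).sum_comp, Fin.sum_univ_add, mul_add]
  simp only [ContinuousAlternatingMap.add_apply, ContinuousAlternatingMap.smul_apply]
  congr 1
  · cases p with
    | zero => simp [contractWedge]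
    | succ p =>
      have h' : p + q = n := by omega
      simp only [contractWedge, wedgeOr, dif_pos h', wedge_apply, finCongr_apply,
        insertNth_castAdd_castAdd h h', insertNth_castAdd_natAdd h h', map_insertNth,
        Fin.val_cast, Fin.val_castAdd]
      have key : ∀ i : Fin (p + 1), ∀ e : Equiv.Perm (Fin n),
          ((((-1) ^ (i : ℕ) * Equiv.Perm.sign e : ℤˣ) : ℤ) : ℝ) *
          ((-1) ^ (i : ℕ) * (α (p + 1)) (Fin.cons v fun j =>
              (w ∘ e) (Fin.cast h' (Fin.castAdd q j))) *
            (β q) fun j => (w ∘ e) (Fin.cast h' (Fin.natAdd p j))) =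
          ((Equiv.Perm.sign e : ℤ) : ℝ) *
            (((α (p + 1)).curryLeft v fun j => w (e (Fin.cast h' (Fin.castAdd q j)))) *
            (β q) fun j => w (e (Fin.cast h' (Fin.natAdd p j)))) := by
        intro i e
        have : (α (p + 1)).curryLeft v (fun j => w (e (Fin.cast h' (Fin.castAdd q j)))) =
          (α (p + 1)) (Fin.cons v fun j => (w ∘ e) (Fin.cast h' (Fin.castAdd q j))) := rfl
        rw [this]
        push_cast
        have h1 : ((-1 : ℝ) ^ (i : ℕ)) * (-1) ^ (i : ℕ) = 1 := by
          rw [← mul_pow]; simp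
        simp only [Function.comp_apply]
        linear_combination (((Equiv.Perm.sign e : ℤ) : ℝ) * ((α (p + 1)) (Fin.cons v fun j =>
            w (e (Fin.cast h' (Fin.castAdd q j)))) *
            (β q) fun j => w (e (Fin.cast h' (Fin.natAdd p j))))) * h1
      -- All `p + 1` positions contribute equally, and this factor turns `(p + 1)!` in the
      -- normalization into `p!`.
      simp only [key, Finset.sum_const, Finset.card_univ, Fintype.card_fin, nsmul_eq_mul,
        Nat.factorial_succ]
      have := Nat.factorial_ne_zero p
      have := Nat.factorial_ne_zero q
      push_cast
      field_simp
  · cases q with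
    | zero => simp [wedgeContract]
    | succ q =>
      have h' : p + q = n := by omega
      simp only [wedgeContract, wedgeOr, dif_pos h', wedge_apply, finCongr_apply,
        insertNth_natAdd_natAdd h h', insertNth_natAdd_castAdd h h', map_insertNth,
        Fin.val_cast, Fin.val_natAdd]
      have key : ∀ i : Fin (q + 1), ∀ e : Equiv.Perm (Fin n),
          ((((-1) ^ (p + i : ℕ) * Equiv.Perm.sign e : ℤˣ) : ℤ) : ℝ) *
          (((α p) fun j => (w ∘ e) (Fin.cast h' (Fin.castAdd q j))) *
            ((-1) ^ (i : ℕ) * (β (q + 1)) (Fin.cons v fun j =>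
                (w ∘ e) (Fin.cast h' (Fin.natAdd p j))))) =
          (-1) ^ p * (((Equiv.Perm.sign e : ℤ) : ℝ) *
            (((α p) fun j => w (e (Fin.cast h' (Fin.castAdd q j)))) *
            (β (q + 1)).curryLeft v fun j => w (e (Fin.cast h' (Fin.natAdd p j))))) := by
        intro i e
        have : (β (q + 1)).curryLeft v (fun j => w (e (Fin.cast h' (Fin.natAdd p j)))) =
          (β (q + 1)) (Fin.cons v fun j => (w ∘ e) (Fin.cast h' (Fin.natAdd p j))) := rfl
        rw [this]
        push_cast
        have h1 : ((-1 : ℝ) ^ (i : ℕ)) * (-1) ^ (i : ℕ) = 1 := by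
          rw [← mul_pow]; simp
        simp only [Function.comp_apply]
        linear_combination ((-1) ^ p * ((Equiv.Perm.sign e : ℤ) : ℝ) *
            (((α p) fun j => w (e (Fin.cast h' (Fin.castAdd q j)))) *
            (β (q + 1)) (Fin.cons v fun j => w (e (Fin.cast h' (Fin.natAdd p j)))))) * h1
      simp only [key, Finset.sum_const, Finset.card_univ, Fintype.card_fin, nsmul_eq_mul,
        Nat.factorial_succ, ← Finset.mul_sum, smul_eq_mul]
      have := Nat.factorial_ne_zero p
      have := Nat.factorial_ne_zero q
      push_cast
      field_simp

end Exterior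

/-! ### The exterior algebra and the exponential of an even form. -/

section ExteriorAlgebra

variable {E E' : Type*} [NormedAddCommGroup E] [NormedSpace ℝ E]
  [NormedAddCommGroup E'] [NormedSpace ℝ E']

theorem wedgeOr_add_left (n p q : ℕ) (α α' : E [⋀^Fin p]→L[ℝ] ℝ) (β : E [⋀^Fin q]→L[ℝ] ℝ) :
    wedgeOr n p q (α + α') β = wedgeOr n p q α β + wedgeOr n p q α' β := by
  unfold wedgeOr
  split_ifs with h
  · ext v
    simp only [ContinuousAlternatingMap.add_apply, wedge_apply, ← mul_add,
      ← Finset.sum_add_distrib, add_mul]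
  · simp

theorem wedgeOr_add_right (n p q : ℕ) (α : E [⋀^Fin p]→L[ℝ] ℝ) (β β' : E [⋀^Fin q]→L[ℝ] ℝ) :
    wedgeOr n p q α (β + β') = wedgeOr n p q α β + wedgeOr n p q α β' := by
  unfold wedgeOr
  split_ifs with h
  · ext v
    simp only [ContinuousAlternatingMap.add_apply, wedge_apply, ← mul_add,
      ← Finset.sum_add_distrib]
  · simp

theorem wedgeOr_smul_left (n p q : ℕ) (r : ℝ) (α : E [⋀^Fin p]→L[ℝ] ℝ)
    (β : E [⋀^Fin q]→L[ℝ] ℝ) : wedgeOr n p q (r • α) β = r • wedgeOr n p q α β := by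
  unfold wedgeOr
  split_ifs with h
  · ext v
    simp only [ContinuousAlternatingMap.smul_apply, wedge_apply, smul_eq_mul, Finset.mul_sum]
    exact Finset.sum_congr rfl fun σ _ => by ring
  · simp

theorem wedgeOr_smul_right (n p q : ℕ) (r : ℝ) (α : E [⋀^Fin p]→L[ℝ] ℝ)
    (β : E [⋀^Fin q]→L[ℝ] ℝ) : wedgeOr n p q α (r • β) = r • wedgeOr n p q α β := by
  unfold wedgeOr
  split_ifs with h
  · ext v
    simp only [ContinuousAlternatingMap.smul_apply, wedge_apply, smul_eq_mul, Finset.mul_sum]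
    exact Finset.sum_congr rfl fun σ _ => by ring
  · simp

namespace Forms

/-- `wedgeOr` removes the proof of `p + q = n` from the summands, so that the sum can be reindexed
and its terms rewritten. -/
theorem mul_apply (α β : Forms E) (n : ℕ) :
    mul α β n = ∑ c ∈ Finset.HasAntidiagonal.antidiagonal n, wedgeOr n c.1 c.2 (α c.1) (β c.2) := by
  rw [← Finset.sum_coe_sort]
  refine Finset.sum_congr rfl fun c _ => ?_
  rw [wedgeOr, dif_pos (Finset.HasAntidiagonal.mem_antidiagonal.1 c.2)]

theorem mul_congr {α α' β β' : Forms E} {n : ℕ} (hα : ∀ k ≤ n, α k = α' k)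
    (hβ : ∀ k ≤ n, β k = β' k) : mul α β n = mul α' β' n := by
  rw [mul_apply, mul_apply]
  refine Finset.sum_congr rfl fun c hc => ?_
  have := Finset.HasAntidiagonal.mem_antidiagonal.1 hc
  rw [hα c.1 (by omega), hβ c.2 (by omega)]

theorem add_mul (α β γ : Forms E) : mul (α + β) γ = mul α γ + mul β γ := by
  funext n
  simp only [mul_apply, Pi.add_apply, wedgeOr_add_left, Finset.sum_add_distrib]

theorem smul_mul (r : ℝ) (α β : Forms E) : mul (r • α) β = r • mul α β := by
  funext n
  simp only [mul_apply, Pi.smul_apply, wedgeOr_smul_left, Finset.smul_sum]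

theorem neg_mul (α β : Forms E) : mul (-α) β = -mul α β := by
  rw [← neg_one_smul ℝ α, smul_mul]
  exact neg_one_smul ℝ (mul α β)

theorem mul_neg (α β : Forms E) : mul α (-β) = -mul α β := by
  rw [← neg_one_smul ℝ β, mul_smul]
  exact neg_one_smul ℝ (mul α β)

theorem zero_mul (β : Forms E) : mul 0 β = 0 := by
  simpa using smul_mul 0 0 β

theorem mul_zero (β : Forms E) : mul β 0 = 0 := by
  simpa using mul_smul 0 β 0

theorem sub_mul (α β γ : Forms E) : mul (α - β) γ = mul α γ - mul β γ := by
  rw [sub_eq_add_neg, add_mul, neg_mul, ← sub_eq_add_neg]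

theorem mul_sub (α β γ : Forms E) : mul α (β - γ) = mul α β - mul α γ := by
  rw [sub_eq_add_neg, mul_add, mul_neg, ← sub_eq_add_neg]

/-- The main involution of the exterior algebra. -/
def grade (α : Forms E) : Forms E := fun k => (-1 : ℝ) ^ k • α k

theorem grade_add (α β : Forms E) : grade (α + β) = grade α + grade β := by
  funext k; simp [grade]

theorem grade_grade (α : Forms E) : grade (grade α) = α := by
  funext k
  simp only [grade, smul_smul, ← mul_pow]
  norm_num

theorem contract_neg (v : E) (α : Forms E) : contract v (-α) = -contract v α := by
  rw [← neg_one_smul ℝ α, contract_smul]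
  exact neg_one_smul ℝ (contract v α)

theorem contract_grade (v : E) (α : Forms E) : contract v (grade α) = -grade (contract v α) := by
  funext k
  ext w
  simp [contract, grade, pow_succ]

/-- The antiderivation property, summed over bidegrees. The terms of degree `0` in the contracted
factor drop out, which shifts the antidiagonal of `n + 1` to that of `n`. -/
theorem contract_mul (v : E) (α β : Forms E) :
    contract v (mul α β) = mul (contract v α) β + mul (grade α) (contract v β) := by
  have hc : ∀ (n p q : ℕ), p + q = n + 1 → (wedgeOr (n + 1) p q (α p) (β q)).curryLeft v =
      contractWedge n v α β p q + (-1 : ℝ) ^ p • wedgeContract n v α β p q := by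
    intro n p q h
    rw [wedgeOr, dif_pos h, curryLeft_wedge]
  funext n
  have h1 : contract v (mul α β) n = ∑ c ∈ Finset.HasAntidiagonal.antidiagonal (n + 1),
      (wedgeOr (n + 1) c.1 c.2 (α c.1) (β c.2)).curryLeft v := by
    ext w
    simp [contract, mul_apply]
  rw [h1, Finset.sum_congr rfl fun c hc' => hc n c.1 c.2
      (Finset.HasAntidiagonal.mem_antidiagonal.1 hc'),
    Finset.sum_add_distrib, Finset.Nat.sum_antidiagonal_succ, Finset.Nat.sum_antidiagonal_succ',
    Pi.add_apply, mul_apply, mul_apply]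
  simp only [contractWedge, wedgeContract, zero_add, smul_zero, grade, wedgeOr_smul_left, contract]

/-- The induction principle for the exterior algebra: an identity whose interior products reduce to
identities of lower degree has to be checked only in degree `0`. -/
theorem apply_succ_eq {α β : Forms E} {n : ℕ} (h : ∀ v, contract v α n = contract v β n) :
    α (n + 1) = β (n + 1) := by
  ext w
  have := congrArg (fun a : E [⋀^Fin n]→L[ℝ] ℝ => a (Fin.tail w)) (h (w 0))
  simp only [contract, ContinuousAlternatingMap.curryLeft_apply_apply] at this
  simpa [Matrix.vecCons] using this

theorem mul_apply_zero (α β : Forms E) (v : Fin 0 → E) : mul α β 0 v = α 0 v * β 0 v := by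
  rw [mul_apply, Finset.Nat.antidiagonal_zero, Finset.sum_singleton, wedgeOr,
    dif_pos (show (0, 0).1 + (0, 0).2 = 0 from rfl), wedge_apply]
  have h1 : ∀ w : Fin 0 → E, w = v := fun w => Subsingleton.elim _ _
  simp [h1]

theorem mul_apply_zero_congr {α β α' β' : Forms E} (h : ∀ v, α 0 v * β 0 v = α' 0 v * β' 0 v) :
    mul α β 0 = mul α' β' 0 := by
  ext v; rw [mul_apply_zero, mul_apply_zero, h]

theorem grade_mul (α β : Forms E) : grade (mul α β) = mul (grade α) (grade β) := by
  funext n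
  simp only [grade, mul_apply, Finset.smul_sum]
  refine Finset.sum_congr rfl fun c hc => ?_
  rw [wedgeOr_smul_left, wedgeOr_smul_right, smul_smul, ← pow_add,
      Finset.HasAntidiagonal.mem_antidiagonal.1 hc]

theorem contract_comap (L : E →L[ℝ] E') (v : E) (ρ : Forms E') :
    contract v (comap L ρ) = comap L (contract (L v) ρ) := by
  funext k
  exact curryLeft_comp (ρ (k + 1)) L v (L v) rfl

theorem comap_add (L : E →L[ℝ] E') (α β : Forms E') : comap L (α + β) = comap L α + comap L β := by
  funext k; ext v; simp [comap]

theorem comap_smul (L : E →L[ℝ] E') (r : ℝ) (α : Forms E') : comap L (r • α) = r • comap L α := by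
  funext k; ext v; simp [comap]

theorem comap_grade (L : E →L[ℝ] E') (α : Forms E') : comap L (grade α) = grade (comap L α) := by
  funext k; ext v; simp [comap, grade]

theorem comap_mul (L : E →L[ℝ] E') (α β : Forms E') :
    comap L (mul α β) = mul (comap L α) (comap L β) := by
  funext n
  induction n generalizing α β with
  | zero => ext v; simp [comap, mul_apply_zero]
  | succ n ih =>
    refine apply_succ_eq fun v => ?_
    simp only [contract_comap, contract_mul, comap_add, Pi.add_apply, ih, ← comap_grade]

theorem mul_assoc (α β γ : Forms E) : mul (mul α β) γ = mul α (mul β γ) := by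
  funext n
  induction n generalizing α β γ with
  | zero => ext v; simp only [mul_apply_zero, _root_.mul_assoc]
  | succ n ih =>
    refine apply_succ_eq fun v => ?_
    simp only [contract_mul, add_mul, mul_add, Pi.add_apply, ih, grade_mul, add_assoc]

theorem apply_zero_of_odd {α : Forms E} (h : grade α = -α) : α 0 = 0 := by
  have := congrFun h 0
  simp only [grade, pow_zero, one_smul, Pi.neg_apply] at this
  ext v
  have := congrArg (fun a : E [⋀^Fin 0]→L[ℝ] ℝ => a v) this
  simp only [ContinuousAlternatingMap.neg_apply] at this
  change α 0 v = 0
  linarith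

/-- Interior products exchange even and odd forms, so the two cases of graded commutativity have to
be carried through the induction together. -/
theorem mul_comm_aux (n : ℕ) :
    (∀ α β : Forms E, grade α = α → mul α β n = mul β α n) ∧
    ∀ α β : Forms E, grade α = -α → mul α β n = mul (grade β) α n := by
  induction n with
  | zero =>
    refine ⟨fun α β _ => mul_apply_zero_congr fun v => mul_comm _ _, fun α β h => ?_⟩
    refine mul_apply_zero_congr fun v => ?_
    simp [apply_zero_of_odd h]
  | succ n ih =>
    refine ⟨fun α β h => apply_succ_eq fun v => ?_, fun α β h => apply_succ_eq fun v => ?_⟩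
    · have hodd : grade (contract v α) = -contract v α := by
        rw [← neg_eq_iff_eq_neg, ← contract_grade, h]
      simp only [contract_mul, Pi.add_apply, h, ih.2 _ _ hodd, ih.1 _ (contract v β) h]
      rw [add_comm]
    · have heven : grade (contract v α) = contract v α := by
        rw [← neg_eq_iff_eq_neg.2 (contract_grade v α), h, contract_neg, neg_neg]
      simp only [contract_mul, Pi.add_apply, h, ih.1 _ β heven, contract_grade, grade_grade,
          neg_mul,
        Pi.neg_apply, ih.2 _ (contract v β) h]
      rw [add_comm]

theorem mul_comm_of_even {α : Forms E} (h : grade α = α) (β : Forms E) : mul α β = mul β α :=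
  funext fun n => (mul_comm_aux n).1 α β h

theorem mul_comm_of_odd {α : Forms E} (h : grade α = -α) (β : Forms E) :
    mul α β = mul (grade β) α :=
  funext fun n => (mul_comm_aux n).2 α β h

/-- The unit of the exterior algebra. -/
def one : Forms E := ofDegree 0 (ContinuousAlternatingMap.constOfIsEmpty ℝ E (Fin 0) 1)

theorem ofDegree_same (k : ℕ) (a : E [⋀^Fin k]→L[ℝ] ℝ) : ofDegree k a k = a := by
  simp [ofDegree]

theorem ofDegree_of_ne {k n : ℕ} (h : n ≠ k) (a : E [⋀^Fin k]→L[ℝ] ℝ) : ofDegree k a n = 0 := by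
  simp [ofDegree, h]

theorem ofDegree_add (k : ℕ) (a b : E [⋀^Fin k]→L[ℝ] ℝ) :
    ofDegree k (a + b) = ofDegree k a + ofDegree k b := Pi.single_add _ _ _

theorem ofDegree_zero (k : ℕ) : ofDegree k (0 : E [⋀^Fin k]→L[ℝ] ℝ) = 0 := Pi.single_zero _

theorem ofDegree_smul (k : ℕ) (r : ℝ) (a : E [⋀^Fin k]→L[ℝ] ℝ) :
    ofDegree k (r • a) = r • ofDegree k a := Pi.single_smul _ _ _

theorem grade_ofDegree (k : ℕ) (a : E [⋀^Fin k]→L[ℝ] ℝ) :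
    grade (ofDegree k a) = (-1 : ℝ) ^ k • ofDegree k a := by
  funext n
  by_cases h : n = k
  · subst h; simp [grade, ofDegree_same]
  · simp only [grade, Pi.smul_apply, ofDegree_of_ne h, smul_zero]

theorem contract_ofDegree (k : ℕ) (v : E) (a : E [⋀^Fin (k + 1)]→L[ℝ] ℝ) :
    contract v (ofDegree (k + 1) a) = ofDegree k (a.curryLeft v) := by
  funext n
  by_cases h : n = k
  · subst h; simp [contract, ofDegree_same]
  · have : n + 1 ≠ k + 1 := by omega
    ext w
    simp [contract, ofDegree_of_ne h, ofDegree_of_ne this]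

theorem contract_ofDegree_zero (v : E) (a : E [⋀^Fin 0]→L[ℝ] ℝ) :
    contract v (ofDegree 0 a) = 0 := by
  funext n
  ext w
  simp [contract, ofDegree_of_ne (Nat.succ_ne_zero n)]

theorem comap_ofDegree (L : E →L[ℝ] E') (k : ℕ) (a : E' [⋀^Fin k]→L[ℝ] ℝ) :
    comap L (ofDegree k a) = ofDegree k (a.compContinuousLinearMap L) := by
  funext n
  by_cases h : n = k
  · subst h; simp [comap, ofDegree_same]
  · ext w
    simp [comap, ofDegree_of_ne h]

theorem one_mul (α : Forms E) : mul one α = α := by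
  funext n
  induction n generalizing α with
  | zero => ext v; simp [mul_apply_zero, one, ofDegree_same]
  | succ n ih =>
    refine apply_succ_eq fun v => ?_
    have : grade (one : Forms E) = one := by simp [one, grade_ofDegree]
    rw [contract_mul, this, one, contract_ofDegree_zero, zero_mul, zero_add, ← one, ih]

theorem mul_one (α : Forms E) : mul α one = α := by
  have : grade (one : Forms E) = one := by simp [one, grade_ofDegree]
  rw [← mul_comm_of_even this, one_mul]

theorem pow_zero' (a : Forms E) : pow a 0 = one := rfl

theorem pow_succ' (a : Forms E) (j : ℕ) : pow a (j + 1) = mul a (pow a j) := rfl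

theorem grade_pow {a : Forms E} (h : grade a = a) (j : ℕ) : grade (pow a j) = pow a j := by
  induction j with
  | zero => simp [pow_zero', one, grade_ofDegree]
  | succ j ih => rw [pow_succ', grade_mul, h, ih]

theorem grade_exp {a : Forms E} (h : grade a = a) : grade (exp a) = exp a := by
  funext n
  simp only [grade, exp, Finset.smul_sum]
  refine Finset.sum_congr rfl fun j _ => ?_
  rw [smul_comm]
  congr 1
  exact congrFun (grade_pow h j) n

/-- Without a component of degree `0`, each further factor raises the lowest degree by at least one.
Hence the exponential series can be truncated at any sufficiently large index, as in
`exp_apply_of_le`. -/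
theorem pow_apply_of_lt {a : Forms E} (h0 : a 0 = 0) {j k : ℕ} (h : k < j) : pow a j k = 0 := by
  induction j generalizing k with
  | zero => omega
  | succ j ih =>
    rw [pow_succ', mul_apply]
    refine Finset.sum_eq_zero fun c hc => ?_
    have hc := Finset.HasAntidiagonal.mem_antidiagonal.1 hc
    obtain ⟨p, q⟩ := c
    rcases p with _ | p
    · dsimp only
      rw [h0]
      simpa using wedgeOr_smul_left k 0 q (0 : ℝ) 0 (pow a j q)
    · dsimp only at hc ⊢
      rw [ih (k := q) (by omega)]
      simpa using wedgeOr_smul_right k (p + 1) q (0 : ℝ) (a (p + 1)) 0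

theorem exp_apply_of_le {a : Forms E} (h0 : a 0 = 0) {k m : ℕ} (h : k ≤ m) :
    exp a k = ∑ j ∈ Finset.range (m + 1), ((j ! : ℝ)⁻¹) • pow a j k := by
  refine Finset.sum_subset (Finset.range_mono (by omega)) fun j _ hj => ?_
  rw [pow_apply_of_lt h0 (by simpa using hj), smul_zero]

theorem contract_pow {a : Forms E} (h : grade a = a) (v : E) (j : ℕ) :
    contract v (pow a (j + 1)) = ((j : ℝ) + 1) • mul (contract v a) (pow a j) := by
  induction j with
  | zero =>
    rw [pow_succ', contract_mul, pow_zero', one, contract_ofDegree_zero, mul_zero]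
    simp
  | succ j ih =>
    rw [pow_succ', contract_mul, ih, h, mul_smul, ← mul_assoc, mul_comm_of_even h, mul_assoc,
      ← pow_succ']
    push_cast
    module

theorem mul_sum (α : Forms E) {ι : Type*} (s : Finset ι) (β : ι → Forms E) :
    mul α (∑ i ∈ s, β i) = ∑ i ∈ s, mul α (β i) := by
  classical
  induction s using Finset.induction_on with
  | empty => simp [mul_zero]
  | insert i s hi ih => rw [Finset.sum_insert hi, Finset.sum_insert hi, mul_add, ih]

/-- An even form commutes with everything, so `ι_v` differentiates its powers as in a commutative
algebra, `ι_v (a^{j+1}) = (j + 1) ι_v a ∧ a^j`. To compare series, the exponential is replaced by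
one finite sum valid in all degrees up to `n`. -/
theorem contract_exp {a : Forms E} (h : grade a = a) (h0 : a 0 = 0) (v : E) :
    contract v (exp a) = mul (contract v a) (exp a) := by
  funext n
  have h1 : mul (contract v a) (exp a) n = mul (contract v a)
      (∑ j ∈ Finset.range (n + 1), ((j ! : ℝ)⁻¹) • pow a j) n := by
    refine mul_congr (fun _ _ => rfl) fun k hk => ?_
    rw [exp_apply_of_le h0 hk, Finset.sum_apply]
    rfl
  have h2 : contract v (exp a) n =
      ∑ j ∈ Finset.range (n + 2), ((j ! : ℝ)⁻¹) • contract v (pow a j) n := by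
    ext w
    simp [contract, exp]
  rw [h1, h2, mul_sum, Finset.sum_apply, Finset.sum_range_succ', pow_zero', one,
    contract_ofDegree_zero]
  simp only [Pi.zero_apply, smul_zero, add_zero]
  refine Finset.sum_congr rfl fun j _ => ?_
  rw [contract_pow h, mul_smul, Pi.smul_apply, Pi.smul_apply, smul_smul]
  congr 1
  have := Nat.factorial_ne_zero j
  rw [Nat.factorial_succ]
  push_cast
  field_simp

theorem exp_apply_zero (a : Forms E) : exp a 0 = one 0 := by
  simp [exp, pow_zero']

/-- Both sides are `1` in degree `0` and satisfy `ι_v ε = ι_v (a + b) ∧ ε`, which determines all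
higher degrees. The induction is strong because the right side of this equation in degree `n`
involves all components of `ε` of degree at most `n`. -/
theorem exp_add {a b : Forms E} (ha : grade a = a) (ha0 : a 0 = 0) (hb : grade b = b)
    (hb0 : b 0 = 0) : exp (a + b) = mul (exp a) (exp b) := by
  have hab : grade (a + b) = a + b := by rw [grade_add, ha, hb]
  have hab0 : (a + b) 0 = 0 := by simp [ha0, hb0]
  funext n
  induction n using Nat.strong_induction_on with
  | _ n ih =>
    rcases n with _ | n
    · ext v
      rw [mul_apply_zero]
      simp [exp_apply_zero, one, ofDegree_same]
    · refine apply_succ_eq fun v => ?_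
      rw [contract_exp hab hab0, contract_mul, contract_exp ha ha0, contract_exp hb hb0,
        grade_exp ha, ← mul_assoc, ← mul_comm_of_even (grade_exp ha),
            mul_comm_of_even (grade_exp ha)]
      rw [mul_congr (fun _ _ => rfl) fun k hk => ih k (by omega), contract_add, add_mul, mul_assoc,
        ← mul_assoc, mul_comm_of_even (grade_exp ha) (contract v b), mul_assoc, mul_assoc]

theorem comap_pow (L : E →L[ℝ] E') (a : Forms E') (j : ℕ) : comap L (pow a j) =
    pow (comap L a) j := by
  induction j with
  | zero =>
    rw [pow_zero', pow_zero', one, comap_ofDegree]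
    congr 1
  | succ j ih => rw [pow_succ', comap_mul, ih, pow_succ']

theorem comap_exp (L : E →L[ℝ] E') (a : Forms E') : comap L (exp a) = exp (comap L a) := by
  funext n
  simp only [exp, ← comap_pow]
  ext v
  simp [comap, exp]

theorem exp_zero : exp (0 : Forms E) = one := by
  funext n
  rw [exp, Finset.sum_range_succ', Finset.sum_eq_zero fun j _ => by
    rw [pow_succ', zero_mul, Pi.zero_apply, smul_zero]]
  simp [pow_zero']

theorem grade_ofDegree_two (b : E [⋀^Fin 2]→L[ℝ] ℝ) : grade (ofDegree 2 b) = ofDegree 2 b := by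
  simp [grade_ofDegree]

theorem ofDegree_two_zero (b : E [⋀^Fin 2]→L[ℝ] ℝ) : ofDegree 2 b 0 = 0 :=
  ofDegree_of_ne (by decide) b

theorem exp_ofDegree_add (a b : E [⋀^Fin 2]→L[ℝ] ℝ) :
    exp (ofDegree 2 (a + b)) = mul (exp (ofDegree 2 a)) (exp (ofDegree 2 b)) := by
  rw [ofDegree_add, exp_add] <;> simp [grade_ofDegree_two, ofDegree_two_zero]

end Forms

end ExteriorAlgebra

/-! ### Differential forms on a vector space. -/

section VectorSpaceCalculus

variable {E E' A : Type*} [NormedAddCommGroup E] [NormedSpace ℝ E]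
  [NormedAddCommGroup E'] [NormedSpace ℝ E'] [NormedAddCommGroup A] [NormedSpace ℝ A]

theorem contDiffAt_bilinear {B C D : Type*} [NormedAddCommGroup B] [NormedSpace ℝ B]
    [NormedAddCommGroup C] [NormedSpace ℝ C] [NormedAddCommGroup D] [NormedSpace ℝ D]
    (b : B →L[ℝ] C →L[ℝ] D) {m : ℕ∞ω} {f : A → B} {g : A → C} {z : A} (hf : ContDiffAt ℝ m f z)
    (hg : ContDiffAt ℝ m g z) : ContDiffAt ℝ m (fun y => b (f y) (g y)) z :=
  (b.contDiff.contDiffAt.comp z hf).clm_apply hg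

/-- The multilinear map underlying a continuous alternating form, as a linear map. -/
def toMultilinearLinear (E : Type*) [NormedAddCommGroup E] [NormedSpace ℝ E] (k : ℕ) :
    (E [⋀^Fin k]→L[ℝ] ℝ) →ₗ[ℝ] MultilinearMap ℝ (fun _ : Fin k => E) ℝ where
  toFun α := α.toAlternatingMap.toMultilinearMap
  map_add' _ _ := rfl
  map_smul' _ _ := rfl

instance instFiniteDimensionalForm [FiniteDimensional ℝ E] (k : ℕ) :
    FiniteDimensional ℝ (E [⋀^Fin k]→L[ℝ] ℝ) :=
  Module.Finite.of_injective (toMultilinearLinear E k) fun α β h => by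
    ext v
    exact congrArg (fun m : MultilinearMap ℝ (fun _ : Fin k => E) ℝ => m v) h

/-- The values on tuples of basis vectors embed the space of forms linearly in a finite-dimensional
space. A linear left inverse recovers the form from finitely many smooth functions. -/
theorem contDiffAt_form_of_apply [FiniteDimensional ℝ E] {k : ℕ} {n : ℕ∞ω}
    {θ : A → E [⋀^Fin k]→L[ℝ] ℝ} {z : A} (h : ∀ v, ContDiffAt ℝ n (fun y => θ y v) z) :
    ContDiffAt ℝ n θ z := by
  let b := Module.finBasis ℝ E
  let Φ : (E [⋀^Fin k]→L[ℝ] ℝ) →ₗ[ℝ] ((Fin k → Fin (Module.finrank ℝ E)) → ℝ) :=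
    { toFun := fun α j => α fun i => b (j i)
      map_add' := fun _ _ => rfl
      map_smul' := fun _ _ => rfl }
  have hΦ : LinearMap.ker Φ = ⊥ := by
    rw [LinearMap.ker_eq_bot]
    intro α β hαβ
    have : α.toAlternatingMap.toMultilinearMap = β.toAlternatingMap.toMultilinearMap :=
      Module.Basis.ext_multilinear (fun _ => b) fun j => congrFun hαβ j
    ext v
    exact congrArg (fun m : MultilinearMap ℝ (fun _ : Fin k => E) ℝ => m v) this
  obtain ⟨Ψ, hΨ⟩ := LinearMap.exists_leftInverse_of_injective Φ hΦ
  have hθ : θ = fun y => Ψ.toContinuousLinearMap (Φ (θ y)) := by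
    funext y
    exact (LinearMap.congr_fun hΨ (θ y)).symm
  rw [hθ]
  exact Ψ.toContinuousLinearMap.contDiff.contDiffAt.comp z (contDiffAt_pi.2 fun j => h _)

theorem contDiffAt_form_apply {k : ℕ} {n : ℕ∞ω} {θ : A → E [⋀^Fin k]→L[ℝ] ℝ}
    {w : Fin k → A → E} {z : A} (hθ : ContDiffAt ℝ n θ z) (hw : ∀ i, ContDiffAt ℝ n (w i) z) :
    ContDiffAt ℝ n (fun y => θ y fun i => w i y) z := by
  induction k with
  | zero =>
    have : (fun y => θ y fun i => w i y) =
        fun y => ContinuousAlternatingMap.apply ℝ E ℝ (0 : Fin 0 → E) (θ y) := by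
      funext y
      exact congrArg (θ y) (Subsingleton.elim _ _)
    rw [this]
    exact (ContinuousAlternatingMap.apply ℝ E ℝ _).contDiff.contDiffAt.comp z hθ
  | succ k ih =>
    have h1 : ContDiffAt ℝ n (fun y => (θ y).curryLeft (w 0 y)) z :=
      contDiffAt_bilinear (ContinuousAlternatingMap.curryLeftLI (𝕜 := ℝ) (E := E) (F := ℝ)
        (n := k)).toContinuousLinearMap hθ (hw 0)
    have h2 := ih h1 fun i => hw i.succ
    refine h2.congr_of_eventuallyEq (Eventually.of_forall fun y => ?_)
    simp only [ContinuousAlternatingMap.curryLeft_apply_apply]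
    congr 1
    funext i
    refine Fin.cases rfl (fun j => rfl) i

theorem contDiffAt_compContinuousLinearMap [FiniteDimensional ℝ E] {k : ℕ} {n : ℕ∞ω}
    {θ : A → E' [⋀^Fin k]→L[ℝ] ℝ} {L : A → E →L[ℝ] E'} {z : A} (hθ : ContDiffAt ℝ n θ z)
    (hL : ContDiffAt ℝ n L z) :
    ContDiffAt ℝ n (fun y => (θ y).compContinuousLinearMap (L y)) z :=
  contDiffAt_form_of_apply fun v => contDiffAt_form_apply (w := fun i y => L y (v i)) hθ
    fun _ => hL.clm_apply contDiffAt_const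

/-- The wedge product as a continuous bilinear map. -/
def wedgeL (E : Type*) [NormedAddCommGroup E] [NormedSpace ℝ E] [FiniteDimensional ℝ E]
    (n p q : ℕ) : (E [⋀^Fin p]→L[ℝ] ℝ) →L[ℝ] (E [⋀^Fin q]→L[ℝ] ℝ) →L[ℝ] E [⋀^Fin n]→L[ℝ] ℝ :=
  LinearMap.toContinuousBilinearMap (LinearMap.mk₂ ℝ (wedgeOr n p q) (wedgeOr_add_left n p q)
    (fun r => wedgeOr_smul_left n p q r) (wedgeOr_add_right n p q)
    fun r => wedgeOr_smul_right n p q r)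

theorem wedgeL_apply [FiniteDimensional ℝ E] (n p q : ℕ) (α : E [⋀^Fin p]→L[ℝ] ℝ)
    (β : E [⋀^Fin q]→L[ℝ] ℝ) : wedgeL E n p q α β = wedgeOr n p q α β := rfl

namespace Forms

theorem contDiffAt_mul [FiniteDimensional ℝ E] {m : ℕ∞ω} {α β : A → Forms E} {z : A}
    (hα : ∀ k, ContDiffAt ℝ m (fun y => α y k) z) (hβ : ∀ k, ContDiffAt ℝ m (fun y => β y k) z)
    (n : ℕ) : ContDiffAt ℝ m (fun y => mul (α y) (β y) n) z := by
  simp only [mul_apply, ← wedgeL_apply]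
  exact ContDiffAt.sum fun c _ => contDiffAt_bilinear (wedgeL E n c.1 c.2) (hα c.1) (hβ c.2)

theorem hasFDerivAt_mul [FiniteDimensional ℝ E] {α β : A → Forms E} {z : A}
    (hα : ∀ k, DifferentiableAt ℝ (fun y => α y k) z)
    (hβ : ∀ k, DifferentiableAt ℝ (fun y => β y k) z) (n : ℕ) :
    HasFDerivAt (fun y => mul (α y) (β y) n) (∑ c ∈ Finset.HasAntidiagonal.antidiagonal n,
      ((wedgeL E n c.1 c.2).precompR A (α z c.1) (fderiv ℝ (fun y => β y c.2) z) +
        (wedgeL E n c.1 c.2).precompL A (fderiv ℝ (fun y => α y c.1) z) (β z c.2))) z := by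
  simp only [mul_apply, ← wedgeL_apply]
  exact HasFDerivAt.fun_sum fun c _ => ContinuousLinearMap.hasFDerivAt_of_bilinear _
    (hα c.1).hasFDerivAt (hβ c.2).hasFDerivAt

/-- The derivative of a field of forms in the direction `v`. -/
def dirD (v : A) (θ : A → Forms E) (z : A) : Forms E := fun k => fderiv ℝ (fun y => θ y k) z v

theorem dirD_mul [FiniteDimensional ℝ E] (v : A) {α β : A → Forms E} {z : A}
    (hα : ∀ k, DifferentiableAt ℝ (fun y => α y k) z)
    (hβ : ∀ k, DifferentiableAt ℝ (fun y => β y k) z) :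
    dirD v (fun y => mul (α y) (β y)) z = mul (dirD v α z) (β z) + mul (α z) (dirD v β z) := by
  funext n
  rw [dirD, (hasFDerivAt_mul hα hβ n).fderiv, _root_.sum_apply, Pi.add_apply,
    mul_apply, mul_apply, ← Finset.sum_add_distrib]
  refine Finset.sum_congr rfl fun c _ => ?_
  rw [add_comm]
  rfl

/-- The exterior derivative of a field of inhomogeneous forms on a vector space. -/
def extDV (θ : E → Forms E) (z : E) : Forms E
  | 0 => 0
  | k + 1 => extDeriv (fun y => θ y k) z

/-- Cartan's formula for the constant field `v`. In the alternating sum defining `dθ(v, w)`, the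
first term is the derivative of `θ` along `v`, and the remaining terms make up `-d(ι_v θ)(w)`. -/
theorem contract_extDV (v : E) {θ : E → Forms E} {z : E}
    (hθ : ∀ k, DifferentiableAt ℝ (fun y => θ y k) z) :
    contract v (extDV θ z) = dirD v θ z - extDV (fun y => contract v (θ y)) z := by
  funext k
  rcases k with _ | k
  · ext w
    simp [contract, extDV, dirD, extDeriv, ContinuousAlternatingMap.alternatizeUncurryFin_apply,
      Subsingleton.elim _ w]
  · have hf : fderiv ℝ (fun y => contract v (θ y) k) z =
        ((ContinuousLinearMap.apply ℝ (E [⋀^Fin k]→L[ℝ] ℝ) v).comp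
          (ContinuousAlternatingMap.curryLeftLI (𝕜 := ℝ) (E := E) (F := ℝ)
            (n := k)).toContinuousLinearMap).comp (fderiv ℝ (fun y => θ y (k + 1)) z) :=
      (((ContinuousLinearMap.apply ℝ (E [⋀^Fin k]→L[ℝ] ℝ) v).comp
          (ContinuousAlternatingMap.curryLeftLI (𝕜 := ℝ) (E := E) (F := ℝ)
            (n := k)).toContinuousLinearMap).hasFDerivAt.comp z (hθ (k + 1)).hasFDerivAt).fderiv
    ext w
    simp only [contract, extDV, dirD, Pi.sub_apply, ContinuousAlternatingMap.sub_apply,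
      ContinuousAlternatingMap.curryLeft_apply_apply, extDeriv]
    simp only [contract] at hf
    rw [hf, ContinuousAlternatingMap.alternatizeUncurryFin_apply,
      ContinuousAlternatingMap.alternatizeUncurryFin_apply, Fin.sum_univ_succ, sub_eq_add_neg,
      ← Finset.sum_neg_distrib]
    congr 1
    · simp [Matrix.vecCons, Fin.removeNth_zero]
    · refine Finset.sum_congr rfl fun i _ => ?_
      simp only [Matrix.vecCons, Fin.cons_succ, Fin.val_succ, pow_succ]
      have : (i.succ.removeNth (Fin.cons v w : Fin (k + 2) → E)) = Fin.cons v (i.removeNth w) := by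
        funext j
        refine Fin.cases ?_ (fun j => ?_) j <;> simp [Fin.removeNth]
      rw [this]
      simp
      rfl

theorem extDV_add {α β : E → Forms E} {z : E}
    (hα : ∀ k, DifferentiableAt ℝ (fun y => α y k) z)
    (hβ : ∀ k, DifferentiableAt ℝ (fun y => β y k) z) :
    extDV (fun y => α y + β y) z = extDV α z + extDV β z := by
  funext k
  rcases k with _ | k
  · simp [extDV]
  · exact extDeriv_fun_add (hα k) (hβ k)

theorem differentiableAt_grade {α : A → Forms E} {z : A}
    (hα : ∀ k, DifferentiableAt ℝ (fun y => α y k) z) (k : ℕ) :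
    DifferentiableAt ℝ (fun y => grade (α y) k) z :=
  (hα k).const_smul ((-1 : ℝ) ^ k)

theorem differentiableAt_contract (v : E) {α : A → Forms E} {z : A}
    (hα : ∀ k, DifferentiableAt ℝ (fun y => α y k) z) (k : ℕ) :
    DifferentiableAt ℝ (fun y => contract v (α y) k) z :=
  (((ContinuousLinearMap.apply ℝ (E [⋀^Fin k]→L[ℝ] ℝ) v).comp
    (ContinuousAlternatingMap.curryLeftLI (𝕜 := ℝ) (E := E) (F := ℝ)
      (n := k)).toContinuousLinearMap).differentiableAt).comp z (hα (k + 1))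

theorem extDV_grade (α : E → Forms E) (z : E) :
    extDV (fun y => grade (α y)) z = -grade (extDV α z) := by
  funext k
  rcases k with _ | k
  · simp [extDV, grade]
  · have h : extDeriv (fun y => (-1 : ℝ) ^ k • α y k) z =
        (-1 : ℝ) ^ k • extDeriv (fun y => α y k) z :=
      extDeriv_smul _ _
    change extDeriv (fun y => (-1 : ℝ) ^ k • α y k) z =
      -((-1 : ℝ) ^ (k + 1) • extDeriv (fun y => α y k) z)
    rw [h, pow_succ]
    module

/-- The Leibniz rule for the exterior derivative on a vector space. -/
theorem extDV_mul [FiniteDimensional ℝ E] {α β : E → Forms E} {z : E}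
    (hα : ∀ k, DifferentiableAt ℝ (fun y => α y k) z)
    (hβ : ∀ k, DifferentiableAt ℝ (fun y => β y k) z) :
    extDV (fun y => mul (α y) (β y)) z =
      mul (extDV α z) (β z) + mul (grade (α z)) (extDV β z) := by
  have hm : ∀ {α β : E → Forms E}, (∀ k, DifferentiableAt ℝ (fun y => α y k) z) →
      (∀ k, DifferentiableAt ℝ (fun y => β y k) z) →
      ∀ k, DifferentiableAt ℝ (fun y => mul (α y) (β y) k) z := fun hα hβ k =>
    (hasFDerivAt_mul hα hβ k).differentiableAt
  funext n
  induction n generalizing α β with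
  | zero =>
    ext v
    rw [Pi.add_apply, ContinuousAlternatingMap.add_apply, mul_apply_zero, mul_apply_zero]
    simp [extDV]
  | succ n ih =>
    refine apply_succ_eq fun v => ?_
    have hcα := differentiableAt_contract v hα
    have hcβ := differentiableAt_contract v hβ
    have hgα := differentiableAt_grade hα
    -- Cartan's formula turns `ι_v d(α ∧ β)` into the product rule for the derivative along `v`,
    -- minus `d` of `ι_v α ∧ β` and of `α ∧ ι_v β` with its sign. The induction hypothesis applies
    -- to these two products one degree lower.
    rw [contract_extDV v (hm hα hβ), dirD_mul v hα hβ]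
    simp only [contract_mul]
    rw [Pi.sub_apply, extDV_add (hm hcα hβ) (hm hgα hcβ), Pi.add_apply, Pi.add_apply, ih hcα hβ,
      ih hgα hcβ, contract_add, contract_mul, contract_mul, contract_extDV v hα,
      contract_extDV v hβ, grade_grade, contract_grade, extDV_grade]
    simp only [Pi.add_apply, sub_mul, mul_sub, neg_mul, Pi.sub_apply, Pi.neg_apply]
    abel

end Forms

end VectorSpaceCalculus

/-! ### Charts, pull-backs and the exterior derivative on manifolds. -/

section ManifoldCalculus

variable {E M : Type*} [NormedAddCommGroup E] [NormedSpace ℝ E]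
  [TopologicalSpace M] [ChartedSpace E M] [IsManifold 𝓘(ℝ, E) ∞ M]
  {E' N : Type*} [NormedAddCommGroup E'] [NormedSpace ℝ E']
  [TopologicalSpace N] [ChartedSpace E' N] [IsManifold 𝓘(ℝ, E') ∞ N]

theorem chart_mdifferentiable (x₀ : M) :
    (chartAt E x₀).MDifferentiable 𝓘(ℝ, E) 𝓘(ℝ, E) := mdifferentiable_chart x₀

theorem diff_comp {E₁ E₂ E₃ M₁ M₂ M₃ : Type*} [NormedAddCommGroup E₁] [NormedSpace ℝ E₁]
    [NormedAddCommGroup E₂] [NormedSpace ℝ E₂] [NormedAddCommGroup E₃] [NormedSpace ℝ E₃]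
    [TopologicalSpace M₁] [ChartedSpace E₁ M₁] [TopologicalSpace M₂] [ChartedSpace E₂ M₂]
    [TopologicalSpace M₃] [ChartedSpace E₃ M₃] {g : M₂ → M₃} {f : M₁ → M₂} {x : M₁}
    (hg : MDifferentiableAt 𝓘(ℝ, E₂) 𝓘(ℝ, E₃) g (f x))
    (hf : MDifferentiableAt 𝓘(ℝ, E₁) 𝓘(ℝ, E₂) f x) :
    diff (E := E₁) (E' := E₃) (g ∘ f) x =
      (diff (E := E₂) (E' := E₃) g (f x)).comp (diff (E := E₁) (E' := E₂) f x) :=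
  mfderiv_comp x hg hf

theorem diff_chart_symm_comp (x₀ : M) {x : M} (hx : x ∈ (chartAt E x₀).source) :
    (diff (E := E) (E' := E) (chartAt E x₀).symm (chartAt E x₀ x)).comp
      (diff (E := E) (E' := E) (chartAt E x₀) x) = ContinuousLinearMap.id ℝ E :=
  (chart_mdifferentiable x₀).symm_comp_deriv hx

theorem diff_chart_comp_symm (x₀ : M) {y : E} (hy : y ∈ (chartAt E x₀).target) :
    (diff (E := E) (E' := E) (chartAt E x₀) ((chartAt E x₀).symm y)).comp
      (diff (E := E) (E' := E) (chartAt E x₀).symm y) = ContinuousLinearMap.id ℝ E :=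
  (chart_mdifferentiable x₀).comp_symm_deriv hy

namespace FormField

/-- The pull-back of `ρ` to a vector space along `g` is locally the pull-back of its chart
representative along `chart ∘ g`. This reduces questions on manifolds to vector spaces; the relevant
`g` are inverse charts and their composites with `f`. -/
theorem pulled_eventuallyEq {A : Type*} [NormedAddCommGroup A] [NormedSpace ℝ A]
    (ρ : FormField E M) {g : A → M} {y : A} (hg : ContMDiffAt 𝓘(ℝ, A) 𝓘(ℝ, E) ∞ g y) (k : ℕ) :
    (fun z => (ρ (g z) k).compContinuousLinearMap (diff (E := A) (E' := E) g z)) =ᶠ[𝓝 y]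
      fun z => (inChart ρ (g y) k ((chartAt E (g y) ∘ g) z)).compContinuousLinearMap
        (fderiv ℝ (chartAt E (g y) ∘ g) z) := by
  have h1 : ∀ᶠ z in 𝓝 y, g z ∈ (chartAt E (g y)).source :=
    hg.continuousAt.preimage_mem_nhds
      ((chartAt E (g y)).open_source.mem_nhds (mem_chart_source E _))
  have h2 : ∀ᶠ z in 𝓝 y, ContMDiffAt 𝓘(ℝ, A) 𝓘(ℝ, E) 1 g z :=
    contMDiffAt_iff_contMDiffAt_nhds (by simp) |>.1 (hg.of_le (m := 1) (by simp))
  filter_upwards [h1, h2] with z hz hz'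
  have hd : fderiv ℝ (chartAt E (g y) ∘ g) z =
      (diff (E := E) (E' := E) (chartAt E (g y)) (g z)).comp (diff (E := A) (E' := E) g z) := by
    rw [← mfderiv_eq_fderiv]
    exact diff_comp ((chart_mdifferentiable (g y)).mdifferentiableAt hz)
      (hz'.mdifferentiableAt (by simp))
  have hc := diff_chart_symm_comp (g y) hz
  ext v
  simp only [inChart, ContinuousAlternatingMap.compContinuousLinearMap_apply, Function.comp_apply,
    (chartAt E (g y)).left_inv hz, hd]
  congr 1
  funext i
  exact (DFunLike.congr_fun hc (diff (E := A) (E' := E) g z (v i))).symm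

theorem contDiffAt_chart_comp {A : Type*} [NormedAddCommGroup A] [NormedSpace ℝ A]
    {g : A → M} {y : A} (hg : ContMDiffAt 𝓘(ℝ, A) 𝓘(ℝ, E) ∞ g y) :
    ContDiffAt ℝ ∞ (chartAt E (g y) ∘ g) y := by
  rw [← contMDiffAt_iff_contDiffAt]
  exact (contMDiffAt_of_mem_maximalAtlas (IsManifold.chart_mem_maximalAtlas (g y))
    (mem_chart_source E (g y))).comp y hg

theorem IsSmooth.contDiffAt {ρ : FormField E M} (hρ : IsSmooth ρ) (x₀ : M) (k : ℕ) {y : E}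
    (hy : y ∈ (chartAt E x₀).target) : ContDiffAt ℝ ∞ (inChart ρ x₀ k) y :=
  (hρ x₀ k).contDiffAt ((chartAt E x₀).open_target.mem_nhds hy)

theorem contDiffAt_pulled {A : Type*} [NormedAddCommGroup A] [NormedSpace ℝ A]
    [FiniteDimensional ℝ A] {ρ : FormField E M} (hρ : IsSmooth ρ) {g : A → M} {y : A}
    (hg : ContMDiffAt 𝓘(ℝ, A) 𝓘(ℝ, E) ∞ g y) (k : ℕ) :
    ContDiffAt ℝ ∞ (fun z => (ρ (g z) k).compContinuousLinearMap (diff (E := A) (E' := E) g z))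
      y := by
  refine ContDiffAt.congr_of_eventuallyEq ?_ (pulled_eventuallyEq ρ hg k)
  have hc := contDiffAt_chart_comp hg
  refine contDiffAt_compContinuousLinearMap ?_ (hc.fderiv_right (by simp))
  exact (hρ.contDiffAt (g y) k (mem_chart_target E (g y))).comp y hc

/-- Naturality of `d` between vector spaces, transported by `pulled_eventuallyEq`. It yields both
the independence of `extD` from the chart and its compatibility with pull-backs. -/
theorem extDeriv_pulled {A : Type*} [NormedAddCommGroup A] [NormedSpace ℝ A]
    {ρ : FormField E M} (hρ : IsSmooth ρ) {g : A → M} {y : A}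
    (hg : ContMDiffAt 𝓘(ℝ, A) 𝓘(ℝ, E) ∞ g y) (k : ℕ) :
    extDeriv (fun z => (ρ (g z) k).compContinuousLinearMap (diff (E := A) (E' := E) g z)) y =
      (extD ρ (g y) (k + 1)).compContinuousLinearMap (diff (E := A) (E' := E) g y) := by
  have hc := contDiffAt_chart_comp hg
  rw [(pulled_eventuallyEq ρ hg k).extDeriv_eq]
  rw [extDeriv_pullback (r := ∞) (f := chartAt E (g y) ∘ g)
    (hρ.differentiableAt (g y) k) hc (by simpa using ENat.LEInfty.out)]
  have hd : fderiv ℝ (chartAt E (g y) ∘ g) y =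
      (diff (E := E) (E' := E) (chartAt E (g y)) (g y)).comp (diff (E := A) (E' := E) g y) := by
    rw [← mfderiv_eq_fderiv]
    exact diff_comp ((chart_mdifferentiable (g y)).mdifferentiableAt (mem_chart_source E _))
      (hg.mdifferentiableAt (by simp))
  rw [hd]
  rfl

theorem contMDiffAt_chart_symm (x₀ : M) {y : E} (hy : y ∈ (chartAt E x₀).target) :
    ContMDiffAt 𝓘(ℝ, E) 𝓘(ℝ, E) ∞ (chartAt E x₀).symm y :=
  (contMDiffOn_chart_symm y hy).contMDiffAt ((chartAt E x₀).open_target.mem_nhds hy)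

/-- `extD` uses a different chart at every point; taking `g` to be the inverse of a fixed chart
shows that this one chart computes it throughout its domain. -/
theorem inChart_extD {ρ : FormField E M} (hρ : IsSmooth ρ) (x₀ : M) (k : ℕ) {y : E}
    (hy : y ∈ (chartAt E x₀).target) :
    inChart (extD ρ) x₀ (k + 1) y = extDeriv (inChart ρ x₀ k) y :=
  (extDeriv_pulled hρ (contMDiffAt_chart_symm x₀ hy) k).symm

theorem isSmooth_extD {ρ : FormField E M} (hρ : IsSmooth ρ) : IsSmooth (extD ρ) := by
  intro x₀ k
  rcases k with _ | k
  · refine (contDiffOn_const (c := 0)).congr fun y _ => ?_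
    ext v
    simp [inChart, extD]
  · refine ContDiffOn.congr ?_ fun y hy => inChart_extD hρ x₀ k hy
    intro y hy
    refine ContDiffAt.contDiffWithinAt ?_
    exact (ContinuousAlternatingMap.alternatizeUncurryFinCLM ℝ E ℝ).contDiff.contDiffAt.comp y
      ((hρ.contDiffAt x₀ k hy).fderiv_right (m := ∞) (by simp))

theorem inChart_pullback {f : M → N} (hf : ContMDiff 𝓘(ℝ, E) 𝓘(ℝ, E') ∞ f) (ρ : FormField E' N)
    (x₀ : M) (k : ℕ) {y : E} (hy : y ∈ (chartAt E x₀).target) :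
    inChart (pullback f ρ : FormField E M) x₀ k y =
      (ρ ((f ∘ (chartAt E x₀).symm) y) k).compContinuousLinearMap
        (diff (E := E) (E' := E') (f ∘ (chartAt E x₀).symm) y) := by
  rw [diff_comp (hf.mdifferentiable (by simp) _)
    ((contMDiffAt_chart_symm x₀ hy).mdifferentiableAt (by simp))]
  rfl

theorem isSmooth_pullback [FiniteDimensional ℝ E] {f : M → N}
    (hf : ContMDiff 𝓘(ℝ, E) 𝓘(ℝ, E') ∞ f) {ρ : FormField E' N} (hρ : IsSmooth ρ) :
    IsSmooth (pullback f ρ : FormField E M) := by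
  intro x₀ k
  refine ContDiffOn.congr ?_ fun y hy => inChart_pullback hf ρ x₀ k hy
  intro y hy
  exact (contDiffAt_pulled hρ (hf.contMDiffAt.comp y (contMDiffAt_chart_symm x₀ hy))
    k).contDiffWithinAt

/-- In the chart at `x` the pulled-back form is the pull-back along `f ∘ chart⁻¹`, a map out of a
vector space, to which `extDeriv_pulled` applies. -/
theorem extD_pullback {f : M → N} (hf : ContMDiff 𝓘(ℝ, E) 𝓘(ℝ, E') ∞ f) {ρ : FormField E' N}
    (hρ : IsSmooth ρ) : extD (pullback f ρ : FormField E M) = pullback f (extD ρ) := by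
  funext x k
  rcases k with _ | k
  · ext v
    simp [extD, pullback, Forms.comap]
  · have hy := mem_chart_target E x
    have hsx : (chartAt E x).symm (chartAt E x x) = x :=
      (chartAt E x).left_inv (mem_chart_source E x)
    have h1 : inChart (pullback f ρ : FormField E M) x k =ᶠ[𝓝 (chartAt E x x)] fun y =>
        (ρ ((f ∘ (chartAt E x).symm) y) k).compContinuousLinearMap
        (diff (E := E) (E' := E') (f ∘ (chartAt E x).symm) y) := by
      filter_upwards [(chartAt E x).open_target.mem_nhds hy] with y hy
      exact inChart_pullback hf ρ x k hy
    have hd : diff (E := E) (E' := E') f x =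
        (diff (E := E) (E' := E') (f ∘ (chartAt E x).symm) (chartAt E x x)).comp
          (diff (E := E) (E' := E) (chartAt E x) x) := by
      rw [diff_comp (hf.mdifferentiable (by simp) _)
        ((contMDiffAt_chart_symm x hy).mdifferentiableAt (by simp)), ContinuousLinearMap.comp_assoc,
        diff_chart_symm_comp x (mem_chart_source E x), hsx, ContinuousLinearMap.comp_id]
    simp only [extD, pullback, Forms.comap]
    rw [h1.extDeriv_eq, extDeriv_pulled hρ (hf.contMDiffAt.comp _ (contMDiffAt_chart_symm x hy)) k,
      Function.comp_apply, hsx, hd]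
    rfl

end FormField

end ManifoldCalculus

/-! ### The Leibniz rule and the derivative of the exponential. -/

section WedgeCalculus

variable {E M : Type*} [NormedAddCommGroup E] [NormedSpace ℝ E]

namespace FormField

/-- The main involution of the algebra of forms. -/
def grade (α : FormField E M) : FormField E M := fun x => Forms.grade (α x)

theorem mul_comm_of_even {α : FormField E M} (h : grade α = α) (β : FormField E M) :
    mul α β = mul β α :=
  funext fun x => Forms.mul_comm_of_even (congrFun h x) (β x)

theorem mul_assoc (α β γ : FormField E M) : mul (mul α β) γ = mul α (mul β γ) :=
  funext fun x => Forms.mul_assoc (α x) (β x) (γ x)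

variable [TopologicalSpace M] [ChartedSpace E M]

theorem inChart_mul (α β : FormField E M) (x₀ : M) (y : E) :
    (fun k => inChart (mul α β) x₀ k y) =
      Forms.mul (fun k => inChart α x₀ k y) (fun k => inChart β x₀ k y) :=
  Forms.comap_mul (diff (E := E) (E' := E) (chartAt E x₀).symm y)
    (α ((chartAt E x₀).symm y)) (β ((chartAt E x₀).symm y))

theorem IsSmooth.neg {α : FormField E M} (hα : IsSmooth α) : IsSmooth (-α) := by
  have h := hα.smul (-1)
  have e : (-1 : ℝ) • α = -α := neg_one_smul ℝ α
  rwa [e] at h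

theorem IsSmooth.sub {α β : FormField E M} (hα : IsSmooth α) (hβ : IsSmooth β) :
    IsSmooth (α - β) := by
  rw [sub_eq_add_neg]
  exact hα.add hβ.neg

theorem isSmooth_sum {ι : Type*} (s : Finset ι) {α : ι → FormField E M}
    (hα : ∀ i ∈ s, IsSmooth (α i)) : IsSmooth (∑ i ∈ s, α i) := by
  classical
  induction s using Finset.induction_on with
  | empty => exact isSmooth_zero
  | insert i s hi ih =>
    rw [Finset.sum_insert hi]
    exact (hα i (Finset.mem_insert_self i s)).add
      (ih fun j hj => hα j (Finset.mem_insert_of_mem hj))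

theorem extD_sum {ι : Type*} (s : Finset ι) {α : ι → FormField E M}
    (hα : ∀ i ∈ s, IsSmooth (α i)) : extD (∑ i ∈ s, α i) = ∑ i ∈ s, extD (α i) := by
  classical
  induction s using Finset.induction_on with
  | empty => exact extD_zero
  | insert i s hi ih =>
    have h : ∀ j ∈ s, IsSmooth (α j) := fun j hj => hα j (Finset.mem_insert_of_mem hj)
    rw [Finset.sum_insert hi, Finset.sum_insert hi,
      extD_add (hα i (Finset.mem_insert_self i s)) (isSmooth_sum s h), ih h]

theorem isSmooth_of_congr {α β : FormField E M} {k : ℕ} (h : ∀ x, α x k = β x k) {x₀ : M}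
    (hβ : ContDiffOn ℝ ∞ (inChart β x₀ k) (chartAt E x₀).target) :
    ContDiffOn ℝ ∞ (inChart α x₀ k) (chartAt E x₀).target := by
  have : inChart α x₀ k = inChart β x₀ k := by
    funext y
    simp only [inChart, h]
  rwa [this]

/-- The component of `dα` in degree `k + 1` sees only the component of `α` in degree `k`. This
allows power series of forms to be truncated under `d`. -/
theorem extD_congr {α β : FormField E M} {k : ℕ} (h : ∀ x, α x k = β x k) (x : M) :
    extD α x (k + 1) = extD β x (k + 1) := by
  have : inChart α x k = inChart β x k := by
    funext y
    simp only [inChart, h]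
  simp only [extD, this]

/-- The powers of a form. -/
def pow (α : FormField E M) (j : ℕ) : FormField E M := fun x => Forms.pow (α x) j

/-- The exponential of a form. -/
def exp (α : FormField E M) : FormField E M := fun x => Forms.exp (α x)

/-- A `2`-form as an inhomogeneous form. -/
def ofTwo (B : M → E [⋀^Fin 2]→L[ℝ] ℝ) : FormField E M := fun x => Forms.ofDegree 2 (B x)

theorem isSmooth_one : IsSmooth (fun _ : M => (Forms.one : Forms E)) := by
  intro x₀ k
  refine (contDiffOn_const (c := Forms.one k)).congr fun y _ => ?_
  rcases k with _ | k
  · ext v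
    simp only [inChart, Forms.one, Forms.ofDegree_same]
    rfl
  · ext v
    simp [inChart, Forms.one, Forms.ofDegree_of_ne (Nat.succ_ne_zero k)]

variable [FiniteDimensional ℝ E] [IsManifold 𝓘(ℝ, E) ∞ M]

theorem isSmooth_mul {α β : FormField E M} (hα : IsSmooth α) (hβ : IsSmooth β) :
    IsSmooth (mul α β) := by
  intro x₀ k y hy
  have : inChart (mul α β) x₀ k = fun y => Forms.mul (fun k => inChart α x₀ k y)
      (fun k => inChart β x₀ k y) k := funext fun y => congrFun (inChart_mul α β x₀ y) k
  rw [this]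
  exact (Forms.contDiffAt_mul (fun k => hα.contDiffAt x₀ k hy)
    (fun k => hβ.contDiffAt x₀ k hy) k).contDiffWithinAt

theorem isSmooth_pow {α : FormField E M} (hα : IsSmooth α) (j : ℕ) : IsSmooth (pow α j) := by
  induction j with
  | zero => exact isSmooth_one
  | succ j ih => exact isSmooth_mul hα ih

theorem isSmooth_exp {α : FormField E M} (hα : IsSmooth α) : IsSmooth (exp α) := by
  intro x₀ k
  refine isSmooth_of_congr (β := ∑ j ∈ Finset.range (k + 1), ((j ! : ℝ)⁻¹) • pow α j) (fun x => ?_)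
    (isSmooth_sum _ (fun j _ => (isSmooth_pow hα j).smul _) x₀ k)
  simp only [exp, Forms.exp, Finset.sum_apply]
  rfl

theorem extD_mul {α β : FormField E M} (hα : IsSmooth α) (hβ : IsSmooth β) :
    extD (mul α β) = mul (extD α) β + mul (grade α) (extD β) := by
  -- At `x` the derivative is the pull-back of the vector space derivative by the differential of
  -- the chart, and `hid` recovers `ρ x` in the same way. As pull-backs are multiplicative, the rule
  -- `Forms.extDV_mul` carries over.
  have key : ∀ (ρ : FormField E M) (x : M), extD ρ x =
      Forms.comap (diff (E := E) (E' := E) (chartAt E x) x)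
        (Forms.extDV (fun y k => inChart ρ x k y) (chartAt E x x)) := by
    intro ρ x
    funext k
    rcases k with _ | k
    · ext v
      simp [extD, Forms.comap, Forms.extDV]
    · rfl
  have hid : ∀ (ρ : FormField E M) (x : M), Forms.comap (diff (E := E) (E' := E) (chartAt E x) x)
      (fun k => inChart ρ x k (chartAt E x x)) = ρ x := by
    intro ρ x
    have hc := diff_chart_symm_comp x (mem_chart_source E x)
    funext k
    ext v
    simp only [Forms.comap, inChart, ContinuousAlternatingMap.compContinuousLinearMap_apply,
      (chartAt E x).left_inv (mem_chart_source E x)]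
    congr 1
    funext i
    exact DFunLike.congr_fun hc (v i)
  funext x
  have hd : ∀ {ρ : FormField E M}, IsSmooth ρ → ∀ k,
      DifferentiableAt ℝ (fun y => inChart ρ x k y) (chartAt E x x) :=
    fun h k => h.differentiableAt x k
  change extD (mul α β) x =
    Forms.mul (extD α x) (β x) + Forms.mul (Forms.grade (α x)) (extD β x)
  have hm : (fun y k => inChart (mul α β) x k y) = fun y =>
      Forms.mul (fun k => inChart α x k y) (fun k => inChart β x k y) :=
    funext fun y => inChart_mul α β x y
  rw [key, key α x, key β x, hm, Forms.extDV_mul (hd hα) (hd hβ), Forms.comap_add,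
      Forms.comap_mul, Forms.comap_mul, hid,
    Forms.comap_grade, hid]

/-- The Leibniz rule for `1 = 1 ∧ 1` gives `d1 = d1 + d1`. -/
theorem extD_one : extD (fun _ : M => (Forms.one : Forms E)) = 0 := by
  have h := extD_mul (M := M) (E := E) isSmooth_one isSmooth_one
  have hg : grade (fun _ : M => (Forms.one : Forms E)) = fun _ => Forms.one := by
    funext x; simp [grade, Forms.one, Forms.grade_ofDegree]
  have h1 : ∀ α : FormField E M, mul (fun _ => Forms.one) α = α := fun α =>
    funext fun x => Forms.one_mul (α x)
  have h2 : ∀ α : FormField E M, mul α (fun _ => Forms.one) = α := fun α =>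
    funext fun x => Forms.mul_one (α x)
  rw [hg, h1, h1, h2] at h
  exact add_eq_left.1 h.symm

theorem extD_pow {α : FormField E M} (hα : IsSmooth α) (hg : grade α = α) (j : ℕ) :
    extD (pow α (j + 1)) = ((j : ℝ) + 1) • mul (extD α) (pow α j) := by
  induction j with
  | zero =>
    have h : pow α 1 = α := funext fun x => Forms.mul_one (α x)
    have h2 : mul (extD α) (pow α 0) = extD α := funext fun x => Forms.mul_one (extD α x)
    rw [h, h2]
    simp
  | succ j ih =>
    have h : pow α (j + 1 + 1) = mul α (pow α (j + 1)) := rfl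
    rw [h, extD_mul hα (isSmooth_pow hα _), ih, hg, mul_smul, ← mul_assoc, mul_comm_of_even hg,
      mul_assoc]
    have h' : mul α (pow α j) = pow α (j + 1) := rfl
    rw [h']
    push_cast
    module

theorem extD_exp {α : FormField E M} (hα : IsSmooth α) (hg : grade α = α) (h0 : ∀ x, α x 0 = 0) :
    extD (exp α) = mul (extD α) (exp α) := by
  have key : ∀ (n k : ℕ) (x : M), k ≤ n → exp α x k =
      (∑ j ∈ Finset.range (n + 1), ((j ! : ℝ)⁻¹) • pow α j) x k := by
    intro n k x hk
    simp only [Finset.sum_apply]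
    exact Forms.exp_apply_of_le (h0 x) hk
  have hS : ∀ n : ℕ, extD (∑ j ∈ Finset.range (n + 1), ((j ! : ℝ)⁻¹) • pow α j) =
      mul (extD α) (∑ j ∈ Finset.range n, ((j ! : ℝ)⁻¹) • pow α j) := by
    intro n
    rw [extD_sum _ fun j _ => (isSmooth_pow hα j).smul _, Finset.sum_range_succ', extD_smul]
    have h1 : extD (pow α 0) = 0 := extD_one
    rw [h1, smul_zero, add_zero]
    funext x
    simp only [mul, Finset.sum_apply, Forms.mul_sum]
    refine Finset.sum_congr rfl fun j _ => ?_
    rw [extD_smul, extD_pow hα hg, smul_smul, Pi.smul_apply, Pi.smul_apply, Forms.mul_smul]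
    have := Nat.factorial_ne_zero j
    rw [Nat.factorial_succ]
    change _ • Forms.mul _ _ = _ • Forms.mul _ _
    congr 1
    push_cast
    field_simp
  funext x n
  rcases n with _ | n
  · ext v
    rw [mul, Forms.mul_apply_zero]
    simp [extD]
  -- Differentiation removes the last term of the truncated series. Starting from index `n + 2`, the
  -- sum that is left still agrees with the exponential in all degrees up to `n + 1`.
  · rw [extD_congr (fun x => key (n + 2) n x (by omega)) x, hS]
    exact Forms.mul_congr (fun _ _ => rfl) fun k hk => (key (n + 1) k x hk).symm

end FormField

end WedgeCalculus

/-! ### Conjugation of the Cartan calculus by the exponential of a two-form. -/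

section ExponentialConjugation

variable {E M : Type*} [NormedAddCommGroup E] [NormedSpace ℝ E]

namespace FormField

theorem add_mul (α β γ : FormField E M) : mul (α + β) γ = mul α γ + mul β γ :=
  funext fun x => Forms.add_mul (α x) (β x) (γ x)

theorem sub_mul (α β γ : FormField E M) : mul (α - β) γ = mul α γ - mul β γ :=
  funext fun x => Forms.sub_mul (α x) (β x) (γ x)

theorem mul_sub (α β γ : FormField E M) : mul α (β - γ) = mul α β - mul α γ :=
  funext fun x => Forms.mul_sub (α x) (β x) (γ x)

theorem neg_mul (α β : FormField E M) : mul (-α) β = -mul α β :=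
  funext fun x => Forms.neg_mul (α x) (β x)

theorem mul_comm_of_odd {α : FormField E M} (h : grade α = -α) (β : FormField E M) :
    mul α β = mul (grade β) α :=
  funext fun x => Forms.mul_comm_of_odd (congrFun h x) (β x)

theorem grade_ofTwo (B : M → E [⋀^Fin 2]→L[ℝ] ℝ) : grade (ofTwo B) = ofTwo B :=
  funext fun x => Forms.grade_ofDegree_two (B x)

theorem grade_exp_ofTwo (B : M → E [⋀^Fin 2]→L[ℝ] ℝ) :
    grade (exp (ofTwo B)) = exp (ofTwo B) :=
  funext fun x => Forms.grade_exp (Forms.grade_ofDegree_two (B x))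

theorem exp_ofTwo_add (B B' : M → E [⋀^Fin 2]→L[ℝ] ℝ) :
    exp (ofTwo (B + B')) = mul (exp (ofTwo B)) (exp (ofTwo B')) :=
  funext fun x => Forms.exp_ofDegree_add (B x) (B' x)

theorem one_mul (α : FormField E M) : mul (fun _ => Forms.one) α = α :=
  funext fun x => Forms.one_mul (α x)

theorem exp_ofTwo_zero : exp (ofTwo (0 : M → E [⋀^Fin 2]→L[ℝ] ℝ)) = fun _ => Forms.one := by
  funext x
  simp [exp, ofTwo, Forms.ofDegree_zero, Forms.exp_zero]

/-- Multiplication by an odd form passes through the exponential of a `2`-form. -/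
theorem mul_exp_ofTwo_left (B : M → E [⋀^Fin 2]→L[ℝ] ℝ) (α ρ : FormField E M) :
    mul α (mul (exp (ofTwo B)) ρ) = mul (exp (ofTwo B)) (mul α ρ) := by
  rw [← mul_assoc, ← mul_comm_of_even (grade_exp_ofTwo B), mul_assoc]

variable [TopologicalSpace M] [ChartedSpace E M]

theorem contract_mul (X : Π x : M, TangentSpace 𝓘(ℝ, E) x) (α β : FormField E M) :
    contract X (mul α β) = mul (contract X α) β + mul (grade α) (contract X β) :=
  funext fun x => Forms.contract_mul (E := E) (X x) (α x) (β x)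

theorem grade_contract (X : Π x : M, TangentSpace 𝓘(ℝ, E) x) (α : FormField E M) :
    grade (contract X α) = -contract X (grade α) := by
  funext x
  have := Forms.contract_grade (E := E) (X x) (α x)
  change Forms.grade (Forms.contract (E := E) (X x) (α x)) =
    -Forms.contract (E := E) (X x) (Forms.grade (α x))
  rw [this, neg_neg]

theorem grade_extD (α : FormField E M) : grade (extD α) = -extD (grade α) := by
  funext x k
  rcases k with _ | k
  · simp [grade, Forms.grade, extD]
  · have h : extD (grade α) x (k + 1) = extD ((-1 : ℝ) ^ k • α) x (k + 1) :=
      extD_congr (fun _ => rfl) x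
    rw [Pi.neg_apply, Pi.neg_apply, h, extD_smul]
    change (-1 : ℝ) ^ (k + 1) • extD α x (k + 1) = -((-1 : ℝ) ^ k • extD α x (k + 1))
    rw [pow_succ]
    module

/-- Conjugation by `e^B` adds the operator `ι_X B ∧` to `ι_X`; in the same way it adds `dB ∧` to `d`
in `extD_exp_mul`. These are the terms that the change of splitting has to compensate. -/
theorem contract_exp_mul (X : Π x : M, TangentSpace 𝓘(ℝ, E) x) (B : M → E [⋀^Fin 2]→L[ℝ] ℝ)
    (ρ : FormField E M) : contract X (mul (exp (ofTwo B)) ρ) =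
      mul (exp (ofTwo B)) (mul (contract X (ofTwo B)) ρ + contract X ρ) := by
  have h : contract X (exp (ofTwo B)) = mul (contract X (ofTwo B)) (exp (ofTwo B)) :=
    funext fun x => Forms.contract_exp (E := E) (Forms.grade_ofDegree_two (B x))
      (Forms.ofDegree_two_zero (B x)) (X x)
  rw [contract_mul, grade_exp_ofTwo, h, mul_assoc, mul_exp_ofTwo_left, mul_add]

variable [FiniteDimensional ℝ E] [IsManifold 𝓘(ℝ, E) ∞ M]

theorem extD_exp_mul {B : M → E [⋀^Fin 2]→L[ℝ] ℝ} (hB : IsSmooth (ofTwo B)) {ρ : FormField E M}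
    (hρ : IsSmooth ρ) : extD (mul (exp (ofTwo B)) ρ) =
      mul (exp (ofTwo B)) (mul (extD (ofTwo B)) ρ + extD ρ) := by
  rw [extD_mul (isSmooth_exp hB) hρ, grade_exp_ofTwo,
    extD_exp hB (grade_ofTwo B) fun x => Forms.ofDegree_two_zero (B x), mul_assoc,
    mul_exp_ofTwo_left, mul_add]

/-- Expand `dι_X + ι_X d` by the two preceding formulas. The mixed terms cancel because `ι_X B` and
`dB` are odd and anticommute, and only `d(ι_X B) + ι_X dB = L_X B` is left. -/
theorem lieD_exp_mul {X : Π x : M, TangentSpace 𝓘(ℝ, E) x}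
    (hX : ContMDiff 𝓘(ℝ, E) 𝓘(ℝ, E).tangent ∞ fun x => (⟨x, X x⟩ : TangentBundle 𝓘(ℝ, E) M))
    {B : M → E [⋀^Fin 2]→L[ℝ] ℝ} (hB : IsSmooth (ofTwo B)) {ρ : FormField E M} (hρ : IsSmooth ρ) :
    lieD X (mul (exp (ofTwo B)) ρ) =
      mul (exp (ofTwo B)) (mul (lieD X (ofTwo B)) ρ + lieD X ρ) := by
  have : CompleteSpace E := FiniteDimensional.complete ℝ E
  have hXB := isSmooth_contract hX hB
  have hXρ := isSmooth_contract hX hρ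
  have g1 : grade (contract X (ofTwo B)) = -contract X (ofTwo B) := by
    rw [grade_contract, grade_ofTwo]
  have g2 : grade (extD (ofTwo B)) = -extD (ofTwo B) := by rw [grade_extD, grade_ofTwo]
  have hodd : mul (extD (ofTwo B)) (contract X (ofTwo B)) =
      -mul (contract X (ofTwo B)) (extD (ofTwo B)) := by
    rw [mul_comm_of_odd g2, g1, neg_mul]
  have hodd' : mul (extD (ofTwo B)) (mul (contract X (ofTwo B)) ρ) =
      -mul (contract X (ofTwo B)) (mul (extD (ofTwo B)) ρ) := by
    rw [← mul_assoc, hodd, neg_mul, mul_assoc]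
  have hm := isSmooth_mul hXB hρ
  simp only [lieD]
  rw [contract_exp_mul, extD_exp_mul hB (hm.add hXρ), extD_exp_mul hB hρ, contract_exp_mul,
    ← mul_add, extD_add hm hXρ, extD_mul hXB hρ, contract_add, contract_mul X (extD (ofTwo B)),
        g1, g2]
  congr 1
  simp only [mul_add, add_mul, neg_mul, hodd']
  abel

end FormField

end ExponentialConjugation

/-! ### Local frames by global sections. -/

section LocalFrames

variable {E F M : Type*} [NormedAddCommGroup E] [NormedSpace ℝ E] [FiniteDimensional ℝ E]
  [TopologicalSpace M] [T2Space M] [ChartedSpace E M] [IsManifold 𝓘(ℝ, E) ∞ M]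
  [NormedAddCommGroup F] [NormedSpace ℝ F] (V : M → Type*) [TopologicalSpace (TotalSpace F V)]
  [∀ x, TopologicalSpace (V x)] [∀ x, AddCommGroup (V x)] [∀ x, Module ℝ (V x)]
  [FiberBundle F V] [VectorBundle ℝ F V] [ContMDiffVectorBundle ∞ F V 𝓘(ℝ, E)]

variable (E) in
/-- A bump function at `x₀` with support in a given neighbourhood. -/
theorem exists_bump (x₀ : M) {s : Set M} (hs : s ∈ 𝓝 x₀) :
    ∃ χ : SmoothBumpFunction 𝓘(ℝ, E) x₀, tsupport χ ⊆ s := by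
  obtain ⟨χ, -, h⟩ := (SmoothBumpFunction.nhds_basis_tsupport (I := 𝓘(ℝ, E)) x₀).mem_iff.1 hs
  exact ⟨χ, h⟩

variable (E F) in
/-- A bump function with support in the domain of the preferred trivialization at `x₀`. -/
def bump (x₀ : M) : SmoothBumpFunction 𝓘(ℝ, E) x₀ :=
  (exists_bump E x₀ ((trivializationAt F V x₀).open_baseSet.mem_nhds
    (FiberBundle.mem_baseSet_trivializationAt F V x₀))).choose

theorem tsupport_bump (x₀ : M) :
    tsupport (bump E F V x₀) ⊆ (trivializationAt F V x₀).baseSet :=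
  (exists_bump E x₀ ((trivializationAt F V x₀).open_baseSet.mem_nhds
    (FiberBundle.mem_baseSet_trivializationAt F V x₀))).choose_spec

theorem contMDiffOn_trivialization_symm (x₀ : M) (w : F) :
    ContMDiffOn 𝓘(ℝ, E) (𝓘(ℝ, E).prod 𝓘(ℝ, F)) ∞
      (fun x => TotalSpace.mk' F x ((trivializationAt F V x₀).symmL ℝ x w))
      (trivializationAt F V x₀).baseSet := by
  rw [(trivializationAt F V x₀).contMDiffOn_section_baseSet_iff]
  refine (contMDiffOn_const (c := w)).congr fun x hx => ?_
  rw [(trivializationAt F V x₀).symmL_apply hx, Bundle.Trivialization.apply_mk_symm _ hx]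

/-- The sections that are constant in the preferred trivialization at `x₀`, multiplied by a bump
function at `x₀`. -/
def bumpSection (x₀ : M) : F →ₗ[ℝ] ContMDiffSection 𝓘(ℝ, E) F ∞ V where
  toFun w :=
    { toFun := (bump E F V x₀ : M → ℝ) • fun x => (trivializationAt F V x₀).symmL ℝ x w
      contMDiff_toFun := ContMDiffOn.smul_section_of_tsupport (bump E F V x₀).contMDiff.contMDiffOn
        (trivializationAt F V x₀).open_baseSet (tsupport_bump V x₀)
        (contMDiffOn_trivialization_symm V x₀ w) }
  map_add' w w' := by
    ext x
    exact (congrArg (bump E F V x₀ x • ·) (map_add _ w w')).trans (smul_add _ _ _)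
  map_smul' r w := by
    ext x
    exact (congrArg (bump E F V x₀ x • ·) (map_smul _ r w)).trans (smul_comm _ _ _)

theorem bumpSection_apply (x₀ : M) (w : F) (x : M) : bumpSection (E := E) V x₀ w x =
    bump E F V x₀ x • (trivializationAt F V x₀).symmL ℝ x w := rfl

theorem bumpSection_eventually (x₀ : M) :
    ∀ᶠ x in 𝓝 x₀, x ∈ (trivializationAt F V x₀).baseSet ∧ ∀ w,
      bumpSection (E := E) V x₀ w x = (trivializationAt F V x₀).symmL ℝ x w := by
  filter_upwards [(bump E F V x₀).eventuallyEq_one,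
    (trivializationAt F V x₀).open_baseSet.mem_nhds
      (FiberBundle.mem_baseSet_trivializationAt F V x₀)]
    with x hx hx'
  refine ⟨hx', fun w => ?_⟩
  rw [bumpSection_apply, hx]
  exact one_smul ℝ _

variable (E F) in
/-- A linear choice of smooth sections with given value at `x₀`. -/
def extendSection (x₀ : M) : V x₀ →ₗ[ℝ] ContMDiffSection 𝓘(ℝ, E) F ∞ V :=
  bumpSection V x₀ ∘ₗ ((trivializationAt F V x₀).continuousLinearMapAt ℝ x₀ : V x₀ →ₗ[ℝ] F)

theorem extendSection_apply_self (x₀ : M) (v : V x₀) : extendSection E F V x₀ v x₀ = v := by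
  obtain ⟨h1, h2⟩ := (bumpSection_eventually (E := E) (F := F) V x₀).self_of_nhds
  rw [extendSection, LinearMap.comp_apply, h2]
  exact (trivializationAt F V x₀).symmL_continuousLinearMapAt h1 v

theorem section_sum_apply {ι : Type*} (s : Finset ι) (𝔛 : ι → ContMDiffSection 𝓘(ℝ, E) F ∞ V)
    (x : M) : (∑ i ∈ s, 𝔛 i) x = ∑ i ∈ s, 𝔛 i x :=
  (congrFun (map_sum (ContMDiffSection.coeAddHom 𝓘(ℝ, E) F ∞ V) 𝔛 s) x).trans
    (Finset.sum_apply _ _ _)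

theorem bumpSection_expand (x₀ : M) (w : F) {ι : Type*} [Fintype ι] (b : Module.Basis ι ℝ F)
    (x : M) : bumpSection (E := E) V x₀ w x =
      ∑ i, b.repr w i • bumpSection (E := E) V x₀ (b i) x := by
  conv_lhs => rw [← b.sum_repr w, map_sum, section_sum_apply]
  simp

variable {EA HA A : Type*} [NormedAddCommGroup EA] [NormedSpace ℝ EA] [TopologicalSpace HA]
  {I : ModelWithCorners ℝ EA HA} [TopologicalSpace A] [ChartedSpace HA A]

/-- Near a point, a smooth section along a map is a combination of global sections with smooth
coefficients. -/
theorem exists_frame_along {f : A → M} {β : ∀ a, V (f a)} {a₀ : A}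
    (h : ContMDiffAt I (𝓘(ℝ, E).prod 𝓘(ℝ, F)) ∞ (fun a => TotalSpace.mk' F (f a) (β a)) a₀) :
    ∃ c : A → F, ContMDiffAt I 𝓘(ℝ, F) ∞ c a₀ ∧
      ∀ᶠ a in 𝓝 a₀, β a = bumpSection (E := E) V (f a₀) (c a) (f a) := by
  rw [contMDiffAt_totalSpace] at h
  refine ⟨_, h.2, ?_⟩
  filter_upwards [h.1.continuousAt.eventually (bumpSection_eventually (E := E) (F := F) V (f a₀))]
    with a ha
  rw [ha.2]
  have := (trivializationAt F V (f a₀)).symmL_continuousLinearMapAt (R := ℝ) ha.1 (β a)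
  rw [Bundle.Trivialization.continuousLinearMapAt_apply,
    Bundle.Trivialization.coe_linearMapAt_of_mem _ ha.1] at this
  exact this.symm

theorem contMDiffAt_along_sum {ι : Type*} (s : Finset ι) {f : A → M} {a₀ : A}
    (hf : ContMDiffAt I 𝓘(ℝ, E) ∞ f a₀) {c : ι → A → ℝ} {β : ι → ∀ a, V (f a)}
    (hc : ∀ i, ContMDiffAt I 𝓘(ℝ, ℝ) ∞ (c i) a₀)
    (hβ : ∀ i, ContMDiffAt I (𝓘(ℝ, E).prod 𝓘(ℝ, F)) ∞
      (fun a => TotalSpace.mk' F (f a) (β i a)) a₀) :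
    ContMDiffAt I (𝓘(ℝ, E).prod 𝓘(ℝ, F)) ∞
      (fun a => TotalSpace.mk' F (f a) (∑ i ∈ s, c i a • β i a)) a₀ := by
  rw [contMDiffAt_totalSpace]
  refine ⟨hf, ?_⟩
  have h1 : ContMDiffAt I 𝓘(ℝ, F) ∞ (fun a => ∑ i ∈ s, c i a •
      ((trivializationAt F V (f a₀)) (TotalSpace.mk' F (f a) (β i a))).2) a₀ :=
    contMDiffAt_finsetSum fun i _ => (hc i).smul ((contMDiffAt_totalSpace.1 (hβ i)).2)
  refine h1.congr_of_eventuallyEq ?_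
  have hbase : ∀ᶠ a in 𝓝 a₀, f a ∈ (trivializationAt F V (f a₀)).baseSet :=
    hf.continuousAt.preimage_mem_nhds ((trivializationAt F V (f a₀)).open_baseSet.mem_nhds
      (FiberBundle.mem_baseSet_trivializationAt F V (f a₀)))
  filter_upwards [hbase] with a ha
  have hL : ∀ v : V (f a), ((trivializationAt F V (f a₀)) (TotalSpace.mk' F (f a) v)).2 =
      (trivializationAt F V (f a₀)).linearMapAt ℝ (f a) v := fun v => by
    rw [Bundle.Trivialization.coe_linearMapAt_of_mem _ ha]
  simp only [hL, map_sum, map_smul]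

theorem section_along {f : A → M} {a₀ : A} (hf : ContMDiffAt I 𝓘(ℝ, E) ∞ f a₀)
    (𝔛 : ContMDiffSection 𝓘(ℝ, E) F ∞ V) :
    ContMDiffAt I (𝓘(ℝ, E).prod 𝓘(ℝ, F)) ∞ (fun a => TotalSpace.mk' F (f a) (𝔛 (f a))) a₀ :=
  (𝔛.contMDiff.contMDiffAt).comp a₀ hf

variable {V}

/-- The axioms give smoothness of the pairing only on global sections over `M`. A section along `f`
is locally a combination of bump sections with smooth coefficients, and the pairing is expanded
accordingly. -/
theorem pairing_along [FiniteDimensional ℝ F] (𝒯 : ExtendedTangentBundle E F V) {f : A → M} {a₀ : A}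
    {β β' : ∀ a, V (f a)}
    (h : ContMDiffAt I (𝓘(ℝ, E).prod 𝓘(ℝ, F)) ∞ (fun a => TotalSpace.mk' F (f a) (β a)) a₀)
    (h' : ContMDiffAt I (𝓘(ℝ, E).prod 𝓘(ℝ, F)) ∞ (fun a => TotalSpace.mk' F (f a) (β' a)) a₀) :
    ContMDiffAt I 𝓘(ℝ, ℝ) ∞ (fun a => 𝒯.pairing (f a) (β a) (β' a)) a₀ := by
  have hf : ContMDiffAt I 𝓘(ℝ, E) ∞ f a₀ := (contMDiffAt_totalSpace.1 h).1
  obtain ⟨c, hc, hcβ⟩ := exists_frame_along V h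
  obtain ⟨c', hc', hcβ'⟩ := exists_frame_along V h'
  let b := Module.finBasis ℝ F
  have hcoord : ∀ {c : A → F}, ContMDiffAt I 𝓘(ℝ, F) ∞ c a₀ → ∀ i,
      ContMDiffAt I 𝓘(ℝ, ℝ) ∞ (fun a => b.repr (c a) i) a₀ := fun hc i =>
    ((b.coord i).toContinuousLinearMap.contDiff.contMDiff.contMDiffAt).comp a₀ hc
  have h1 : ContMDiffAt I 𝓘(ℝ, ℝ) ∞ (fun a => ∑ i, ∑ j, (b.repr (c a) i * b.repr (c' a) j) *
      𝒯.pairing (f a) (bumpSection (E := E) V (f a₀) (b i) (f a))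
        (bumpSection (E := E) V (f a₀) (b j) (f a))) a₀ :=
    contMDiffAt_finsetSum fun i _ => contMDiffAt_finsetSum fun j _ =>
      ((hcoord hc i).mul (hcoord hc' j)).mul (((𝒯.pairing_smooth _ _).contMDiffAt).comp a₀ hf)
  refine h1.congr_of_eventuallyEq ?_
  filter_upwards [hcβ, hcβ'] with a ha ha'
  rw [ha, ha', bumpSection_expand V _ (c a) b, bumpSection_expand V _ (c' a) b, map_sum,
    Finset.sum_comm]
  refine Finset.sum_congr rfl fun j _ => ?_
  rw [map_sum, LinearMap.sum_apply]
  refine Finset.sum_congr rfl fun i _ => ?_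
  simp only [map_smul, LinearMap.smul_apply, smul_eq_mul]
  ring

/-- Again by expansion in bump sections, since a splitting is only required to be smooth on global
vector fields. Vector fields along `f` and families of fields parametrized by `M` need this version.
-/
theorem IsotropicSplitting.along {𝒯 : ExtendedTangentBundle E F V} (s : IsotropicSplitting 𝒯)
    {f : A → M} {a₀ : A} {X : ∀ a, TangentSpace 𝓘(ℝ, E) (f a)}
    (h : ContMDiffAt I 𝓘(ℝ, E).tangent ∞ (fun a => (⟨f a, X a⟩ : TangentBundle 𝓘(ℝ, E) M)) a₀) :
    ContMDiffAt I (𝓘(ℝ, E).prod 𝓘(ℝ, F)) ∞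
      (fun a => TotalSpace.mk' F (f a) (s.toFun (f a) (X a))) a₀ := by
  have hf : ContMDiffAt I 𝓘(ℝ, E) ∞ f a₀ := (contMDiffAt_totalSpace.1 h).1
  obtain ⟨c, hc, hcβ⟩ := exists_frame_along (TangentSpace 𝓘(ℝ, E) : M → Type _) h
  let b := Module.finBasis ℝ E
  have h1 := contMDiffAt_along_sum V Finset.univ hf (c := fun i a => b.repr (c a) i)
    (β := fun i a => s.toFun (f a) (bumpSection (E := E) (TangentSpace 𝓘(ℝ, E)) (f a₀) (b i) (f a)))
    (fun i => ((b.coord i).toContinuousLinearMap.contDiff.contMDiff.contMDiffAt).comp a₀ hc)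
    (fun i => section_along V hf (s.apply (bumpSection _ (f a₀) (b i))))
  refine h1.congr_of_eventuallyEq ?_
  filter_upwards [hcβ] with a ha
  rw [ha, bumpSection_expand _ _ (c a) b]
  simp only [map_sum, map_smul]

end LocalFrames

/-! ### Coordinate vector fields and smoothness of forms. -/

section CoordinateFields

variable {E M : Type*} [NormedAddCommGroup E] [NormedSpace ℝ E] [FiniteDimensional ℝ E]
  [TopologicalSpace M] [T2Space M] [ChartedSpace E M] [IsManifold 𝓘(ℝ, E) ∞ M]

/-- The coordinate vector field with value `u` at `x₀`, multiplied by a bump function. -/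
def coordField (x₀ : M) : E →ₗ[ℝ] VField E M :=
  bumpSection (TangentSpace 𝓘(ℝ, E) : M → Type _) x₀

omit [FiniteDimensional ℝ E] [T2Space M] in
theorem diff_chart_eq (x₀ : M) {x : M} (hx : x ∈ (chartAt E x₀).source) :
    diff (E := E) (E' := E) (chartAt E x₀) x = tangentCoordChange 𝓘(ℝ, E) x x₀ x :=
  mfderiv_chartAt_eq_tangentCoordChange (I := 𝓘(ℝ, E)) hx

/-- Near `x₀` the bump function is `1`, and the trivialization of the tangent bundle is the
coordinate change to the chart at `x₀`. By the cocycle identity the differential of the chart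
therefore sends the field to the constant vector `u`. -/
theorem coordField_eventually (x₀ : M) : ∀ᶠ x in 𝓝 x₀, x ∈ (chartAt E x₀).source ∧
    ∀ u : E, (coordField x₀ u x : E) =
      diff (E := E) (E' := E) (chartAt E x₀).symm (chartAt E x₀ x) u := by
  filter_upwards [bumpSection_eventually (E := E) (F := E) (TangentSpace 𝓘(ℝ, E) : M → Type _) x₀,
    (chartAt E x₀).open_source.mem_nhds (mem_chart_source E x₀)] with x hx hx'
  refine ⟨hx', fun u => ?_⟩
  have h2 := hx.2 u
  rw [TangentBundle.symmL_trivializationAt_eq_core hx'] at h2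
  have h3 : diff (E := E) (E' := E) (chartAt E x₀) x (coordField x₀ u x : E) = u := by
    rw [diff_chart_eq x₀ hx']
    refine (congrArg (tangentCoordChange 𝓘(ℝ, E) x x₀ x) h2).trans ?_
    refine (tangentCoordChange_comp (I := 𝓘(ℝ, E)) ⟨⟨?_, ?_⟩, ?_⟩).trans
      (tangentCoordChange_self (I := 𝓘(ℝ, E)) ?_) <;> simp [hx']
  have h4 : ∀ w : E, diff (E := E) (E' := E) (chartAt E x₀).symm (chartAt E x₀ x)
      (diff (E := E) (E' := E) (chartAt E x₀) x w) = w := fun w =>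
    congrArg (fun L : E →L[ℝ] E => L w) (diff_chart_symm_comp x₀ hx')
  exact (h4 _).symm.trans (congrArg _ h3)

omit [FiniteDimensional ℝ E] [T2Space M] in
theorem diff_chart_self (x₀ : M) :
    diff (E := E) (E' := E) (chartAt E x₀) x₀ = ContinuousLinearMap.id ℝ E := by
  rw [diff_chart_eq x₀ (mem_chart_source E x₀)]
  ext v
  exact tangentCoordChange_self (I := 𝓘(ℝ, E)) (by simp)

omit [FiniteDimensional ℝ E] [T2Space M] in
theorem diff_chart_symm_self (x₀ : M) :
    diff (E := E) (E' := E) (chartAt E x₀).symm (chartAt E x₀ x₀) = ContinuousLinearMap.id ℝ E := by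
  have h := diff_chart_symm_comp (E := E) x₀ (mem_chart_source E x₀)
  rwa [diff_chart_self, ContinuousLinearMap.comp_id] at h

theorem coordField_self (x₀ : M) (u : E) : (coordField x₀ u x₀ : E) = u := by
  rw [(coordField_eventually x₀).self_of_nhds.2, diff_chart_symm_self]
  rfl

namespace FormField

omit [T2Space M] in
/-- Smoothness may be checked in the preferred chart at each point, near that point. -/
theorem isSmooth_of_contDiffAt {ρ : FormField E M}
    (h : ∀ x k, ContDiffAt ℝ ∞ (inChart ρ x k) (chartAt E x x)) : IsSmooth ρ := by
  intro x₀ k y hy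
  refine ContDiffAt.contDiffWithinAt ?_
  have hg := contMDiffAt_chart_symm x₀ hy
  refine ContDiffAt.congr_of_eventuallyEq ?_ (pulled_eventuallyEq ρ hg k)
  have hc := contDiffAt_chart_comp hg
  refine contDiffAt_compContinuousLinearMap ?_ (hc.fderiv_right (by simp))
  exact (h ((chartAt E x₀).symm y) k).comp y hc

/-- Constant vectors in the chart correspond to coordinate fields on `M`. This translates between
chart representatives and the intrinsic values for which the axioms give information. -/
theorem inChart_apply_eventually (ρ : FormField E M) (x₀ : M) (k : ℕ) (v : Fin k → E) :
    ∀ᶠ y in 𝓝 (chartAt E x₀ x₀), inChart ρ x₀ k y v =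
      ρ ((chartAt E x₀).symm y) k (fun i => coordField x₀ (v i) ((chartAt E x₀).symm y)) := by
  have hc : Tendsto (chartAt E x₀).symm (𝓝 (chartAt E x₀ x₀)) (𝓝 x₀) := by
    have := (chartAt E x₀).continuousAt_symm (mem_chart_target E x₀)
    rwa [ContinuousAt, (chartAt E x₀).left_inv (mem_chart_source E x₀)] at this
  filter_upwards [hc.eventually (coordField_eventually (E := E) x₀),
    (chartAt E x₀).open_target.mem_nhds (mem_chart_target E x₀)] with y hy hy'
  rw [(chartAt E x₀).right_inv hy'] at hy
  have : (fun i => coordField x₀ (v i) ((chartAt E x₀).symm y) : Fin k → E) =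
      fun i => diff (E := E) (E' := E) (chartAt E x₀).symm y (v i) := funext fun i => hy.2 _
  rw [this]
  rfl

/-- A form is smooth if it has smooth values on coordinate fields. -/
theorem isSmooth_ofDegree {k : ℕ} {θ : M → E [⋀^Fin k]→L[ℝ] ℝ}
    (h : ∀ (x₀ : M) (v : Fin k → E), ContMDiffAt 𝓘(ℝ, E) 𝓘(ℝ, ℝ) ∞
      (fun x => θ x (fun i => coordField x₀ (v i) x)) x₀) :
    IsSmooth (fun x => Forms.ofDegree k (θ x)) := by
  refine isSmooth_of_contDiffAt fun x₀ n => ?_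
  by_cases hn : n = k
  · subst hn
    refine contDiffAt_form_of_apply fun v => ?_
    refine ContDiffAt.congr_of_eventuallyEq ?_ (inChart_apply_eventually _ x₀ n v)
    simp only [Forms.ofDegree_same]
    have h1 := (h x₀ v).comp_of_eq (contMDiffAt_chart_symm x₀ (mem_chart_target E x₀))
      ((chartAt E x₀).left_inv (mem_chart_source E x₀))
    exact contMDiffAt_iff_contDiffAt.1 h1
  · have : inChart (fun x => Forms.ofDegree k (θ x)) x₀ n = fun _ => 0 := by
      funext y; ext v; simp [inChart, Forms.ofDegree_of_ne hn]
    rw [this]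
    exact contDiffAt_const

theorem IsSmooth.contMDiffAt_apply {k : ℕ} {ρ : FormField E M}
    (h : IsSmooth ρ) (x₀ : M) (v : Fin k → E) :
    ContMDiffAt 𝓘(ℝ, E) 𝓘(ℝ, ℝ) ∞ (fun x => ρ x k (fun i => coordField x₀ (v i) x)) x₀ := by
  have h1 : ContDiffAt ℝ ∞ (fun y => inChart ρ x₀ k y v) (chartAt E x₀ x₀) :=
    contDiffAt_form_apply (h.contDiffAt x₀ k (mem_chart_target E x₀)) fun _ => contDiffAt_const
  have h2 := (contMDiffAt_iff_contDiffAt.2 h1).comp x₀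
    (contMDiffAt_of_mem_maximalAtlas (I := 𝓘(ℝ, E)) (n := ∞)
      (IsManifold.chart_mem_maximalAtlas x₀) (mem_chart_source E x₀))
  refine h2.congr_of_eventuallyEq ?_
  have hc := (chartAt E x₀).continuousAt (mem_chart_source E x₀)
  filter_upwards [hc.eventually (inChart_apply_eventually ρ x₀ k v),
    (chartAt E x₀).open_source.mem_nhds (mem_chart_source E x₀)] with x hx hx'
  rw [(chartAt E x₀).left_inv hx'] at hx
  exact hx.symm

end FormField

end CoordinateFields

/-! ### Derivatives along coordinate fields. -/

section DirectionalDerivatives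

variable {E M : Type*} [NormedAddCommGroup E] [NormedSpace ℝ E] [FiniteDimensional ℝ E]
  [TopologicalSpace M] [T2Space M] [ChartedSpace E M] [IsManifold 𝓘(ℝ, E) ∞ M]

omit [FiniteDimensional ℝ E] [T2Space M] [IsManifold 𝓘(ℝ, E) ∞ M] in
theorem dirDeriv_congr {g h : M → ℝ} {x : M} (hgh : g =ᶠ[𝓝 x] h) (v : TangentSpace 𝓘(ℝ, E) x) :
    dirDeriv g x v = dirDeriv h x v := by
  rw [dirDeriv, dirDeriv, hgh.mfderiv_eq]
  rfl

omit [FiniteDimensional ℝ E] [T2Space M] in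
theorem dirDeriv_eq_fderiv {g : M → ℝ} {x₀ x : M} (hx : x ∈ (chartAt E x₀).source)
    (hg : MDifferentiableAt 𝓘(ℝ, E) 𝓘(ℝ, ℝ) g x) (v : E) :
    dirDeriv g x v = fderiv ℝ (g ∘ (chartAt E x₀).symm) (chartAt E x₀ x)
      (diff (E := E) (E' := E) (chartAt E x₀) x v) := by
  have h1 : MDifferentiableAt 𝓘(ℝ, E) 𝓘(ℝ, ℝ) (g ∘ (chartAt E x₀).symm) (chartAt E x₀ x) := by
    refine MDifferentiableAt.comp (I' := 𝓘(ℝ, E)) _ ?_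
      ((chart_mdifferentiable x₀).symm.mdifferentiableAt ((chartAt E x₀).map_source hx))
    rwa [(chartAt E x₀).left_inv hx]
  have h2 : g =ᶠ[𝓝 x] (g ∘ (chartAt E x₀).symm) ∘ chartAt E x₀ := by
    filter_upwards [(chartAt E x₀).open_source.mem_nhds hx] with y hy
    simp [(chartAt E x₀).left_inv hy]
  refine (dirDeriv_congr h2 _).trans ?_
  rw [← mfderiv_eq_fderiv]
  exact congrArg (fun L : E →L[ℝ] ℝ => L v)
    (diff_comp h1 ((chart_mdifferentiable x₀).mdifferentiableAt hx))

omit [FiniteDimensional ℝ E] [T2Space M] in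
theorem dirDeriv_self {g : M → ℝ} {x₀ : M} (hg : MDifferentiableAt 𝓘(ℝ, E) 𝓘(ℝ, ℝ) g x₀) (v : E) :
    dirDeriv g x₀ v = fderiv ℝ (g ∘ (chartAt E x₀).symm) (chartAt E x₀ x₀) v := by
  rw [dirDeriv_eq_fderiv (mem_chart_source E x₀) hg, diff_chart_self]
  rfl

theorem dirDeriv_coordField {g : M → ℝ} (hg : ContMDiff 𝓘(ℝ, E) 𝓘(ℝ, ℝ) ∞ g) (x₀ : M) (v : E) :
    ∀ᶠ x in 𝓝 x₀, dirDeriv g x (coordField x₀ v x) =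
      fderiv ℝ (g ∘ (chartAt E x₀).symm) (chartAt E x₀ x) v := by
  filter_upwards [coordField_eventually (E := E) x₀] with x hx
  refine (dirDeriv_eq_fderiv hx.1 (hg.mdifferentiable (by simp) x) _).trans ?_
  refine congrArg _ ?_
  refine (congrArg _ (hx.2 v)).trans ?_
  have h := congrArg (fun L : E →L[ℝ] E => L v)
    (diff_chart_comp_symm x₀ ((chartAt E x₀).map_source hx.1))
  simpa [(chartAt E x₀).left_inv hx.1] using h

/-- Coordinate fields commute. -/
theorem dirDeriv_dirDeriv_coordField {g : M → ℝ} (hg : ContMDiff 𝓘(ℝ, E) 𝓘(ℝ, ℝ) ∞ g) (x₀ : M)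
    (u v : E) : dirDeriv (fun x => dirDeriv g x (coordField x₀ v x)) x₀ u =
      dirDeriv (fun x => dirDeriv g x (coordField x₀ u x)) x₀ v := by
  set G := g ∘ (chartAt E x₀).symm with hG
  have hGs : ContDiffAt ℝ ∞ G (chartAt E x₀ x₀) :=
    contMDiffAt_iff_contDiffAt.1
      (hg.contMDiffAt.comp _ (FormField.contMDiffAt_chart_symm x₀ (mem_chart_target E x₀)))
  have hd : DifferentiableAt ℝ (fderiv ℝ G) (chartAt E x₀ x₀) :=
    (hGs.fderiv_right (m := ∞) (by simp)).differentiableAt (by simp)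
  -- Near `x₀` the fields have constant coefficients in the chart, so the iterated derivative at
  -- `x₀` is the second derivative of `G`, which is symmetric.
  have key : ∀ u v : E, dirDeriv (fun x => dirDeriv g x (coordField x₀ v x)) x₀ u =
      fderiv ℝ (fderiv ℝ G) (chartAt E x₀ x₀) u v := by
    intro u v
    have hd' : DifferentiableAt ℝ (fun z => fderiv ℝ G z v) (chartAt E x₀ x₀) :=
      hd.clm_apply (differentiableAt_const v)
    have hm : MDifferentiableAt 𝓘(ℝ, E) 𝓘(ℝ, ℝ) (fun x => fderiv ℝ G (chartAt E x₀ x) v) x₀ :=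
      MDifferentiableAt.comp (I' := 𝓘(ℝ, E)) x₀ hd'.mdifferentiableAt
        ((chart_mdifferentiable x₀).mdifferentiableAt (mem_chart_source E x₀))
    refine (dirDeriv_congr (dirDeriv_coordField hg x₀ v) _).trans ((dirDeriv_self hm u).trans ?_)
    have he : (fun x => fderiv ℝ G (chartAt E x₀ x) v) ∘ (chartAt E x₀).symm
        =ᶠ[𝓝 (chartAt E x₀ x₀)] fun z => fderiv ℝ G z v := by
      filter_upwards [(chartAt E x₀).open_target.mem_nhds (mem_chart_target E x₀)] with z hz
      simp [(chartAt E x₀).right_inv hz]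
    rw [he.fderiv_eq, fderiv_clm_apply hd (differentiableAt_const v)]
    simp
  rw [key, key]
  exact (hGs.isSymmSndFDerivAt (by simp; exact ENat.LEInfty.out)) u v

namespace FormField

/-- The exterior derivative on coordinate fields. -/
theorem extD_apply {ρ : FormField E M} (hρ : IsSmooth ρ) (x₀ : M) (k : ℕ) (v : Fin (k + 1) → E) :
    extD ρ x₀ (k + 1) v = ∑ i : Fin (k + 1), (-1 : ℝ) ^ (i : ℕ) *
      dirDeriv (fun x => ρ x k (fun j => coordField x₀ (i.removeNth v j) x)) x₀ (v i) := by
  have h1 : extD ρ x₀ (k + 1) v = extDeriv (inChart ρ x₀ k) (chartAt E x₀ x₀) v := by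
    simp only [extD, diff_chart_self]
    rfl
  have hd := hρ.differentiableAt x₀ k
  rw [h1, extDeriv_apply hd]
  refine Finset.sum_congr rfl fun i _ => ?_
  have hm := (hρ.contMDiffAt_apply x₀ (i.removeNth v)).mdifferentiableAt (by simp)
  have hz : ∀ r : ℝ, ((-1 : ℤ) ^ (i : ℕ)) • r = (-1 : ℝ) ^ (i : ℕ) * r := by simp
  refine (hz _).trans (congrArg _ <| Eq.symm ((dirDeriv_self hm (v i)).trans ?_))
  exact congrArg (fun L : E →L[ℝ] ℝ => L (v i))
    (EventuallyEq.fderiv_eq (inChart_apply_eventually ρ x₀ k (i.removeNth v))).symm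

end FormField

end DirectionalDerivatives

/-! ### Alternating forms from skew maps. -/

section SkewMaps

variable {E : Type*} [NormedAddCommGroup E] [NormedSpace ℝ E] [FiniteDimensional ℝ E]

theorem continuous_multilinearMap {k : ℕ} (m : MultilinearMap ℝ (fun _ : Fin k => E) ℝ) :
    Continuous m := by
  let b := Module.finBasis ℝ E
  have h : ∀ v : Fin k → E, m v = ∑ r : Fin k → Fin (Module.finrank ℝ E),
      (∏ i, b.coord (r i) (v i)) * m fun i => b (r i) := by
    intro v
    have h1 : v = fun i => ∑ j, b.coord j (v i) • b j := funext fun i => (b.sum_repr (v i)).symm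
    conv_lhs => rw [h1, m.map_sum]
    refine Finset.sum_congr rfl fun r _ => ?_
    rw [m.map_smul_univ, smul_eq_mul]
  have h2 : (m : (Fin k → E) → ℝ) = fun v => ∑ r : Fin k → Fin (Module.finrank ℝ E),
      (∏ i, b.coord (r i) (v i)) * m fun i => b (r i) := funext h
  rw [h2]
  refine continuous_finsetSum _ fun r _ => Continuous.mul (continuous_finsetProd _ fun i _ => ?_)
    continuous_const
  exact (LinearMap.continuous_of_finiteDimensional (b.coord (r i))).comp (continuous_apply i)

/-- Linearity is needed in the last slot only, skewness supplies it in the other. In the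
applications the first slot depends on arbitrary choices and is not visibly linear. -/
theorem exists_twoForm (t : E → E →ₗ[ℝ] ℝ) (h : ∀ u v, t u v = -t v u) :
    ∃ β : E [⋀^Fin 2]→L[ℝ] ℝ, ∀ u v, β ![u, v] = t u v := by
  let m : MultilinearMap ℝ (fun _ : Fin 2 => E) ℝ :=
    { toFun := fun v => t (v 0) (v 1)
      map_update_add' := by
        intro _ v i x y
        fin_cases i
        · simp [h _ (v 1)]; ring
        · simp
      map_update_smul' := by
        intro _ v i c x
        fin_cases i
        · simp [h _ (v 1)]
        · simp }
  have h0 : ∀ u, t u u = 0 := fun u => by linarith [h u u]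
  refine ⟨{ m with cont := continuous_multilinearMap m, map_eq_zero_of_eq' := ?_ }, fun u v => rfl⟩
  intro v i j hv hij
  have : v 0 = v 1 := by
    fin_cases i <;> fin_cases j <;>
      first | exact absurd rfl hij | exact hv | exact hv.symm
  change t (v 0) (v 1) = 0
  rw [this, h0]

/-- Two sign changes give cyclic invariance, which moves every slot to the last one, where linearity
is known. -/
theorem exists_threeForm (t : E → E → E →ₗ[ℝ] ℝ) (h : ∀ u v w, t u v w = -t v u w)
    (h' : ∀ u v w, t u v w = -t u w v) :
    ∃ β : E [⋀^Fin 3]→L[ℝ] ℝ, ∀ u v w, β ![u, v, w] = t u v w := by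
  have hc : ∀ u v w, t u v w = t v w u := fun u v w => by rw [h, h', neg_neg]
  have h10 : (1 : Fin 3) ≠ 0 := by decide
  have h20 : (2 : Fin 3) ≠ 0 := by decide
  have h21 : (2 : Fin 3) ≠ 1 := by decide
  let m : MultilinearMap ℝ (fun _ : Fin 3 => E) ℝ :=
    { toFun := fun v => t (v 0) (v 1) (v 2)
      map_update_add' := by
        intro _ v i x y
        match i with
        | 0 => simp only [Function.update_self, Function.update_of_ne h10,
            Function.update_of_ne h20, hc _ (v 1), map_add]
        | 1 => simp only [Function.update_self, Function.update_of_ne h10.symm,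
            Function.update_of_ne h21, ← hc (v 2) (v 0), map_add]
        | 2 => simp only [Function.update_self, Function.update_of_ne h20.symm,
            Function.update_of_ne h21.symm, map_add]
      map_update_smul' := by
        intro _ v i c x
        match i with
        | 0 => simp only [Function.update_self, Function.update_of_ne h10,
            Function.update_of_ne h20, hc _ (v 1), map_smul]
        | 1 => simp only [Function.update_self, Function.update_of_ne h10.symm,
            Function.update_of_ne h21, ← hc (v 2) (v 0), map_smul]
        | 2 => simp only [Function.update_self, Function.update_of_ne h20.symm,
            Function.update_of_ne h21.symm, map_smul] }
  have h0 : ∀ u w, t u u w = 0 := fun u w => by linarith [h u u w]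
  have h1 : ∀ u w, t u w w = 0 := fun u w => by linarith [h' u w w]
  have h2 : ∀ u w, t u w u = 0 := fun u w => by rw [hc, hc, h0]
  refine ⟨{ m with cont := continuous_multilinearMap m, map_eq_zero_of_eq' := ?_ },
    fun u v w => rfl⟩
  intro v i j hv hij
  have : v 0 = v 1 ∨ v 1 = v 2 ∨ v 2 = v 0 := by
    fin_cases i <;> fin_cases j <;>
      first | exact absurd rfl hij | exact .inl hv | exact .inl hv.symm | exact .inr (.inl hv) |
        exact .inr (.inl hv.symm) | exact .inr (.inr hv) | exact .inr (.inr hv.symm)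
  change t (v 0) (v 1) (v 2) = 0
  rcases this with e | e | e
  · rw [e, h0]
  · rw [e, h1]
  · rw [e, h2]

end SkewMaps

/-! ### The anchor of the bracket of lifted coordinate fields. -/

section AnchorOfBrackets

variable {E F M : Type*} [NormedAddCommGroup E] [NormedSpace ℝ E] [FiniteDimensional ℝ E]
  [TopologicalSpace M] [T2Space M] [ChartedSpace E M] [IsManifold 𝓘(ℝ, E) ∞ M]
  [NormedAddCommGroup F] [NormedSpace ℝ F] {V : M → Type*} [TopologicalSpace (TotalSpace F V)]
  [∀ x, TopologicalSpace (V x)] [∀ x, AddCommGroup (V x)] [∀ x, Module ℝ (V x)]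
  [FiberBundle F V] [VectorBundle ℝ F V]

theorem dirDeriv_add {g h : M → ℝ} {x : M} (hg : MDifferentiableAt 𝓘(ℝ, E) 𝓘(ℝ, ℝ) g x)
    (hh : MDifferentiableAt 𝓘(ℝ, E) 𝓘(ℝ, ℝ) h x) (v : TangentSpace 𝓘(ℝ, E) x) :
    dirDeriv (fun y => g y + h y) x v = dirDeriv g x v + dirDeriv h x v :=
  congrArg (fun L : E →L[ℝ] ℝ => L v) (mfderiv_add hg hh)

theorem dirDeriv_mul {g h : M → ℝ} {x : M} (hg : MDifferentiableAt 𝓘(ℝ, E) 𝓘(ℝ, ℝ) g x)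
    (hh : MDifferentiableAt 𝓘(ℝ, E) 𝓘(ℝ, ℝ) h x) (v : TangentSpace 𝓘(ℝ, E) x) :
    dirDeriv (fun y => g y * h y) x v = g x * dirDeriv h x v + h x * dirDeriv g x v :=
  congrArg (fun L : E →L[ℝ] ℝ => L v)
    (HasMFDerivAt.mul hg.hasMFDerivAt hh.hasMFDerivAt).mfderiv

theorem dirDeriv_const_mul (r : ℝ) {h : M → ℝ} {x : M}
    (hh : MDifferentiableAt 𝓘(ℝ, E) 𝓘(ℝ, ℝ) h x) (v : TangentSpace 𝓘(ℝ, E) x) :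
    dirDeriv (fun y => r * h y) x v = r * dirDeriv h x v := by
  have h0 : dirDeriv (fun _ : M => r) x v = 0 := by
    rw [dirDeriv, mfderiv_const]
    rfl
  rw [dirDeriv_mul mdifferentiableAt_const hh, h0, mul_zero, add_zero]

/-- A linear functional not vanishing on `w`, read in the chart, centred at `x₀` and cut off by a
bump function. -/
theorem exists_function (x₀ : M) {w : E} (hw : w ≠ 0) : ∃ g : M → ℝ,
    ContMDiff 𝓘(ℝ, E) 𝓘(ℝ, ℝ) ∞ g ∧ g x₀ = 0 ∧ dirDeriv g x₀ w ≠ 0 := by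
  obtain ⟨ℓ, hℓ⟩ : ∃ ℓ : E →L[ℝ] ℝ, ℓ w ≠ 0 := by
    by_contra! h
    exact hw (SeparatingDual.eq_zero_of_forall_dual_eq_zero (R := ℝ) h)
  obtain ⟨χ, -⟩ := exists_bump E x₀ univ_mem
  let h : E → ℝ := fun z => ℓ (z - chartAt E x₀ x₀)
  have hh : ContDiff ℝ ∞ h := ℓ.contDiff.comp (contDiff_id.sub contDiff_const)
  have hg : ContMDiff 𝓘(ℝ, E) 𝓘(ℝ, ℝ) ∞ fun x => χ x • h (chartAt E x₀ x) :=
    χ.contMDiff_smul (hh.contMDiff.comp_contMDiffOn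
      (contMDiffOn_of_mem_maximalAtlas (IsManifold.chart_mem_maximalAtlas x₀)))
  refine ⟨_, hg, by simp [h], ?_⟩
  rw [dirDeriv_self (hg.mdifferentiable (by simp) x₀)]
  have he : (fun x => χ x • h (chartAt E x₀ x)) ∘ (chartAt E x₀).symm
      =ᶠ[𝓝 (chartAt E x₀ x₀)] h := by
    have hc := (chartAt E x₀).continuousAt_symm (mem_chart_target E x₀)
    rw [ContinuousAt, (chartAt E x₀).left_inv (mem_chart_source E x₀)] at hc
    filter_upwards [(chartAt E x₀).open_target.mem_nhds (mem_chart_target E x₀),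
      hc.eventually χ.eventuallyEq_one] with z hz hz'
    simp [(chartAt E x₀).right_inv hz, hz']
  rw [he.fderiv_eq]
  have : HasFDerivAt h ℓ (chartAt E x₀ x₀) :=
    ℓ.hasFDerivAt.comp _ ((hasFDerivAt_id _).sub_const _)
  rwa [this.fderiv]

/-- The product of a function and a section. -/
def smulSection {g : M → ℝ} (hg : ContMDiff 𝓘(ℝ, E) 𝓘(ℝ, ℝ) ∞ g)
    (𝔛 : ContMDiffSection 𝓘(ℝ, E) F ∞ V) : ContMDiffSection 𝓘(ℝ, E) F ∞ V where
  toFun := g • ⇑𝔛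
  contMDiff_toFun := hg.smul_section 𝔛.contMDiff

namespace ExtendedTangentBundle

variable (𝒯 : ExtendedTangentBundle E F V)

/-- By exactness an element of the kernel of the anchor is a covector, and a covector pairs with `e`
through the anchor of `e`. -/
theorem pairing_eq_of_anchor {x : M} {k e e' : V x} (hk : 𝒯.anchor x k = 0)
    (h : 𝒯.anchor x e = 𝒯.anchor x e') : 𝒯.pairing x k e = 𝒯.pairing x k e' := by
  obtain ⟨ξ, hξ⟩ := (𝒯.exact x k).1 hk
  have h1 := hξ e
  rw [h, ← hξ e'] at h1
  linarith

theorem pairing_eq_zero_of_anchor {x : M} {k e : V x} (hk : 𝒯.anchor x k = 0)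
    (h : 𝒯.anchor x e = 0) : 𝒯.pairing x k e = 0 := by
  rw [𝒯.pairing_eq_of_anchor hk (h.trans (map_zero _).symm), map_zero]

theorem mdifferentiableAt_pairing (𝔛 𝔜 : ContMDiffSection 𝓘(ℝ, E) F ∞ V) (x : M) :
    MDifferentiableAt 𝓘(ℝ, E) 𝓘(ℝ, ℝ) (fun y => 𝒯.pairing y (𝔛 y) (𝔜 y)) x :=
  (𝒯.pairing_smooth 𝔛 𝔜).mdifferentiable (by simp) x

theorem dirDeriv_pairing (𝔛 𝔜 ℨ : ContMDiffSection 𝓘(ℝ, E) F ∞ V) (x : M) :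
    dirDeriv (fun y => 𝒯.pairing y (𝔜 y) (ℨ y)) x (𝒯.anchor x (𝔛 x)) =
      𝒯.pairing x (𝒯.bracket 𝔛 𝔜 x) (ℨ x) + 𝒯.pairing x (𝔜 x) (𝒯.bracket 𝔛 ℨ x) :=
  𝒯.anchor_pairing 𝔛 𝔜 ℨ x

theorem dirDeriv_pairing_symm (𝔛 𝔜 ℨ : ContMDiffSection 𝓘(ℝ, E) F ∞ V) (x : M) :
    dirDeriv (fun y => 𝒯.pairing y (𝔜 y) (ℨ y)) x (𝒯.anchor x (𝔛 x)) =
      𝒯.pairing x (𝔛 x) (𝒯.bracket 𝔜 ℨ x) + 𝒯.pairing x (𝔛 x) (𝒯.bracket ℨ 𝔜 x) :=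
  (𝒯.anchor_pairing_symm 𝔛 𝔜 ℨ x).trans (map_add _ _ _)

/-- The anchor of `𝔛 * 𝔜` vanishes at a point if `𝔛` and `𝔜` project to coordinate fields. -/
theorem anchor_bracket_eq_zero [ContMDiffVectorBundle ∞ F V 𝓘(ℝ, E)]
    {𝔛 𝔜 : ContMDiffSection 𝓘(ℝ, E) F ∞ V} {x₀ : M} {u v : E}
    (h𝔛 : ∀ᶠ x in 𝓝 x₀, 𝒯.anchor x (𝔛 x) = coordField x₀ u x)
    (h𝔜 : ∀ᶠ x in 𝓝 x₀, 𝒯.anchor x (𝔜 x) = coordField x₀ v x) :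
    𝒯.anchor x₀ (𝒯.bracket 𝔛 𝔜 x₀) = 0 := by
  -- The second derivative of `⟨P, Q⟩`, first along `𝔜` and then along `𝔛`, computed by applying the
  -- invariance of the pairing twice.
  have second : ∀ {𝔛 𝔜 : ContMDiffSection 𝓘(ℝ, E) F ∞ V} {u v : E}
      (_ : ∀ᶠ x in 𝓝 x₀, 𝒯.anchor x (𝔛 x) = coordField x₀ u x)
      (_ : ∀ᶠ x in 𝓝 x₀, 𝒯.anchor x (𝔜 x) = coordField x₀ v x)
      (P Q : ContMDiffSection 𝓘(ℝ, E) F ∞ V),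
      dirDeriv (fun x => dirDeriv (fun y => 𝒯.pairing y (P y) (Q y)) x (coordField x₀ v x)) x₀ u =
        𝒯.pairing x₀ (𝒯.bracket 𝔛 (𝒯.bracket 𝔜 P) x₀) (Q x₀) +
        𝒯.pairing x₀ (𝒯.bracket 𝔜 P x₀) (𝒯.bracket 𝔛 Q x₀) +
        (𝒯.pairing x₀ (𝒯.bracket 𝔛 P x₀) (𝒯.bracket 𝔜 Q x₀) +
        𝒯.pairing x₀ (P x₀) (𝒯.bracket 𝔛 (𝒯.bracket 𝔜 Q) x₀)) := by
    intro 𝔛 𝔜 u v h𝔛 h𝔜 P Q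
    have h1 : (fun x => dirDeriv (fun y => 𝒯.pairing y (P y) (Q y)) x (coordField x₀ v x))
        =ᶠ[𝓝 x₀] fun x => 𝒯.pairing x (𝒯.bracket 𝔜 P x) (Q x) +
          𝒯.pairing x (P x) (𝒯.bracket 𝔜 Q x) := by
      filter_upwards [h𝔜] with x hx
      rw [← hx, 𝒯.dirDeriv_pairing]
    have h2 : (u : TangentSpace 𝓘(ℝ, E) x₀) = 𝒯.anchor x₀ (𝔛 x₀) :=
      (h𝔛.self_of_nhds.trans (coordField_self x₀ u)).symm
    refine (dirDeriv_congr h1 _).trans ((dirDeriv_add (𝒯.mdifferentiableAt_pairing _ _ x₀)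
      (𝒯.mdifferentiableAt_pairing _ _ x₀) _).trans ?_)
    refine (congrArg (fun w : TangentSpace 𝓘(ℝ, E) x₀ =>
      dirDeriv (fun x => 𝒯.pairing x (𝒯.bracket 𝔜 P x) (Q x)) x₀ w +
      dirDeriv (fun x => 𝒯.pairing x (P x) (𝒯.bracket 𝔜 Q x)) x₀ w) h2).trans ?_
    simp only [𝒯.dirDeriv_pairing]
  -- In the difference of the two orders the mixed terms cancel, and the Jacobi identity turns the
  -- rest into the derivative of `⟨P, Q⟩` along the anchor of `𝔛 * 𝔜`. The difference is zero
  -- because coordinate fields commute.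
  have key : ∀ P Q : ContMDiffSection 𝓘(ℝ, E) F ∞ V,
      dirDeriv (fun y => 𝒯.pairing y (P y) (Q y)) x₀ (𝒯.anchor x₀ (𝒯.bracket 𝔛 𝔜 x₀)) = 0 := by
    intro P Q
    have hs := dirDeriv_dirDeriv_coordField (𝒯.pairing_smooth P Q) x₀ u v
    rw [second h𝔛 h𝔜 P Q, second h𝔜 h𝔛 P Q] at hs
    have hj : ∀ R, 𝒯.bracket (𝒯.bracket 𝔛 𝔜) R =
        𝒯.bracket 𝔛 (𝒯.bracket 𝔜 R) - 𝒯.bracket 𝔜 (𝒯.bracket 𝔛 R) := fun R =>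
      eq_sub_of_add_eq (𝒯.jacobi 𝔛 𝔜 R).symm
    rw [𝒯.dirDeriv_pairing, hj, hj]
    simp only [ContMDiffSection.coe_sub, Pi.sub_apply, map_sub, LinearMap.sub_apply]
    linarith
  by_contra hw
  obtain ⟨g, hg, hg0, hg1⟩ := exists_function (E := E) x₀ (w := 𝒯.anchor x₀ (𝒯.bracket 𝔛 𝔜 x₀)) hw
  have he : 𝒯.bracket 𝔛 𝔜 x₀ ≠ 0 := fun h => hw (by rw [h, map_zero])
  obtain ⟨e', he'⟩ : ∃ e', 𝒯.pairing x₀ (𝒯.bracket 𝔛 𝔜 x₀) e' ≠ 0 := by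
    by_contra! h
    exact he (𝒯.pairing_nondegenerate x₀ _ h)
  -- If the anchor `w` of the bracket at `x₀` were non-zero, take `P = g · (𝔛 * 𝔜)` with `g(x₀) = 0`
  -- and `dg(w) ≠ 0`, and `Q` pairing non-trivially with the bracket at `x₀`. Then the derivative of
  -- `⟨P, Q⟩` along `w` is non-zero.
  have h1 := key (smulSection hg (𝒯.bracket 𝔛 𝔜)) (extendSection E F V x₀ e')
  have h2 : (fun y => 𝒯.pairing y (smulSection hg (𝒯.bracket 𝔛 𝔜) y)
      (extendSection E F V x₀ e' y)) = fun y => g y *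
        𝒯.pairing y (𝒯.bracket 𝔛 𝔜 y) (extendSection E F V x₀ e' y) := by
    funext y
    change 𝒯.pairing y (g y • 𝒯.bracket 𝔛 𝔜 y) _ = _
    rw [map_smul, LinearMap.smul_apply, smul_eq_mul]
  rw [h2, dirDeriv_mul (hg.mdifferentiable (by simp) x₀) (𝒯.mdifferentiableAt_pairing _ _ x₀), hg0,
    zero_mul, zero_add, extendSection_apply_self] at h1
  exact (mul_ne_zero he' hg1) h1

end ExtendedTangentBundle

end AnchorOfBrackets

/-! ### The twisting form and its dependence on the splitting. -/

section Twisting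

variable {E F M : Type*} [NormedAddCommGroup E] [NormedSpace ℝ E] [FiniteDimensional ℝ E]
  [TopologicalSpace M] [T2Space M] [ChartedSpace E M] [IsManifold 𝓘(ℝ, E) ∞ M]
  [NormedAddCommGroup F] [NormedSpace ℝ F] {V : M → Type*} [TopologicalSpace (TotalSpace F V)]
  [∀ x, TopologicalSpace (V x)] [∀ x, AddCommGroup (V x)] [∀ x, Module ℝ (V x)]
  [FiberBundle F V] [VectorBundle ℝ F V] [ContMDiffVectorBundle ∞ F V 𝓘(ℝ, E)]
  {𝒯 : ExtendedTangentBundle E F V}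

/-- A smooth vector field with value `u` at `x₀`. -/
def extendVector (x₀ : M) (u : E) : VField E M :=
  extendSection E E (TangentSpace 𝓘(ℝ, E) : M → Type _) x₀ u

theorem extendVector_self (x₀ : M) (u : E) : (extendVector x₀ u x₀ : E) = u :=
  extendSection_apply_self (E := E) (F := E) (TangentSpace 𝓘(ℝ, E) : M → Type _) x₀ u

/-- The anchor, with values in the model space. -/
def ExtendedTangentBundle.anch (𝒯 : ExtendedTangentBundle E F V) (x : M) : V x →ₗ[ℝ] E :=
  𝒯.anchor x

theorem ExtendedTangentBundle.pairing_congr (𝒯 : ExtendedTangentBundle E F V) {x : M}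
    {k e e' : V x} (hk : 𝒯.anch x k = 0) (h : 𝒯.anch x e = 𝒯.anch x e') :
    𝒯.pairing x k e = 𝒯.pairing x k e' := 𝒯.pairing_eq_of_anchor hk h

namespace IsotropicSplitting

/-- The splitting at `x`, as a map on the model space. -/
def lin (s : IsotropicSplitting 𝒯) (x : M) : E →ₗ[ℝ] V x := s.toFun x

variable (s : IsotropicSplitting 𝒯)

theorem anch_lin (x : M) (u : E) : 𝒯.anch x (s.lin x u) = u := s.anchor_toFun x u

theorem pairing_lin (x : M) (u v : E) : 𝒯.pairing x (s.lin x u) (s.lin x v) = 0 :=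
  s.isotropic x u v

theorem dirDeriv_pairing_apply (X Y : VField E M) (x : M) (v : TangentSpace 𝓘(ℝ, E) x) :
    dirDeriv (fun y => 𝒯.pairing y (s.apply X y) (s.apply Y y)) x v = 0 := by
  have : (fun y => 𝒯.pairing y (s.apply X y) (s.apply Y y)) = fun _ => 0 :=
    funext fun y => s.isotropic y _ _
  rw [this, dirDeriv, mfderiv_const]
  rfl

/-- The number `⟨s(X) * s(Y), s(Z)⟩`. -/
def torsion (X Y Z : VField E M) (x : M) : ℝ :=
  𝒯.pairing x (𝒯.bracket (s.apply X) (s.apply Y) x) (s.apply Z x)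

/-- The symmetric part of the bracket paired with `s(Z)` is the derivative of `⟨s(X), s(Y)⟩`, which
vanishes by isotropy. In `torsion_swap_right` the invariance of the pairing plays the same role. -/
theorem torsion_swap_left (X Y Z : VField E M) (x : M) : s.torsion X Y Z x =
    -s.torsion Y X Z x := by
  have h := 𝒯.dirDeriv_pairing_symm (s.apply Z) (s.apply X) (s.apply Y) x
  rw [s.dirDeriv_pairing_apply] at h
  rw [torsion, torsion, 𝒯.pairing_symm, 𝒯.pairing_symm x _ (s.apply Z x)]
  linarith

theorem torsion_swap_right (X Y Z : VField E M) (x : M) :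
    s.torsion X Y Z x = -s.torsion X Z Y x := by
  have h := 𝒯.dirDeriv_pairing (s.apply X) (s.apply Y) (s.apply Z) x
  rw [s.dirDeriv_pairing_apply, 𝒯.pairing_symm x (s.apply Y x)] at h
  rw [torsion, torsion]
  linarith

theorem torsion_rotate (X Y Z : VField E M) (x : M) : s.torsion X Y Z x = s.torsion Y Z X x := by
  rw [torsion_swap_left, torsion_swap_right, neg_neg]

theorem torsion_congr_right (X Y : VField E M) {Z Z' : VField E M} {x : M} (hZ : Z x = Z' x) :
    s.torsion X Y Z x = s.torsion X Y Z' x :=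
  congrArg (fun u => 𝒯.pairing x (𝒯.bracket (s.apply X) (s.apply Y) x) (s.toFun x u)) hZ

/-- The dependence on the third field is pointwise by definition, and cyclic invariance passes this
on to the other two. Tensoriality thus follows without a Leibniz rule for the bracket. -/
theorem torsion_congr {X X' Y Y' Z Z' : VField E M} {x : M} (hX : X x = X' x) (hY : Y x = Y' x)
    (hZ : Z x = Z' x) : s.torsion X Y Z x = s.torsion X' Y' Z' x := by
  rw [s.torsion_congr_right X Y hZ, s.torsion_rotate, s.torsion_congr_right Y Z' hX,
    s.torsion_rotate, s.torsion_congr_right Z' X' hY, s.torsion_rotate]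

/-- Needed because `twist` is defined by choice. At each point, extend vectors to fields in any way:
the expression is linear in the last slot and skew, and tensoriality removes the dependence on the
extensions. -/
theorem exists_isTwisting : ∃ H, s.IsTwisting H := by
  have h : ∀ x : M, ∃ β : E [⋀^Fin 3]→L[ℝ] ℝ, ∀ u v w, β ![u, v, w] =
      2 * s.torsion (extendVector x u) (extendVector x v) (extendVector x w) x := by
    intro x
    let t : E → E → E →ₗ[ℝ] ℝ := fun u v => (2 : ℝ) •
      (𝒯.pairing x (𝒯.bracket (s.apply (extendVector x u)) (s.apply (extendVector x v)) x) ∘ₗ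
        (s.toFun x : E →ₗ[ℝ] V x))
    have ht : ∀ u v w, t u v w =
        2 * s.torsion (extendVector x u) (extendVector x v) (extendVector x w) x := fun u v w =>
      congrArg (fun u' : E => 2 * 𝒯.pairing x (𝒯.bracket (s.apply (extendVector x u))
        (s.apply (extendVector x v)) x) (s.toFun x u')) (extendVector_self x w).symm
    obtain ⟨β, hβ⟩ := exists_threeForm t
      (fun u v w => by rw [ht, ht, torsion_swap_left, mul_neg])
      (fun u v w => by rw [ht, ht, torsion_swap_right, mul_neg])
    exact ⟨β, fun u v w => (hβ u v w).trans (ht u v w)⟩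
  choose H hH using h
  refine ⟨H, fun X Y Z x => (hH x _ _ _).trans ?_⟩
  have h1 : s.torsion (extendVector x (X x)) (extendVector x (Y x)) (extendVector x (Z x)) x =
      s.torsion X Y Z x :=
    s.torsion_congr (extendVector_self x _) (extendVector_self x _) (extendVector_self x _)
  rw [h1, torsion_rotate, torsion, 𝒯.pairing_symm]

theorem isTwisting_twist : s.IsTwisting s.twist := Classical.epsilon_spec s.exists_isTwisting

theorem twist_apply (X Y Z : VField E M) (x : M) : s.twist x ![X x, Y x, Z x] =
    2 * 𝒯.pairing x (s.apply X x) (𝒯.bracket (s.apply Y) (s.apply Z) x) :=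
  s.isTwisting_twist X Y Z x

theorem isSmooth_twist : FormField.IsSmooth (fun x => Forms.ofDegree 3 (s.twist x)) := by
  refine FormField.isSmooth_ofDegree fun x₀ v => ?_
  have h : (fun x => s.twist x (fun i => coordField x₀ (v i) x)) = fun x =>
      2 * 𝒯.pairing x (s.apply (coordField x₀ (v 0)) x)
        (𝒯.bracket (s.apply (coordField x₀ (v 1))) (s.apply (coordField x₀ (v 2))) x) := by
    funext x
    rw [← twist_apply]
    refine congrArg _ (funext fun i => ?_)
    match i with
    | 0 => rfl
    | 1 => rfl
    | 2 => rfl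
  rw [h]
  exact (contMDiff_const.mul (𝒯.pairing_smooth _ _)).contMDiffAt

/-- The splitting `s'` is `s + ι_• B`. -/
def IsShift (s s' : IsotropicSplitting 𝒯) (B : M → E [⋀^Fin 2]→L[ℝ] ℝ) : Prop :=
  ∀ (x : M) (u : E) (e : V x),
    2 * 𝒯.pairing x (s'.lin x u - s.lin x u) e = B x ![u, 𝒯.anch x e]

variable {s} {s' s'' : IsotropicSplitting 𝒯} {B B' : M → E [⋀^Fin 2]→L[ℝ] ℝ}

theorem anch_sub (s s' : IsotropicSplitting 𝒯) (x : M) (u : E) :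
    𝒯.anch x (s'.lin x u - s.lin x u) = 0 := by
  rw [map_sub, s.anch_lin, s'.anch_lin, sub_self]

/-- The difference of two splittings takes values in the kernel of the anchor, hence in covectors;
isotropy of both splittings makes the resulting bilinear form skew. -/
theorem exists_isShift (s s' : IsotropicSplitting 𝒯) : ∃ B, IsShift s s' B := by
  have h : ∀ x : M, ∃ β : E [⋀^Fin 2]→L[ℝ] ℝ, ∀ u v, β ![u, v] =
      2 * 𝒯.pairing x (s'.lin x u - s.lin x u) (s.lin x v) := by
    intro x
    refine exists_twoForm (fun u => (2 : ℝ) • (𝒯.pairing x (s'.lin x u - s.lin x u) ∘ₗ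
      s.lin x)) fun u v => ?_
    simp only [LinearMap.smul_apply, LinearMap.comp_apply, smul_eq_mul]
    rw [𝒯.pairing_congr (anch_sub s s' x v) (e := s.lin x u) (e' := s'.lin x u)
      (by rw [s.anch_lin, s'.anch_lin])]
    simp only [map_sub, LinearMap.sub_apply, s.pairing_lin, s'.pairing_lin]
    rw [𝒯.pairing_symm x (s.lin x v)]
    ring
  choose B hB using h
  refine ⟨B, fun x u e => ?_⟩
  rw [hB, 𝒯.pairing_congr (anch_sub s s' x u) (s.anch_lin x (𝒯.anch x e)).symm]

theorem IsShift.apply (h : IsShift s s' B) (x : M) (u v : E) :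
    B x ![u, v] = 2 * 𝒯.pairing x (s'.lin x u) (s.lin x v) := by
  have h1 := h x u (s.lin x v)
  rw [s.anch_lin] at h1
  rw [← h1, map_sub, LinearMap.sub_apply, s.pairing_lin, sub_zero]

theorem twoForm_eq (β : E [⋀^Fin 2]→L[ℝ] ℝ) (v : Fin 2 → E) : β v = β ![v 0, v 1] :=
  congrArg β (funext fun i => by
    match i with
    | 0 => rfl
    | 1 => rfl)

theorem threeForm_eq (β : E [⋀^Fin 3]→L[ℝ] ℝ) (v : Fin 3 → E) : β v = β ![v 0, v 1, v 2] :=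
  congrArg β (funext fun i => by
    match i with
    | 0 => rfl
    | 1 => rfl
    | 2 => rfl)

theorem twoForm_swap (β : E [⋀^Fin 2]→L[ℝ] ℝ) (u v : E) : β ![u, v] = -β ![v, u] := by
  have := β.map_swap ![v, u] (i := 0) (j := 1) (by decide)
  refine Eq.trans ?_ this
  exact congrArg β (funext fun i => by
    match i with
    | 0 => rfl
    | 1 => rfl)

theorem IsShift.unique (h : IsShift s s' B) (h' : IsShift s s' B') : B = B' := by
  funext x
  ext v
  rw [twoForm_eq (B x), twoForm_eq (B' x), h.apply, h'.apply]

theorem IsShift.isSmooth (h : IsShift s s' B) : FormField.IsSmooth (FormField.ofTwo B) := by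
  refine FormField.isSmooth_ofDegree fun x₀ v => ?_
  have h : (fun x => B x (fun i => coordField x₀ (v i) x)) = fun x =>
      2 * 𝒯.pairing x (s'.apply (coordField x₀ (v 0)) x) (s.apply (coordField x₀ (v 1)) x) := by
    funext x
    exact (twoForm_eq (B x) _).trans (h.apply x _ _)
  rw [h]
  exact (contMDiff_const.mul (𝒯.pairing_smooth _ _)).contMDiffAt

theorem IsShift.trans (h : IsShift s s' B) (h' : IsShift s' s'' B') :
    IsShift s s'' (B + B') := by
  intro x u e
  have h1 := h x u e
  have h2 := h' x u e
  rw [Pi.add_apply, ContinuousAlternatingMap.add_apply, ← h1, ← h2]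
  simp only [map_sub, LinearMap.sub_apply]
  ring

theorem isShift_refl (s : IsotropicSplitting 𝒯) : IsShift s s 0 := by
  intro x u e
  simp

/-- With the section fixed, its vector part `X` is the same for both splittings, so adding `ι_X B`
to `s(X)` has to be compensated in the covector. -/
theorem IsShift.covector (h : IsShift s s' B) (x : M) (e : V x) (v : E) :
    s'.covector x e v = s.covector x e v - B x ![𝒯.anch x e, v] := by
  change 2 * 𝒯.pairing x e (s'.lin x v) = 2 * 𝒯.pairing x e (s.lin x v) - _
  have h1 := h x v e
  rw [twoForm_swap, ← h1, 𝒯.pairing_symm x _ e, map_sub]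
  ring

/-- The section `s'(X) - s(X)`. -/
def shiftSection (s s' : IsotropicSplitting 𝒯) (X : VField E M) : ContMDiffSection 𝓘(ℝ, E) F ∞ V :=
  s'.apply X - s.apply X

theorem anchor_apply_eventually (s : IsotropicSplitting 𝒯) (x₀ : M) (u : E) :
    ∀ᶠ x in 𝓝 x₀, 𝒯.anchor x (s.apply (coordField x₀ u) x) = coordField x₀ u x :=
  Eventually.of_forall fun x => s.anchor_toFun x _

theorem anch_shiftSection (s s' : IsotropicSplitting 𝒯) (X : VField E M) (x : M) :
    𝒯.anch x (shiftSection s s' X x) = 0 := anch_sub s s' x (X x)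

theorem IsShift.pairing_shiftSection (h : IsShift s s' B) (X Y : VField E M) (x : M) :
    B x ![X x, Y x] = 2 * 𝒯.pairing x (shiftSection s s' X x) (s.apply Y x) :=
  ((h x (X x) (s.lin x (Y x))).trans
    (congrArg (fun w : E => B x ![(X x : E), w]) (s.anch_lin x (Y x)))).symm

theorem IsShift.dirDeriv_left (h : IsShift s s' B) (X Y : VField E M) (x₀ : M) (u : E) :
    dirDeriv (fun x => B x ![X x, Y x]) x₀ u =
      2 * dirDeriv (fun x => 𝒯.pairing x (shiftSection s s' X x) (s.apply Y x)) x₀ u := by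
  rw [funext fun x => h.pairing_shiftSection X Y x]
  exact dirDeriv_const_mul 2 (𝒯.mdifferentiableAt_pairing _ _ x₀) u

theorem IsShift.dirDeriv_right (h : IsShift s s' B) (X Y : VField E M) (x₀ : M) (u : E) :
    dirDeriv (fun x => B x ![X x, Y x]) x₀ u =
      -2 * dirDeriv (fun x => 𝒯.pairing x (shiftSection s s' Y x) (s.apply X x)) x₀ u := by
  have h1 : (fun x => B x ![X x, Y x]) =
      fun x => -2 * 𝒯.pairing x (shiftSection s s' Y x) (s.apply X x) := by
    funext x
    refine (twoForm_swap (B x) (X x) (Y x)).trans ?_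
    rw [neg_mul]
    exact congrArg Neg.neg (h.pairing_shiftSection Y X x)
  rw [h1]
  exact dirDeriv_const_mul (-2) (𝒯.mdifferentiableAt_pairing _ _ x₀) u

/-- Write `s' = s + β` with `β` covector-valued and expand. Every pairing of a value of `β` with a
bracket of lifted coordinate fields vanishes, since such a bracket has anchor zero. What remains are
three derivatives of pairings `⟨β, s⟩`, the three terms of `dB` on commuting fields. -/
theorem IsShift.pairing_bracket (h : IsShift s s' B) (x₀ : M) (u v w : E) :
    2 * 𝒯.pairing x₀ (s'.apply (coordField x₀ u) x₀)
        (𝒯.bracket (s'.apply (coordField x₀ v)) (s'.apply (coordField x₀ w)) x₀) =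
      2 * 𝒯.pairing x₀ (s.apply (coordField x₀ u) x₀)
        (𝒯.bracket (s.apply (coordField x₀ v)) (s.apply (coordField x₀ w)) x₀) +
      (dirDeriv (fun x => B x ![coordField x₀ v x, coordField x₀ w x]) x₀ u -
        dirDeriv (fun x => B x ![coordField x₀ u x, coordField x₀ w x]) x₀ v +
        dirDeriv (fun x => B x ![coordField x₀ u x, coordField x₀ v x]) x₀ w) := by
  have hD : ∀ (a : E) (𝔜 ℨ : ContMDiffSection 𝓘(ℝ, E) F ∞ V) (t : IsotropicSplitting 𝒯),
      dirDeriv (fun y => 𝒯.pairing y (𝔜 y) (ℨ y)) x₀ a =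
      dirDeriv (fun y => 𝒯.pairing y (𝔜 y) (ℨ y)) x₀
        (𝒯.anchor x₀ (t.apply (coordField x₀ a) x₀)) := fun a 𝔜 ℨ t =>
    congrArg (fun b : E => dirDeriv (fun y => 𝒯.pairing y (𝔜 y) (ℨ y)) x₀ b)
      (((t.anchor_apply_eventually x₀ a).self_of_nhds).trans (coordField_self x₀ a)).symm
  set X := coordField x₀ u
  set Y := coordField x₀ v
  set Z := coordField x₀ w
  have hβ : ∀ (X : VField E M) {𝔜 ℨ : ContMDiffSection 𝓘(ℝ, E) F ∞ V} {a b : E}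
      (_ : ∀ᶠ x in 𝓝 x₀, 𝒯.anchor x (𝔜 x) = coordField x₀ a x)
      (_ : ∀ᶠ x in 𝓝 x₀, 𝒯.anchor x (ℨ x) = coordField x₀ b x),
      𝒯.pairing x₀ (shiftSection s s' X x₀) (𝒯.bracket 𝔜 ℨ x₀) = 0 := fun X 𝔜 ℨ a b h1 h2 =>
    𝒯.pairing_eq_zero_of_anchor (anch_shiftSection s s' X x₀) (𝒯.anchor_bracket_eq_zero h1 h2)
  have e : ∀ X, s'.apply X = s.apply X + shiftSection s s' X := fun X => by
    rw [shiftSection, add_sub_cancel]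
  have h1 : 𝒯.pairing x₀ (s'.apply X x₀) (𝒯.bracket (s'.apply Y) (s'.apply Z) x₀) =
      𝒯.pairing x₀ (s.apply X x₀) (𝒯.bracket (s'.apply Y) (s'.apply Z) x₀) := by
    rw [e X, ContMDiffSection.coe_add, Pi.add_apply, map_add, LinearMap.add_apply,
      hβ X (s'.anchor_apply_eventually x₀ v) (s'.anchor_apply_eventually x₀ w), add_zero]
  -- The first factor of the last term is left as `s'(Y)`, so that no bracket of two covector-valued
  -- sections appears.
  have h2 : 𝒯.bracket (s'.apply Y) (s'.apply Z) x₀ = 𝒯.bracket (s.apply Y) (s.apply Z) x₀ +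
      𝒯.bracket (shiftSection s s' Y) (s.apply Z) x₀ +
      𝒯.bracket (s'.apply Y) (shiftSection s s' Z) x₀ := by
    conv_lhs => rw [e Z, map_add]
    conv_lhs => rw [ContMDiffSection.coe_add, Pi.add_apply]
    congr 1
    rw [e Y, map_add, LinearMap.add_apply, ContMDiffSection.coe_add, Pi.add_apply]
  -- Invariance evaluates `⟨s(X), s'(Y) * β(Z)⟩` as a derivative along `Y`. For `β(Y) * s(Z)` the
  -- covector is on the left, so `h4` first reverses the bracket, which produces a derivative along
  -- `X`, and `h5` applies invariance along `Z`.
  have h3 := 𝒯.dirDeriv_pairing (s'.apply Y) (shiftSection s s' Z) (s.apply X) x₀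
  rw [hβ Z (s'.anchor_apply_eventually x₀ v) (s.anchor_apply_eventually x₀ u), add_zero,
    ← hD v, 𝒯.pairing_symm] at h3
  have h4 := 𝒯.dirDeriv_pairing_symm (s.apply X) (shiftSection s s' Y) (s.apply Z) x₀
  rw [← hD u] at h4
  have h5 := 𝒯.dirDeriv_pairing (s.apply Z) (shiftSection s s' Y) (s.apply X) x₀
  rw [hβ Y (s.anchor_apply_eventually x₀ w) (s.anchor_apply_eventually x₀ u), add_zero,
    ← hD w, 𝒯.pairing_symm] at h5
  rw [h1, h2, map_add, map_add, h.dirDeriv_left Y Z, h.dirDeriv_right X Z, h.dirDeriv_right X Y]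
  linarith

/-- `H_{s'} = H_s + dB` for `s' = s + ι_• B`. -/
theorem IsShift.twist (h : IsShift s s' B) : (fun x => Forms.ofDegree 3 (s'.twist x)) =
    (fun x => Forms.ofDegree 3 (s.twist x)) + FormField.extD (FormField.ofTwo B) := by
  funext x₀ k
  by_cases hk : k = 3
  · subst hk
    ext v
    have hv : ∀ β : E [⋀^Fin 3]→L[ℝ] ℝ, β v = β ![coordField x₀ (v 0) x₀,
        coordField x₀ (v 1) x₀, coordField x₀ (v 2) x₀] := fun β =>
      (threeForm_eq β v).trans (by simp only [coordField_self])
    rw [Pi.add_apply, Pi.add_apply, ContinuousAlternatingMap.add_apply,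
      FormField.extD_apply h.isSmooth, Forms.ofDegree_same, Forms.ofDegree_same, hv (s'.twist x₀),
      hv (s.twist x₀), s'.twist_apply, s.twist_apply, h.pairing_bracket, Fin.sum_univ_three]
    have hf : ∀ i : Fin 3, (fun x => FormField.ofTwo B x 2
        (fun j => coordField x₀ (i.removeNth v j) x)) = fun x =>
          B x ![coordField x₀ (i.removeNth v 0) x, coordField x₀ (i.removeNth v 1) x] :=
      fun i => funext fun x => by
        rw [FormField.ofTwo, Forms.ofDegree_same]
        exact twoForm_eq _ _
    simp only [hf]
    change _ + _ = _ + ((-1 : ℝ) ^ 0 * dirDeriv (fun x => B x ![coordField x₀ (v 1) x,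
        coordField x₀ (v 2) x]) x₀ (v 0) +
      (-1 : ℝ) ^ 1 * dirDeriv (fun x => B x ![coordField x₀ (v 0) x,
        coordField x₀ (v 2) x]) x₀ (v 1) +
      (-1 : ℝ) ^ 2 * dirDeriv (fun x => B x ![coordField x₀ (v 0) x,
        coordField x₀ (v 1) x]) x₀ (v 2))
    ring
  · have h0 : FormField.extD (FormField.ofTwo B) x₀ k = 0 := by
      rcases k with _ | k
      · rfl
      · rw [FormField.extD_congr (β := 0), FormField.extD_zero]
        · rfl
        · exact fun x => Forms.ofDegree_of_ne (by omega) _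
    rw [Pi.add_apply, Pi.add_apply, h0, add_zero, Forms.ofDegree_of_ne hk, Forms.ofDegree_of_ne hk]

end IsotropicSplitting

end Twisting

/-! ### Smooth dependence of solutions of linear equations. -/

section SmoothSolutions

variable {E M : Type*} [NormedAddCommGroup E] [NormedSpace ℝ E]
  [TopologicalSpace M] [ChartedSpace E M] {ι : Type*} [Fintype ι] [DecidableEq ι]
  {A : M → Matrix ι ι ℝ} {x₀ : M}

theorem contMDiffAt_det (h : ∀ i j, ContMDiffAt 𝓘(ℝ, E) 𝓘(ℝ, ℝ) ∞ (fun x => A x i j) x₀) :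
    ContMDiffAt 𝓘(ℝ, E) 𝓘(ℝ, ℝ) ∞ (fun x => (A x).det) x₀ := by
  simp only [Matrix.det_apply', Finset.prod_eq_multiset_prod]
  refine contMDiffAt_finsetSum fun σ _ => contMDiffAt_const.mul ?_
  exact contMDiffAt_finsetProd fun i _ => h _ _

theorem contMDiffAt_inv_apply (h : ∀ i j, ContMDiffAt 𝓘(ℝ, E) 𝓘(ℝ, ℝ) ∞ (fun x => A x i j) x₀)
    (h0 : (A x₀).det ≠ 0) (i j : ι) :
    ContMDiffAt 𝓘(ℝ, E) 𝓘(ℝ, ℝ) ∞ (fun x => (A x)⁻¹ i j) x₀ := by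
  simp only [Matrix.inv_def, Matrix.smul_apply, Ring.inverse_eq_inv', smul_eq_mul,
    Matrix.adjugate_apply]
  refine ((contMDiffAt_det h).inv₀ h0).mul (contMDiffAt_det fun k l => ?_)
  simp only [Matrix.updateRow_apply]
  split_ifs
  · exact contMDiffAt_const
  · exact h _ _

theorem det_ne_zero_eventually
    (h : ∀ i j, ContMDiffAt 𝓘(ℝ, E) 𝓘(ℝ, ℝ) ∞ (fun x => A x i j) x₀) (h0 : (A x₀).det ≠ 0) :
    ∀ᶠ x in 𝓝 x₀, (A x).det ≠ 0 :=
  (contMDiffAt_det h).continuousAt.eventually_ne h0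

/-- Solutions of a regular system of linear equations depend smoothly on the parameters. -/
theorem contMDiffAt_of_mulVec (h : ∀ i j, ContMDiffAt 𝓘(ℝ, E) 𝓘(ℝ, ℝ) ∞ (fun x => A x i j) x₀)
    (h0 : (A x₀).det ≠ 0) {p c : M → ι → ℝ}
    (hp : ∀ i, ContMDiffAt 𝓘(ℝ, E) 𝓘(ℝ, ℝ) ∞ (fun x => p x i) x₀)
    (hc : ∀ᶠ x in 𝓝 x₀, (A x).mulVec (c x) = p x) (i : ι) :
    ContMDiffAt 𝓘(ℝ, E) 𝓘(ℝ, ℝ) ∞ (fun x => c x i) x₀ := by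
  have h1 : ContMDiffAt 𝓘(ℝ, E) 𝓘(ℝ, ℝ) ∞ (fun x => ∑ j, (A x)⁻¹ i j * p x j) x₀ :=
    contMDiffAt_finsetSum fun j _ => (contMDiffAt_inv_apply h h0 i j).mul (hp j)
  refine h1.congr_of_eventuallyEq ?_
  filter_upwards [hc, det_ne_zero_eventually h h0] with x hx hx'
  have : c x = (A x)⁻¹.mulVec (p x) := by
    rw [← hx, Matrix.mulVec_mulVec, Matrix.nonsing_inv_mul _ hx'.isUnit, Matrix.one_mulVec]
  rw [this]
  rfl

end SmoothSolutions

theorem finite_fiber (F : Type*) [NormedAddCommGroup F] [NormedSpace ℝ F] [FiniteDimensional ℝ F]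
    {M : Type*} [TopologicalSpace M] (V : M → Type*) [TopologicalSpace (TotalSpace F V)]
    [∀ x, TopologicalSpace (V x)] [∀ x, AddCommGroup (V x)] [∀ x, Module ℝ (V x)]
    [FiberBundle F V] [VectorBundle ℝ F V] (x : M) : Module.Finite ℝ (V x) :=
  Module.Finite.equiv ((trivializationAt F V x).continuousLinearEquivAt ℝ x
    (FiberBundle.mem_baseSet_trivializationAt F V x)).symm.toLinearEquiv

/-! ### Shifting a splitting by a two-form. -/

section Shifts

variable {E F M : Type*} [NormedAddCommGroup E] [NormedSpace ℝ E] [FiniteDimensional ℝ E]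
  [TopologicalSpace M] [T2Space M] [ChartedSpace E M] [IsManifold 𝓘(ℝ, E) ∞ M]
  [NormedAddCommGroup F] [NormedSpace ℝ F] [FiniteDimensional ℝ F]
  {V : M → Type*} [TopologicalSpace (TotalSpace F V)]
  [∀ x, TopologicalSpace (V x)] [∀ x, AddCommGroup (V x)] [∀ x, Module ℝ (V x)]
  [FiberBundle F V] [VectorBundle ℝ F V] [ContMDiffVectorBundle ∞ F V 𝓘(ℝ, E)]
  {𝒯 : ExtendedTangentBundle E F V}

variable (𝒯) in
/-- A section is smooth if its pairings with smooth sections are. -/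
theorem contMDiffAt_of_pairing {e : ∀ x, V x} {x₀ : M}
    (h : ∀ P : ContMDiffSection 𝓘(ℝ, E) F ∞ V,
      ContMDiffAt 𝓘(ℝ, E) 𝓘(ℝ, ℝ) ∞ (fun x => 𝒯.pairing x (e x) (P x)) x₀) :
    ContMDiffAt 𝓘(ℝ, E) (𝓘(ℝ, E).prod 𝓘(ℝ, F)) ∞ (fun x => TotalSpace.mk' F x (e x)) x₀ := by
  let b := Module.finBasis ℝ F
  let β := fun i => bumpSection (E := E) V x₀ (b i)
  -- The Gram matrix of a local frame. It is invertible at `x₀` by non-degeneracy, and the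
  -- coefficients of `e` solve the linear system with this matrix whose right side consists of the
  -- given pairings.
  let G : M → Matrix (Fin (Module.finrank ℝ F)) (Fin (Module.finrank ℝ F)) ℝ :=
    fun x i j => 𝒯.pairing x (β i x) (β j x)
  let c : M → F := fun x => (trivializationAt F V x₀).continuousLinearMapAt ℝ x (e x)
  have hc : ∀ᶠ x in 𝓝 x₀, e x = ∑ j, b.repr (c x) j • β j x := by
    filter_upwards [bumpSection_eventually (E := E) (F := F) V x₀] with x hx
    rw [← bumpSection_expand V x₀ (c x) b x, hx.2]
    exact ((trivializationAt F V x₀).symmL_continuousLinearMapAt hx.1 (e x)).symm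
  have hG : ∀ i j, ContMDiffAt 𝓘(ℝ, E) 𝓘(ℝ, ℝ) ∞ (fun x => G x i j) x₀ := fun i j =>
    (𝒯.pairing_smooth _ _).contMDiffAt
  have hpair : ∀ x (a : Fin (Module.finrank ℝ F) → ℝ) i,
      𝒯.pairing x (∑ j, a j • β j x) (β i x) = (G x).mulVec a i := by
    intro x a i
    rw [map_sum, LinearMap.sum_apply, Matrix.mulVec, dotProduct]
    refine Finset.sum_congr rfl fun j _ => ?_
    rw [map_smul, LinearMap.smul_apply, 𝒯.pairing_symm, smul_eq_mul, mul_comm]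
  have h0 : (G x₀).det ≠ 0 := by
    rw [Ne, ← Matrix.exists_mulVec_eq_zero_iff]
    rintro ⟨a, ha, ha'⟩
    obtain ⟨hx, hx'⟩ := (bumpSection_eventually (E := E) (F := F) V x₀).self_of_nhds
    have h1 : ∑ j, a j • β j x₀ = 0 := by
      refine 𝒯.pairing_nondegenerate x₀ _ fun e' => ?_
      have h2 : e' = ∑ i, b.repr ((trivializationAt F V x₀).continuousLinearMapAt ℝ x₀ e') i •
          β i x₀ := by
        rw [← bumpSection_expand V x₀ _ b x₀, hx']
        exact ((trivializationAt F V x₀).symmL_continuousLinearMapAt hx e').symm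
      rw [h2, map_sum]
      refine Finset.sum_eq_zero fun i _ => ?_
      rw [map_smul, hpair, ha', Pi.zero_apply, smul_zero]
    have h2 : (trivializationAt F V x₀).symmL ℝ x₀ (∑ j, a j • b j) = 0 := by
      rw [map_sum, ← h1]
      refine Finset.sum_congr rfl fun j _ => ?_
      rw [map_smul, ← hx']
    have h3 := (trivializationAt F V x₀).continuousLinearMapAt_symmL (R := ℝ) hx (∑ j, a j • b j)
    rw [h2, map_zero] at h3
    exact ha (funext fun j => Fintype.linearIndependent_iff.1 b.linearIndependent a h3.symm j)
  have hcs := contMDiffAt_of_mulVec (c := fun x j => b.repr (c x) j)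
    (p := fun x i => 𝒯.pairing x (e x) (β i x)) hG h0 (fun i => h (β i)) (by
      filter_upwards [hc] with x hx
      funext i
      rw [← hpair, ← hx])
  refine (contMDiffAt_along_sum V Finset.univ (f := fun x => x) contMDiffAt_id
    (c := fun j x => b.repr (c x) j) (β := fun j x => β j x) hcs
    (fun j => (β j).contMDiff.contMDiffAt)).congr_of_eventuallyEq ?_
  filter_upwards [hc] with x hx
  rw [hx]

/-- A `2`-form as a bilinear map. -/
def bilinearOfTwoForm (β : E [⋀^Fin 2]→L[ℝ] ℝ) : E →ₗ[ℝ] E →ₗ[ℝ] ℝ :=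
  have hadd : ∀ u u' v : E, β ![u + u', v] = β ![u, v] + β ![u', v] := fun u u' v =>
    β.toAlternatingMap.toMultilinearMap.cons_add ![v] u u'
  have hsmul : ∀ (r : ℝ) (u v : E), β ![r • u, v] = r • β ![u, v] := fun r u v =>
    β.toAlternatingMap.toMultilinearMap.cons_smul ![v] r u
  LinearMap.mk₂ ℝ (fun u v => β ![u, v]) hadd hsmul
    (fun u v v' => by
      rw [IsotropicSplitting.twoForm_swap, hadd, IsotropicSplitting.twoForm_swap β v,
        IsotropicSplitting.twoForm_swap β v']
      ring)
    (fun r u v => by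
      rw [IsotropicSplitting.twoForm_swap, hsmul, IsotropicSplitting.twoForm_swap β v, smul_neg,
        neg_neg])

theorem bilinearOfTwoForm_apply (β : E [⋀^Fin 2]→L[ℝ] ℝ) (u v : E) :
    bilinearOfTwoForm β u v = β ![u, v] := rfl

variable (𝒯) in
-- In finite dimension a non-degenerate pairing identifies the fibre with its dual, so the
-- functional `e ↦ β(u, anchor e) / 2` is represented by an element, linearly in `u`.
theorem exists_musical (x : M) (β : E →ₗ[ℝ] E →ₗ[ℝ] ℝ) :
    ∃ k : E →ₗ[ℝ] V x, ∀ u e, 2 * 𝒯.pairing x (k u) e = β u (𝒯.anch x e) := by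
  have := finite_fiber F V x
  have hinj : Function.Injective (𝒯.pairing x : V x →ₗ[ℝ] Module.Dual ℝ (V x)) := by
    rw [← LinearMap.ker_eq_bot, LinearMap.ker_eq_bot']
    exact fun e he => 𝒯.pairing_nondegenerate x e fun e' => by rw [he, LinearMap.zero_apply]
  let D := LinearEquiv.ofInjectiveOfFinrankEq (𝒯.pairing x : V x →ₗ[ℝ] Module.Dual ℝ (V x)) hinj
    Subspace.dual_finrank_eq.symm
  refine ⟨D.symm.toLinearMap ∘ₗ ((2 : ℝ)⁻¹ • β.compl₂ (𝒯.anch x)), fun u e => ?_⟩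
  have h := D.apply_symm_apply (((2 : ℝ)⁻¹ • β.compl₂ (𝒯.anch x)) u)
  have h' := LinearMap.congr_fun h e
  change 2 * D (D.symm (((2 : ℝ)⁻¹ • β.compl₂ (𝒯.anch x)) u)) e = _
  rw [h]
  simp

namespace FormField

theorem IsSmooth.contMDiff_apply_two {B : M → E [⋀^Fin 2]→L[ℝ] ℝ} (hB : IsSmooth (ofTwo B))
    (X Y : VField E M) : ContMDiff 𝓘(ℝ, E) 𝓘(ℝ, ℝ) ∞ fun x => B x ![X x, Y x] := by
  intro x₀
  have h := (isSmooth_contract Y.contMDiff (isSmooth_contract X.contMDiff hB)).contMDiffAt_apply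
    (k := 0) x₀ ![]
  refine h.congr_of_eventuallyEq (Eventually.of_forall fun x => ?_)
  have h2 : ∀ u v : E, Forms.contract v (Forms.contract u (Forms.ofDegree 2 (B x))) 0 =
      ((B x).curryLeft u).curryLeft v := fun u v => by
    rw [Forms.contract_ofDegree, Forms.contract_ofDegree, Forms.ofDegree_same]
  have h1 : contract (fun x => Y x) (contract (fun x => X x) (ofTwo B)) x 0 =
      (((B x).curryLeft (X x : E)).curryLeft (Y x : E)) := h2 _ _
  change _ = contract (fun x => Y x) (contract (fun x => X x) (ofTwo B)) x 0 _
  rw [h1]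
  exact congrArg (B x) (funext fun i => by
    match i with
    | 0 => rfl
    | 1 => rfl)

end FormField

/-- The vector field `anchor 𝔛`. -/
def anchorField (𝒯 : ExtendedTangentBundle E F V) (𝔛 : ContMDiffSection 𝓘(ℝ, E) F ∞ V) :
    VField E M where
  toFun := 𝒯.vectorPart 𝔛
  contMDiff_toFun := 𝒯.anchor_smooth 𝔛

namespace IsotropicSplitting

/-- Add to `s(u)` the covector `ι_u B`. The two cross terms in the pairing cancel because `B` is
skew, and covectors pair to zero with each other. Smoothness is checked on pairings by
`contMDiffAt_of_pairing`. -/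
theorem exists_shift (s : IsotropicSplitting 𝒯) {B : M → E [⋀^Fin 2]→L[ℝ] ℝ}
    (hB : FormField.IsSmooth (FormField.ofTwo B)) : ∃ s', IsShift s s' B := by
  choose k hk using fun x => exists_musical 𝒯 x (bilinearOfTwoForm (B x))
  have hk0 : ∀ x u, 𝒯.anch x (k x u) = 0 := fun x u =>
    (𝒯.exact x (k x u)).2 ⟨bilinearOfTwoForm (B x) u, hk x u⟩
  have hanch : ∀ x u, 𝒯.anch x (s.lin x u + k x u) = u := fun x u => by
    rw [map_add, anch_lin, hk0, add_zero]
  have hiso : ∀ x u v, 𝒯.pairing x (s.lin x u + k x u) (s.lin x v + k x v) = 0 := fun x u v => by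
    have h1 := hk x u (s.lin x v)
    have h2 := hk x v (s.lin x u)
    have h3 := hk x u (k x v)
    rw [anch_lin, bilinearOfTwoForm_apply] at h1 h2
    rw [twoForm_swap] at h2
    rw [hk0, map_zero] at h3
    simp only [map_add, LinearMap.add_apply, s.pairing_lin]
    rw [𝒯.pairing_symm x (s.lin x u)]
    linarith
  let s' : IsotropicSplitting 𝒯 :=
    { toFun := fun x => (s.lin x + k x : E →ₗ[ℝ] V x)
      smooth := fun X x₀ => contMDiffAt_of_pairing 𝒯 (e := fun x => (s.lin x + k x) (X x))
        fun P => by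
          have h1 : (fun x => 𝒯.pairing x ((s.lin x + k x) (X x)) (P x)) = fun x =>
              𝒯.pairing x (s.apply X x) (P x) + 2⁻¹ * B x ![X x, anchorField 𝒯 P x] := by
            funext x
            have h2 := hk x (X x) (P x)
            have h3 : B x ![X x, anchorField 𝒯 P x] = 2 * 𝒯.pairing x (k x (X x)) (P x) :=
              h2.symm
            rw [h3, inv_mul_cancel_left₀ two_ne_zero]
            exact (LinearMap.congr_fun (map_add (𝒯.pairing x) _ _) (P x)).trans
              (LinearMap.add_apply _ _ _)
          rw [h1]
          exact ((𝒯.pairing_smooth _ _).add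
            (contMDiff_const.mul (hB.contMDiff_apply_two _ _))).contMDiffAt
      anchor_toFun := hanch
      isotropic := hiso }
  refine ⟨s', fun x u e => ?_⟩
  have : s'.lin x u = s.lin x u + k x u := rfl
  rw [this, add_sub_cancel_left, hk]
  rfl

end IsotropicSplitting

end Shifts

/-! ### Spinors and their operators. -/

section Spinors

variable {E F M : Type*} [NormedAddCommGroup E] [NormedSpace ℝ E] [FiniteDimensional ℝ E]
  [TopologicalSpace M] [T2Space M] [ChartedSpace E M] [IsManifold 𝓘(ℝ, E) ∞ M]
  [NormedAddCommGroup F] [NormedSpace ℝ F] {V : M → Type*} [TopologicalSpace (TotalSpace F V)]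
  [∀ x, TopologicalSpace (V x)] [∀ x, AddCommGroup (V x)] [∀ x, Module ℝ (V x)]
  [FiberBundle F V] [VectorBundle ℝ F V] [ContMDiffVectorBundle ∞ F V 𝓘(ℝ, E)]
  {𝒯 : ExtendedTangentBundle E F V}

namespace FormField

theorem extD_sub {α β : FormField E M} (hα : IsSmooth α) (hβ : IsSmooth β) :
    extD (α - β) = extD α - extD β := by
  have h := extD_add (hα.sub hβ) hβ
  rw [sub_add_cancel] at h
  rw [h, add_sub_cancel_right]

theorem contract_add_left (X Y : Π x : M, TangentSpace 𝓘(ℝ, E) x) (ρ : FormField E M) :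
    contract (X + Y) ρ = contract X ρ + contract Y ρ := by
  have h : ∀ (u v : E) (α : Forms E), Forms.contract (u + v) α =
      Forms.contract u α + Forms.contract v α := fun u v α => by
    funext k
    exact map_add ((α (k + 1)).curryLeft) u v
  exact funext fun x => h _ _ _

theorem contract_smul_left (r : ℝ) (X : Π x : M, TangentSpace 𝓘(ℝ, E) x) (ρ : FormField E M) :
    contract (r • X) ρ = r • contract X ρ := by
  have h : ∀ (u : E) (α : Forms E), Forms.contract (r • u) α = r • Forms.contract u α :=
    fun u α => by
      funext k
      exact map_smul ((α (k + 1)).curryLeft) r u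
  exact funext fun x => h _ _

end FormField

namespace IsotropicSplitting

variable (s : IsotropicSplitting 𝒯)

theorem isSmooth_formPart (𝔛 : ContMDiffSection 𝓘(ℝ, E) F ∞ V) :
    FormField.IsSmooth (s.formPart 𝔛) := by
  refine FormField.isSmooth_ofDegree fun x₀ v => ?_
  exact ((contMDiff_const (c := (2 : ℝ))).mul
    (𝒯.pairing_smooth 𝔛 (s.apply (coordField x₀ (v 0))))).contMDiffAt

theorem formPart_add (𝔛 𝔜 : ContMDiffSection 𝓘(ℝ, E) F ∞ V) :
    s.formPart (𝔛 + 𝔜) = s.formPart 𝔛 + s.formPart 𝔜 := by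
  funext x
  refine Eq.trans ?_ (Forms.ofDegree_add 1 _ _)
  refine congrArg (Forms.ofDegree 1) ?_
  ext v
  change 2 * 𝒯.pairing x (𝔛 x + 𝔜 x) _ = 2 * 𝒯.pairing x (𝔛 x) _ + 2 * 𝒯.pairing x (𝔜 x) _
  rw [map_add, LinearMap.add_apply, mul_add]

theorem formPart_smul (r : ℝ) (𝔛 : ContMDiffSection 𝓘(ℝ, E) F ∞ V) :
    s.formPart (r • 𝔛) = r • s.formPart 𝔛 := by
  funext x
  refine Eq.trans ?_ (Forms.ofDegree_smul 1 _ _)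
  refine congrArg (Forms.ofDegree 1) ?_
  ext v
  change 2 * 𝒯.pairing x (r • 𝔛 x) _ = r * (2 * 𝒯.pairing x (𝔛 x) _)
  rw [map_smul, LinearMap.smul_apply, smul_eq_mul, mul_left_comm]

variable {s} {s' : IsotropicSplitting 𝒯} {B : M → E [⋀^Fin 2]→L[ℝ] ℝ}

theorem IsShift.formPart (h : IsShift s s' B) (𝔛 : ContMDiffSection 𝓘(ℝ, E) F ∞ V) :
    s'.formPart 𝔛 = s.formPart 𝔛 -
      FormField.contract (𝒯.vectorPart 𝔛) (FormField.ofTwo B) := by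
  funext x
  have h1 : FormField.contract (𝒯.vectorPart 𝔛) (FormField.ofTwo B) x =
      Forms.ofDegree 1 ((B x).curryLeft (𝒯.anch x (𝔛 x))) :=
    Forms.contract_ofDegree 1 (𝒯.anch x (𝔛 x)) (B x)
  rw [Pi.sub_apply, h1, eq_sub_iff_add_eq]
  refine (Forms.ofDegree_add 1 _ _).symm.trans ?_
  refine congrArg (Forms.ofDegree 1) ?_
  ext v
  change s'.covector x (𝔛 x) (v 0) + B x (Matrix.vecCons (𝒯.anch x (𝔛 x)) v) =
    s.covector x (𝔛 x) (v 0)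
  rw [h.covector, twoForm_eq (B x) (Matrix.vecCons _ v)]
  exact sub_add_cancel (s.covector x (𝔛 x) (v 0)) (B x ![𝒯.anch x (𝔛 x), v 0])

end IsotropicSplitting

open IsotropicSplitting FormField

theorem mem_spinors {ρ : SpinorField 𝒯} : ρ ∈ spinors 𝒯 ↔ (∀ s, (ρ s).IsSmooth) ∧
    ∀ {s s' : IsotropicSplitting 𝒯} {B}, IsShift s s' B →
      ρ s' = FormField.mul (FormField.exp (ofTwo B)) (ρ s) :=
  ⟨fun h => ⟨h.1, fun hB => funext (h.2 _ _ _ hB)⟩,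
    fun h => ⟨h.1, fun _ _ _ hB => congrFun (h.2 hB)⟩⟩

/-- Any two splittings differ by some `B`, so one representative determines the others. -/
theorem spinor_ext {ρ η : SpinorField 𝒯} (hρ : ρ ∈ spinors 𝒯) (hη : η ∈ spinors 𝒯)
    (s : IsotropicSplitting 𝒯) (h : ρ s = η s) : ρ = η := by
  funext s'
  obtain ⟨B, hB⟩ := exists_isShift s s'
  rw [(mem_spinors.1 hρ).2 hB, (mem_spinors.1 hη).2 hB, h]

/-- Define the other representatives by the transformation law starting from `s`. They are
consistent because shifts add and `e^{B+B'} = e^B ∧ e^{B'}`. -/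
theorem exists_spinor (s : IsotropicSplitting 𝒯) {θ : FormField E M} (hθ : IsSmooth θ) :
    ∃ ρ ∈ spinors 𝒯, ρ s = θ := by
  choose B hB using fun s' => exists_isShift s s'
  refine ⟨fun s' => FormField.mul (FormField.exp (ofTwo (B s'))) θ, mem_spinors.2 ⟨fun s' =>
    isSmooth_mul (isSmooth_exp (hB s').isSmooth) hθ, fun {s₁ s₂ B'} h => ?_⟩, ?_⟩
  · rw [← FormField.mul_assoc, ← exp_ofTwo_add, (hB s₂).unique ((hB s₁).trans h), add_comm]
  · change FormField.mul (FormField.exp (ofTwo (B s))) θ = θ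
    rw [(hB s).unique (isShift_refl s), exp_ofTwo_zero, FormField.one_mul]

/-- The term `dB ∧` from conjugating `d` by `e^B` cancels against the change of `H`. -/
theorem dT_mem {ρ : SpinorField 𝒯} (hρ : ρ ∈ spinors 𝒯) : dT ρ ∈ spinors 𝒯 := by
  rw [mem_spinors] at hρ ⊢
  refine ⟨fun s => (isSmooth_extD (hρ.1 s)).sub (isSmooth_mul s.isSmooth_twist (hρ.1 s)),
    fun {s s' B} h => ?_⟩
  rw [dT, dT, hρ.2 h, h.twist, extD_exp_mul h.isSmooth (hρ.1 s), mul_exp_ofTwo_left,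
    ← FormField.mul_sub, FormField.add_mul]
  congr 1
  abel

/-- The term `ι_X B ∧` from conjugating `ι_X` cancels against the change of the covector part. -/
theorem cliff_mem (𝔛 : ContMDiffSection 𝓘(ℝ, E) F ∞ V) {ρ : SpinorField 𝒯}
    (hρ : ρ ∈ spinors 𝒯) : cliff 𝔛 ρ ∈ spinors 𝒯 := by
  rw [mem_spinors] at hρ ⊢
  refine ⟨fun s => (isSmooth_contract (𝒯.anchor_smooth 𝔛) (hρ.1 s)).add
    (isSmooth_mul (s.isSmooth_formPart 𝔛) (hρ.1 s)), fun {s s' B} h => ?_⟩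
  rw [cliff, cliff, hρ.2 h, h.formPart, contract_exp_mul, mul_exp_ofTwo_left,
    ← FormField.mul_add, FormField.sub_mul]
  congr 1
  abel

theorem isSmooth_lieD {X : Π x : M, TangentSpace 𝓘(ℝ, E) x}
    (hX : ContMDiff 𝓘(ℝ, E) 𝓘(ℝ, E).tangent ∞ fun x => (⟨x, X x⟩ : TangentBundle 𝓘(ℝ, E) M))
    {ρ : FormField E M} (hρ : IsSmooth ρ) : IsSmooth (lieD X ρ) :=
  (isSmooth_extD (isSmooth_contract hX hρ)).add (isSmooth_contract hX (isSmooth_extD hρ))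

/-- Under the shift, `dξ - ι_X H` changes by `-d(ι_X B) - ι_X dB = -L_X B`, which cancels the term
from conjugating `L_X`. -/
theorem lieT_mem (𝔛 : ContMDiffSection 𝓘(ℝ, E) F ∞ V) {ρ : SpinorField 𝒯}
    (hρ : ρ ∈ spinors 𝒯) : lieT 𝔛 ρ ∈ spinors 𝒯 := by
  rw [mem_spinors] at hρ ⊢
  have hX := 𝒯.anchor_smooth 𝔛
  change ContMDiff 𝓘(ℝ, E) 𝓘(ℝ, E).tangent ∞
    fun x => (⟨x, 𝒯.vectorPart 𝔛 x⟩ : TangentBundle 𝓘(ℝ, E) M) at hX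
  refine ⟨fun s => (isSmooth_lieD hX (hρ.1 s)).add (isSmooth_mul
    ((isSmooth_extD (s.isSmooth_formPart 𝔛)).sub (isSmooth_contract hX s.isSmooth_twist))
    (hρ.1 s)), fun {s s' B} h => ?_⟩
  rw [lieT, lieT, hρ.2 h, h.formPart, h.twist, lieD_exp_mul hX h.isSmooth (hρ.1 s),
    mul_exp_ofTwo_left, ← FormField.mul_add,
    extD_sub (s.isSmooth_formPart 𝔛) (isSmooth_contract hX h.isSmooth), contract_add]
  congr 1
  have : extD (s.formPart 𝔛) - extD (contract (𝒯.vectorPart 𝔛) (ofTwo B)) -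
      (contract (𝒯.vectorPart 𝔛) (fun x => Forms.ofDegree 3 (s.twist x)) +
        contract (𝒯.vectorPart 𝔛) (extD (ofTwo B))) =
      (extD (s.formPart 𝔛) - contract (𝒯.vectorPart 𝔛) (fun x => Forms.ofDegree 3 (s.twist x))) -
        lieD (𝒯.vectorPart 𝔛) (ofTwo B) := by
    rw [lieD]
    abel
  rw [this, FormField.sub_mul]
  abel

variable (𝒯) in
/-- The differential of spinors. -/
def dTLinear : spinors 𝒯 →ₗ[ℝ] spinors 𝒯 where
  toFun ρ := ⟨dT ρ.1, dT_mem ρ.2⟩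
  map_add' ρ η := Subtype.ext (dT_add ρ.2 η.2)
  map_smul' r ρ := Subtype.ext (dT_smul r ρ.1)

variable (𝒯) in
/-- The Clifford action on spinors. -/
def cliffLinear : ContMDiffSection 𝓘(ℝ, E) F ∞ V →ₗ[ℝ] spinors 𝒯 →ₗ[ℝ] spinors 𝒯 where
  toFun 𝔛 :=
    { toFun := fun ρ => ⟨cliff 𝔛 ρ.1, cliff_mem 𝔛 ρ.2⟩
      map_add' := fun ρ η => Subtype.ext (cliff_add 𝔛 ρ.1 η.1)
      map_smul' := fun r ρ => Subtype.ext (cliff_smul r 𝔛 ρ.1) }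
  map_add' 𝔛 𝔜 := by
    ext1 ρ
    refine Subtype.ext (funext fun s => ?_)
    have hX : 𝒯.vectorPart (𝔛 + 𝔜) = 𝒯.vectorPart 𝔛 + 𝒯.vectorPart 𝔜 :=
      funext fun x => map_add (𝒯.anchor x) _ _
    change contract (𝒯.vectorPart (𝔛 + 𝔜)) (ρ.1 s) + FormField.mul (s.formPart (𝔛 + 𝔜)) (ρ.1 s) =
      (contract (𝒯.vectorPart 𝔛) (ρ.1 s) + FormField.mul (s.formPart 𝔛) (ρ.1 s)) +
      (contract (𝒯.vectorPart 𝔜) (ρ.1 s) + FormField.mul (s.formPart 𝔜) (ρ.1 s))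
    rw [hX, contract_add_left, formPart_add, FormField.add_mul]
    abel
  map_smul' r 𝔛 := by
    ext1 ρ
    refine Subtype.ext (funext fun s => ?_)
    have hX : 𝒯.vectorPart (r • 𝔛) = r • 𝒯.vectorPart 𝔛 :=
      funext fun x => map_smul (𝒯.anchor x) r _
    have hm : FormField.mul (r • s.formPart 𝔛) (ρ.1 s) = r • FormField.mul (s.formPart 𝔛) (ρ.1 s) :=
      funext fun x => Forms.smul_mul r _ _
    change contract (𝒯.vectorPart (r • 𝔛)) (ρ.1 s) + FormField.mul (s.formPart (r • 𝔛)) (ρ.1 s) =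
      r • (contract (𝒯.vectorPart 𝔛) (ρ.1 s) + FormField.mul (s.formPart 𝔛) (ρ.1 s))
    rw [hX, contract_smul_left, formPart_smul, hm, smul_add]

end Spinors

/-! ### The two-form representing a morphism. -/

section RepresentingForm

variable {E F M : Type*} [NormedAddCommGroup E] [NormedSpace ℝ E] [FiniteDimensional ℝ E]
  [TopologicalSpace M] [T2Space M] [ChartedSpace E M] [IsManifold 𝓘(ℝ, E) ∞ M]
  [NormedAddCommGroup F] [NormedSpace ℝ F] [FiniteDimensional ℝ F]
  {V : M → Type*} [TopologicalSpace (TotalSpace F V)]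
  [∀ x, TopologicalSpace (V x)] [∀ x, AddCommGroup (V x)] [∀ x, Module ℝ (V x)]
  [FiberBundle F V] [VectorBundle ℝ F V] [ContMDiffVectorBundle ∞ F V 𝓘(ℝ, E)]
  {E' F' N : Type*} [NormedAddCommGroup E'] [NormedSpace ℝ E'] [FiniteDimensional ℝ E']
  [TopologicalSpace N] [T2Space N] [ChartedSpace E' N] [IsManifold 𝓘(ℝ, E') ∞ N]
  [NormedAddCommGroup F'] [NormedSpace ℝ F'] [FiniteDimensional ℝ F']
  {W : N → Type*} [TopologicalSpace (TotalSpace F' W)]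
  [∀ y, TopologicalSpace (W y)] [∀ y, AddCommGroup (W y)] [∀ y, Module ℝ (W y)]
  [FiberBundle F' W] [VectorBundle ℝ F' W] [ContMDiffVectorBundle ∞ F' W 𝓘(ℝ, E')]
  {𝒯M : ExtendedTangentBundle E F V} {𝒯N : ExtendedTangentBundle E' F' W}

/-- In the decomposition `e = s(X) + ξ` this is `⟨e, e'⟩ = (ξ(X') + ξ'(X)) / 2`. -/
theorem IsotropicSplitting.pairing_eq (s : IsotropicSplitting 𝒯M) (x : M) (e e' : V x) :
    𝒯M.pairing x e e' = 𝒯M.pairing x e (s.lin x (𝒯M.anch x e')) +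
      𝒯M.pairing x e' (s.lin x (𝒯M.anch x e)) := by
  have h : 𝒯M.anch x (e - s.lin x (𝒯M.anch x e)) = 0 := by rw [map_sub, s.anch_lin, sub_self]
  have h1 := 𝒯M.pairing_congr h (s.anch_lin x (𝒯M.anch x e')).symm
  rw [map_sub, LinearMap.sub_apply, LinearMap.sub_apply, s.pairing_lin,
    𝒯M.pairing_symm x (s.lin x _) e'] at h1
  linarith

namespace Morphism

variable (f : Morphism 𝒯M 𝒯N) (sM : IsotropicSplitting 𝒯M) (sN : IsotropicSplitting 𝒯N)

/-- The differential of the underlying map. -/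
def der (x : M) : E →L[ℝ] E' := diff f.toFun x

/-- The map `(e, v) ↦ 2⟨e₁, sM(v)⟩ - 2⟨e₂, sN(f_* v)⟩`. -/
def defect (x : M) : V x × W (f.toFun x) →ₗ[ℝ] E →ₗ[ℝ] ℝ :=
  (2 : ℝ) • ((𝒯M.pairing x).compl₂ (sM.lin x) ∘ₗ LinearMap.fst ℝ (V x) (W (f.toFun x)) -
    (𝒯N.pairing (f.toFun x)).compl₂ (sN.lin (f.toFun x) ∘ₗ (f.der x : E →ₗ[ℝ] E')) ∘ₗ
      LinearMap.snd ℝ (V x) (W (f.toFun x)))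

theorem defect_apply (x : M) (e : V x × W (f.toFun x)) (v : E) : f.defect sM sN x e v =
    2 * (𝒯M.pairing x e.1 (sM.lin x v) - 𝒯N.pairing (f.toFun x) e.2
      (sN.lin (f.toFun x) (f.der x v))) := rfl

theorem represents_iff {b : M → E [⋀^Fin 2]→L[ℝ] ℝ} : f.Represents sM sN b ↔
    ∀ (x : M) (e : V x × W (f.toFun x)), e ∈ f.str x ↔
      𝒯N.anch (f.toFun x) e.2 = f.der x (𝒯M.anch x e.1) ∧
        ∀ v, f.defect sM sN x e v = b x ![𝒯M.anch x e.1, v] := by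
  refine forall_congr' fun x => forall_congr' fun e => iff_congr Iff.rfl
    (and_congr Iff.rfl (forall_congr' fun v => ?_))
  rw [defect_apply, mul_sub, sub_eq_iff_eq_add']
  rfl

variable {f}

theorem anch_snd {x : M} {e : V x × W (f.toFun x)} (he : e ∈ f.str x) :
    𝒯N.anch (f.toFun x) e.2 = f.der x (𝒯M.anch x e.1) := (f.isotropic x).2.1 e he

variable (f) in
theorem exists_mem (x : M) (u : E) : ∃ e ∈ f.str x, 𝒯M.anch x e.1 = u := (f.isotropic x).2.2 u

/-- The product pairing of two pairs over the graph is, up to a factor, the symmetrization of the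
defect. Isotropy of the structure is therefore skewness of the defect. -/
theorem prodPairing_eq {x : M} {e e' : V x × W (f.toFun x)}
    (he : 𝒯N.anch (f.toFun x) e.2 = f.der x (𝒯M.anch x e.1))
    (he' : 𝒯N.anch (f.toFun x) e'.2 = f.der x (𝒯M.anch x e'.1)) :
    f.defect sM sN x e (𝒯M.anch x e'.1) + f.defect sM sN x e' (𝒯M.anch x e.1) =
      -2 * prodPairing 𝒯M 𝒯N x (f.toFun x) e e' := by
  rw [prodPairing, sM.pairing_eq x e.1, sN.pairing_eq (f.toFun x) e.2, he, he', defect_apply,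
    defect_apply]
  ring

theorem defect_skew {x : M} {e e' : V x × W (f.toFun x)} (he : e ∈ f.str x) (he' : e' ∈ f.str x) :
    f.defect sM sN x e (𝒯M.anch x e'.1) = -f.defect sM sN x e' (𝒯M.anch x e.1) := by
  have h := prodPairing_eq sM sN (anch_snd he) (anch_snd he')
  rw [(f.isotropic x).1 e he e' he', mul_zero] at h
  linarith

/-- Skewness exchanges the pair with the test vector `v`, after which only the anchor of the pair
enters. -/
theorem defect_congr {x : M} {e e' : V x × W (f.toFun x)} (he : e ∈ f.str x) (he' : e' ∈ f.str x)
    (h : 𝒯M.anch x e.1 = 𝒯M.anch x e'.1) : f.defect sM sN x e = f.defect sM sN x e' := by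
  ext v
  obtain ⟨z, hz, rfl⟩ := f.exists_mem x v
  rw [defect_skew sM sN he hz, defect_skew sM sN he' hz, h]

theorem exists_form (x : M) : ∃ β : E [⋀^Fin 2]→L[ℝ] ℝ, ∀ e ∈ f.str x, ∀ v,
    f.defect sM sN x e v = β ![𝒯M.anch x e.1, v] := by
  choose ε hε hε' using f.exists_mem x
  obtain ⟨β, hβ⟩ := exists_twoForm (fun u => f.defect sM sN x (ε u)) fun u v => by
    have := defect_skew sM sN (hε u) (hε v)
    rwa [hε', hε'] at this
  exact ⟨β, fun e he v => by rw [hβ, defect_congr sM sN he (hε _) (hε' _).symm]⟩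

/-- The pairs over the graph whose defect is given by `b` form an isotropic space, because `b` is
skew. It contains the structure, hence equals it by maximality. -/
theorem represents_of_forall {b : M → E [⋀^Fin 2]→L[ℝ] ℝ}
    (h : ∀ x, ∀ e ∈ f.str x, ∀ v, f.defect sM sN x e v = b x ![𝒯M.anch x e.1, v]) :
    f.Represents sM sN b := by
  rw [represents_iff]
  intro x e
  let S : Submodule ℝ (V x × W (f.toFun x)) :=
    { carrier := {e | 𝒯N.anch (f.toFun x) e.2 = f.der x (𝒯M.anch x e.1) ∧
        ∀ v, f.defect sM sN x e v = bilinearOfTwoForm (b x) (𝒯M.anch x e.1) v}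
      zero_mem' := by simp
      add_mem' := fun {e e'} he he' => ⟨by
          rw [Prod.snd_add, Prod.fst_add, map_add, map_add, map_add, he.1, he'.1], fun v => by
          rw [Prod.fst_add, map_add, map_add, map_add, LinearMap.add_apply, LinearMap.add_apply,
            he.2, he'.2]⟩
      smul_mem' := fun r e he => ⟨by
          rw [Prod.smul_snd, Prod.smul_fst, map_smul, map_smul, map_smul, he.1], fun v => by
          rw [Prod.smul_fst, map_smul, map_smul, map_smul, LinearMap.smul_apply,
            LinearMap.smul_apply, he.2]⟩ }
  have hS : f.str x ≤ S := fun e he => ⟨anch_snd he, h x e he⟩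
  have hiso : IsIsotropicOver 𝒯M 𝒯N f.toFun x S := by
    refine ⟨fun e he e' he' => ?_, fun e he => he.1, fun u => ?_⟩
    · have h1 := prodPairing_eq sM sN he.1 he'.1
      rw [he.2, he'.2, bilinearOfTwoForm_apply, bilinearOfTwoForm_apply,
        IsotropicSplitting.twoForm_swap, neg_add_cancel] at h1
      linarith
    · obtain ⟨e, he, he'⟩ := f.exists_mem x u
      exact ⟨e, hS he, he'⟩
  exact Iff.trans (by rw [f.maximal x S hiso hS]) (Iff.refl (e ∈ S))

variable {sM sN}

theorem Represents.defect {b : M → E [⋀^Fin 2]→L[ℝ] ℝ} (h : f.Represents sM sN b) {x : M}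
    {e : V x × W (f.toFun x)} (he : e ∈ f.str x) (v : E) :
    f.defect sM sN x e v = b x ![𝒯M.anch x e.1, v] :=
  (((f.represents_iff sM sN).1 h x e).1 he).2 v

variable (f sM sN) in
theorem exists_represents : ∃ b, f.Represents sM sN b := by
  choose b hb using fun x => exists_form (f := f) sM sN x
  exact ⟨b, represents_of_forall sM sN hb⟩

theorem contMDiffAt_der (X : VField E M) (x₀ : M) :
    ContMDiffAt 𝓘(ℝ, E) 𝓘(ℝ, E').tangent ∞
      (fun x => (⟨f.toFun x, f.der x (X x)⟩ : TangentBundle 𝓘(ℝ, E') N)) x₀ :=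
  ((f.smooth.contMDiff_tangentMap (m := ∞) (by simp)).comp X.contMDiff).contMDiffAt

/-- The defect of a smooth section of the structure is smooth. Near `x₀` a coordinate field is a
smooth combination of anchors of such sections, so `b` on coordinate fields is the same combination
of their defects. -/
theorem Represents.isSmooth {b : M → E [⋀^Fin 2]→L[ℝ] ℝ} (h : f.Represents sM sN b) :
    FormField.IsSmooth (FormField.ofTwo b) := by
  refine FormField.isSmooth_ofDegree fun x₀ v => ?_
  let B := Module.finBasis ℝ E
  choose ε hε hε' using fun i => f.exists_mem x₀ (B i)
  -- Sections of the structure whose anchors at `x₀` are the basis vectors `B i`.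
  choose α β hβ hmem hval using fun i => f.exists_section x₀ (ε i) (hε i)
  have hfr := fun i => exists_frame_along (E := E) (I := 𝓘(ℝ, E))
    (TangentSpace 𝓘(ℝ, E) : M → Type _) (f := fun x => x) (a₀ := x₀)
    ((anchorField 𝒯M (α i)).contMDiff.contMDiffAt (x := x₀))
  choose c hc hcX using hfr
  -- The columns of `A` are the coordinates of the anchors in the coordinate frame. At `x₀` it is
  -- the identity, hence it is invertible nearby, and `a` below gives the coefficients of the field
  -- of `v 0` in terms of the anchors.
  let A : M → Matrix (Fin (Module.finrank ℝ E)) (Fin (Module.finrank ℝ E)) ℝ :=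
    fun x => Matrix.of fun k i => B.repr (c i x) k
  have hA : ∀ k i, ContMDiffAt 𝓘(ℝ, E) 𝓘(ℝ, ℝ) ∞ (fun x => A x k i) x₀ := fun k i =>
    ((B.coord k).toContinuousLinearMap.contDiff.contMDiff.contMDiffAt).comp x₀ (hc i)
  have hc0 : ∀ i, c i x₀ = B i := fun i => by
    have h1 := (hcX i).self_of_nhds
    have h2 : (anchorField 𝒯M (α i) x₀ : E) = B i := by
      refine Eq.trans ?_ (hε' i)
      exact congrArg (fun e : V x₀ × W (f.toFun x₀) => 𝒯M.anch x₀ e.1) (hval i)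
    exact ((coordField_self x₀ (c i x₀)).symm.trans h1.symm).trans h2
  have hA0 : (A x₀).det ≠ 0 := by
    have : A x₀ = 1 := by
      ext k i
      simp [A, hc0, Matrix.one_apply, Finsupp.single_apply, eq_comm]
    simp [this]
  let a : M → Fin (Module.finrank ℝ E) → ℝ := fun x => (A x)⁻¹.mulVec (B.repr (v 0))
  have ha : ∀ i, ContMDiffAt 𝓘(ℝ, E) 𝓘(ℝ, ℝ) ∞ (fun x => a x i) x₀ := by
    intro i
    have h1 : ContMDiffAt 𝓘(ℝ, E) 𝓘(ℝ, ℝ) ∞ (fun x => ∑ j, (A x)⁻¹ i j * B.repr (v 0) j) x₀ :=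
      contMDiffAt_finsetSum fun j _ => (contMDiffAt_inv_apply hA hA0 i j).mul contMDiffAt_const
    exact h1
  have hX : ∀ᶠ x in 𝓝 x₀, (coordField x₀ (v 0) x : E) = ∑ i, a x i • 𝒯M.anch x (α i x) := by
    filter_upwards [eventually_all.2 hcX, det_ne_zero_eventually hA hA0] with x hx hx'
    have h1 : v 0 = ∑ i, a x i • c i x := by
      apply B.repr.injective
      ext k
      have h2 : (A x).mulVec (a x) = B.repr (v 0) := by
        rw [Matrix.mulVec_mulVec, Matrix.mul_nonsing_inv _ hx'.isUnit, Matrix.one_mulVec]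
      rw [← h2, map_sum, Finsupp.finsetSum_apply]
      change ∑ i, A x k i * a x i = _
      refine Finset.sum_congr rfl fun i _ => ?_
      rw [map_smul, Finsupp.smul_apply, smul_eq_mul, mul_comm]
      rfl
    conv_lhs => rw [h1, map_sum]
    rw [section_sum_apply]
    refine Finset.sum_congr rfl fun i _ => ?_
    rw [map_smul]
    exact congrArg (a x i • ·) (hx i).symm
  have hs : ContMDiffAt 𝓘(ℝ, E) 𝓘(ℝ, ℝ) ∞ (fun x => ∑ i, a x i * (2 *
      (𝒯M.pairing x (α i x) (sM.apply (coordField x₀ (v 1)) x) -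
        𝒯N.pairing (f.toFun x) (β i x)
          (sN.toFun (f.toFun x) (f.der x (coordField x₀ (v 1) x)))))) x₀ :=
    contMDiffAt_finsetSum fun i _ => (ha i).mul (contMDiffAt_const.mul
      ((𝒯M.pairing_smooth _ _).contMDiffAt.sub
        (pairing_along 𝒯N ((hβ i) x₀) (sN.along (contMDiffAt_der (f := f) _ x₀)))))
  refine hs.congr_of_eventuallyEq ?_
  filter_upwards [hX] with x hx
  have h1 : ∀ u w : E, u = ∑ i, a x i • 𝒯M.anch x (α i x) → b x ![u, w] =
      ∑ i, a x i * f.defect sM sN x (α i x, β i x) w := by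
    rintro u w rfl
    rw [← bilinearOfTwoForm_apply, map_sum, LinearMap.sum_apply]
    refine Finset.sum_congr rfl fun i _ => ?_
    rw [map_smul, LinearMap.smul_apply, smul_eq_mul, bilinearOfTwoForm_apply,
      h.defect (hmem i x)]
  exact (IsotropicSplitting.twoForm_eq (b x) _).trans (h1 _ _ hx)

end Morphism

end RepresentingForm

/-! ### Involutivity and the pull-back of the twisting form. -/

section TwistingCompatibility

variable {E F M : Type*} [NormedAddCommGroup E] [NormedSpace ℝ E] [FiniteDimensional ℝ E]
  [TopologicalSpace M] [T2Space M] [ChartedSpace E M] [IsManifold 𝓘(ℝ, E) ∞ M]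
  [NormedAddCommGroup F] [NormedSpace ℝ F] [FiniteDimensional ℝ F]
  {V : M → Type*} [TopologicalSpace (TotalSpace F V)]
  [∀ x, TopologicalSpace (V x)] [∀ x, AddCommGroup (V x)] [∀ x, Module ℝ (V x)]
  [FiberBundle F V] [VectorBundle ℝ F V] [ContMDiffVectorBundle ∞ F V 𝓘(ℝ, E)]
  {E' F' N : Type*} [NormedAddCommGroup E'] [NormedSpace ℝ E'] [FiniteDimensional ℝ E']
  [TopologicalSpace N] [T2Space N] [ChartedSpace E' N] [IsManifold 𝓘(ℝ, E') ∞ N]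
  [NormedAddCommGroup F'] [NormedSpace ℝ F'] [FiniteDimensional ℝ F']
  {W : N → Type*} [TopologicalSpace (TotalSpace F' W)]
  [∀ y, TopologicalSpace (W y)] [∀ y, AddCommGroup (W y)] [∀ y, Module ℝ (W y)]
  [FiberBundle F' W] [VectorBundle ℝ F' W] [ContMDiffVectorBundle ∞ F' W 𝓘(ℝ, E')]
  {𝒯M : ExtendedTangentBundle E F V} {𝒯N : ExtendedTangentBundle E' F' W}

namespace Morphism

variable {f : Morphism 𝒯M 𝒯N} {sM : IsotropicSplitting 𝒯M} {sN : IsotropicSplitting 𝒯N}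

variable (f) in
/-- The image of a vector field under the differential of `f` extends to a family of vector fields,
after multiplication with a bump function. -/
theorem exists_family (x₀ : M) (u : E) : ∃ (X : VField E M) (Y : M → VField E' N),
    (X x₀ : E) = u ∧ (∀ x, (Y x (f.toFun x) : E') = f.der x (X x)) ∧
    ContMDiff (𝓘(ℝ, E).prod 𝓘(ℝ, E')) 𝓘(ℝ, E').tangent ∞
      (fun q : M × N => (⟨q.2, Y q.1 q.2⟩ : TangentBundle 𝓘(ℝ, E') N)) := by
  -- There need not be a single field on `N` related to `X` by `f`. Letting the field depend on `x`
  -- avoids this: in the frame at `y₀` it has the coefficients `d x` of `f_* X`, and the bump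
  -- function restricts `x` to where `f x` stays in the frame's domain.
  set y₀ := f.toFun x₀ with hy₀
  set e := trivializationAt E' (TangentSpace 𝓘(ℝ, E') : N → Type _) y₀ with he
  have hgood := (f.smooth.continuous.continuousAt (x := x₀)).eventually
    (bumpSection_eventually (E := E') (F := E') (TangentSpace 𝓘(ℝ, E') : N → Type _) y₀)
  obtain ⟨χ, hχ⟩ := exists_bump E x₀ hgood
  let c : M → E' := fun x =>
    (e (⟨f.toFun x, f.der x (coordField x₀ u x)⟩ : TangentBundle 𝓘(ℝ, E') N)).2
  let d : M → E' := fun x => χ x • c x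
  have hd : ContMDiff 𝓘(ℝ, E) 𝓘(ℝ, E') ∞ d := by
    refine contMDiff_of_tsupport fun x hx => ?_
    have hx' := (hχ (tsupport_smul_subset_left _ _ hx)).1
    exact χ.contMDiff.contMDiffAt.smul
      ((e.contMDiffAt_iff (e.mem_source.2 hx')).1 (contMDiffAt_der (coordField x₀ u) x)).2
  refine ⟨smulSection χ.contMDiff (coordField x₀ u), fun x => coordField y₀ (d x), ?_, ?_, ?_⟩
  · have h1 : (χ : M → ℝ) x₀ = 1 := χ.eq_one
    change (χ x₀ • (coordField x₀ u x₀ : E) : E) = u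
    rw [h1, one_smul, coordField_self]
  · intro x
    have hr : f.der x (smulSection χ.contMDiff (coordField x₀ u) x) =
        χ x • f.der x (coordField x₀ u x) := map_smul (f.der x) (χ x) _
    have hl : (coordField y₀ (d x) (f.toFun x) : E') =
        χ x • (coordField y₀ (c x) (f.toFun x) : E') := by
      rw [show d x = χ x • c x from rfl, map_smul]
      rfl
    rw [hr]
    refine hl.trans ?_
    -- Where the bump function vanishes both sides are zero; elsewhere `f x` lies where the frame
    -- reproduces the trivialization exactly.
    by_cases hx : χ x = 0
    · rw [hx]
      exact (zero_smul ℝ (coordField y₀ (c x) (f.toFun x) : E')).trans (zero_smul ℝ _).symm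
    · have hx' := hχ (subset_tsupport _ hx)
      refine congrArg (χ x • ·) ((hx'.2 (c x)).trans ?_)
      have h1 := e.symmL_continuousLinearMapAt (R := ℝ) hx'.1 (f.der x (coordField x₀ u x))
      rw [Bundle.Trivialization.continuousLinearMapAt_apply,
        Bundle.Trivialization.coe_linearMapAt_of_mem _ hx'.1] at h1
      exact h1
  · intro q
    let b := Module.finBasis ℝ E'
    refine (contMDiffAt_along_sum (TangentSpace 𝓘(ℝ, E') : N → Type _) Finset.univ
      (f := fun q : M × N => q.2) (a₀ := q) contMDiff_snd.contMDiffAt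
      (c := fun i q => b.repr (d q.1) i) (β := fun i q => coordField y₀ (b i) q.2)
      (fun i => ?_) (fun i => section_along _ contMDiff_snd.contMDiffAt
        (coordField y₀ (b i)))).congr_of_eventuallyEq (Eventually.of_forall fun q => ?_)
    · exact (((b.coord i).toContinuousLinearMap.contDiff.contMDiff).comp
        (hd.comp contMDiff_fst)).contMDiffAt
    · exact congrArg (fun w => (⟨q.2, w⟩ : TangentBundle 𝓘(ℝ, E') N))
        (bumpSection_expand (TangentSpace 𝓘(ℝ, E') : N → Type _) y₀ (d q.1) b q.2)

/-- The section `(x, y) ↦ (sM(X(x)), sN(Y_x(y)))` over `M × N`. -/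
def splitSection (sM : IsotropicSplitting 𝒯M) (sN : IsotropicSplitting 𝒯N) (X : VField E M)
    (Y : M → VField E' N) (hY : ContMDiff (𝓘(ℝ, E).prod 𝓘(ℝ, E')) 𝓘(ℝ, E').tangent ∞
      (fun q : M × N => (⟨q.2, Y q.1 q.2⟩ : TangentBundle 𝓘(ℝ, E') N))) :
    ProdSection E F V E' F' W where
  fst q := sM.apply X q.1
  snd q := sN.toFun q.2 (Y q.1 q.2)
  smooth_fst := (sM.apply X).contMDiff.comp contMDiff_fst
  smooth_snd q := sN.along (f := fun q : M × N => q.2) (a₀ := q) (hY q)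

theorem Represents.mem (h : f.Represents sM sN 0) (x : M) (u : E) :
    (sM.lin x u, sN.lin (f.toFun x) (f.der x u)) ∈ f.str x := by
  rw [(f.represents_iff sM sN).1 h]
  refine ⟨by rw [sN.anch_lin, sM.anch_lin], fun v => ?_⟩
  rw [defect_apply, sM.pairing_lin, sN.pairing_lin, sub_zero, mul_zero]
  rfl

theorem dirDeriv_eq_zero {g : M → ℝ} (r : ℝ) (h : ∀ x, g x = r) (x : M)
    (v : TangentSpace 𝓘(ℝ, E) x) : dirDeriv g x v = 0 := by
  rw [funext h, dirDeriv, mfderiv_const]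
  rfl

/-- All derivatives with respect to the parameter vanish: the `M`-component does not depend on the
point of `N`, and the pairings of the `N`-components are identically zero by isotropy of `sN`. -/
theorem prodBracketPairing_splitSection {X₂ X₃ : VField E M} {Y₂ Y₃ : M → VField E' N}
    (h₂ : ContMDiff (𝓘(ℝ, E).prod 𝓘(ℝ, E')) 𝓘(ℝ, E').tangent ∞
      (fun q : M × N => (⟨q.2, Y₂ q.1 q.2⟩ : TangentBundle 𝓘(ℝ, E') N)))
    (h₃ : ContMDiff (𝓘(ℝ, E).prod 𝓘(ℝ, E')) 𝓘(ℝ, E').tangent ∞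
      (fun q : M × N => (⟨q.2, Y₃ q.1 q.2⟩ : TangentBundle 𝓘(ℝ, E') N)))
    (X₁ : VField E M) (Y₁ : VField E' N) (x : M) (y : N) :
    prodBracketPairing 𝒯M 𝒯N (splitSection sM sN X₂ Y₂ h₂) (splitSection sM sN X₃ Y₃ h₃) x y
        (sM.apply X₁ x, sN.apply Y₁ y) =
      -𝒯M.pairing x (𝒯M.bracket (sM.apply X₂) (sM.apply X₃) x) (sM.apply X₁ x) +
        𝒯N.pairing y (𝒯N.bracket (sN.apply (Y₂ x)) (sN.apply (Y₃ x)) y) (sN.apply Y₁ y) := by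
  have key : ∀ {a b c₁ c₂ c₃ c₄ c₅ c₆ : ℝ}, c₁ = 0 → c₂ = 0 → c₃ = 0 → c₄ = 0 → c₅ = 0 → c₆ = 0 →
      a + b + c₁ - c₂ + c₃ + c₄ - c₅ + c₆ = a + b := by
    rintro a b _ _ _ _ _ _ rfl rfl rfl rfl rfl rfl
    simp
  exact key
    (dirDeriv_eq_zero (-𝒯M.pairing x (sM.apply X₃ x) (sM.apply X₁ x)) (fun _ => rfl) _ _)
    (dirDeriv_eq_zero (-𝒯M.pairing x (sM.apply X₂ x) (sM.apply X₁ x)) (fun _ => rfl) _ _)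
    (dirDeriv_eq_zero (-𝒯M.pairing x (sM.apply X₂ x) (sM.apply X₃ x)) (fun _ => rfl) _ _)
    (dirDeriv_eq_zero 0 (fun _ => sN.isotropic y _ _) _ _)
    (dirDeriv_eq_zero 0 (fun _ => sN.isotropic y _ _) _ _)
    (dirDeriv_eq_zero 0 (fun _ => sN.isotropic y _ _) _ _)

/-- If the morphism is represented by the zero form, then `f` pulls back the twisting form. -/
theorem Represents.twist (h : f.Represents sM sN 0) (x : M) (u v w : E) :
    sM.twist x ![u, v, w] = sN.twist (f.toFun x) ![f.der x u, f.der x v, f.der x w] := by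
  obtain ⟨X₁, Y₁, hX₁, hY₁, -⟩ := f.exists_family x u
  obtain ⟨X₂, Y₂, hX₂, hY₂, hs₂⟩ := f.exists_family x v
  obtain ⟨X₃, Y₃, hX₃, hY₃, hs₃⟩ := f.exists_family x w
  have hmem : ∀ {X : VField E M} {Y : M → VField E' N},
      (∀ x, (Y x (f.toFun x) : E') = f.der x (X x)) → ∀ x,
        ((sM.apply X x, sN.toFun (f.toFun x) (Y x (f.toFun x))) : V x × W (f.toFun x)) ∈ f.str x :=
    fun {X Y} hY x => by
      have h1 := h.mem x (X x)
      rw [← hY x] at h1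
      exact h1
  -- The bracket of the split sections is represented by an element `z` of the structure, which is
  -- orthogonal to the pair of lifts of `X₁` and `Y₁`. This orthogonality is the equality of the two
  -- twisting forms.
  obtain ⟨z, hz, hz'⟩ := f.involutive (splitSection sM sN X₂ Y₂ hs₂) (splitSection sM sN X₃ Y₃ hs₃)
    (hmem hY₂) (hmem hY₃) x
  have h0 := (f.isotropic x).1 z hz _ (hmem hY₁ x)
  have h1 := (hz' _).symm.trans h0
  have h2 := (prodBracketPairing_splitSection (sM := sM) (sN := sN) hs₂ hs₃ X₁ (Y₁ x) x
    (f.toFun x)).symm.trans h1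
  have h3 : sM.twist x ![u, v, w] = sM.twist x ![X₁ x, X₂ x, X₃ x] := by rw [hX₁, hX₂, hX₃]
  have h4 : sN.twist (f.toFun x) ![f.der x u, f.der x v, f.der x w] = sN.twist (f.toFun x)
      ![Y₁ x (f.toFun x), Y₂ x (f.toFun x), Y₃ x (f.toFun x)] := by
    rw [hY₁, hY₂, hY₃, hX₁, hX₂, hX₃]
  rw [h3, h4, sM.twist_apply, sN.twist_apply, 𝒯M.pairing_symm, 𝒯N.pairing_symm]
  linarith

end Morphism

end TwistingCompatibility

/-! ### The induced map of spinors. -/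

section SpinorMap

variable {E F M : Type*} [NormedAddCommGroup E] [NormedSpace ℝ E] [FiniteDimensional ℝ E]
  [TopologicalSpace M] [T2Space M] [ChartedSpace E M] [IsManifold 𝓘(ℝ, E) ∞ M]
  [NormedAddCommGroup F] [NormedSpace ℝ F] [FiniteDimensional ℝ F]
  {V : M → Type*} [TopologicalSpace (TotalSpace F V)]
  [∀ x, TopologicalSpace (V x)] [∀ x, AddCommGroup (V x)] [∀ x, Module ℝ (V x)]
  [FiberBundle F V] [VectorBundle ℝ F V] [ContMDiffVectorBundle ∞ F V 𝓘(ℝ, E)]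
  {E' F' N : Type*} [NormedAddCommGroup E'] [NormedSpace ℝ E'] [FiniteDimensional ℝ E']
  [TopologicalSpace N] [T2Space N] [ChartedSpace E' N] [IsManifold 𝓘(ℝ, E') ∞ N]
  [NormedAddCommGroup F'] [NormedSpace ℝ F'] [FiniteDimensional ℝ F']
  {W : N → Type*} [TopologicalSpace (TotalSpace F' W)]
  [∀ y, TopologicalSpace (W y)] [∀ y, AddCommGroup (W y)] [∀ y, Module ℝ (W y)]
  [FiberBundle F' W] [VectorBundle ℝ F' W] [ContMDiffVectorBundle ∞ F' W 𝓘(ℝ, E')]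
  {𝒯M : ExtendedTangentBundle E F V} {𝒯N : ExtendedTangentBundle E' F' W}

open IsotropicSplitting FormField

namespace Forms

omit [FiniteDimensional ℝ E] in
-- Homogeneous parity is an eigenvalue condition for the main involution. As the involution is
-- multiplicative, wedging with an even form preserves it.
theorem grade_eq_iff {p : ZMod 2} {α : Forms E} :
    grade α = (-1 : ℝ) ^ p.val • α ↔ ∀ n : ℕ, (n : ZMod 2) ≠ p → α n = 0 := by
  have hsign : ∀ n : ℕ, (n : ZMod 2) ≠ p → (-1 : ℝ) ^ n = -(-1 : ℝ) ^ p.val := by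
    intro n hn
    rcases Nat.even_or_odd n with h | h
    · rw [h.neg_one_pow]
      have : (n : ZMod 2) = 0 := (ZMod.natCast_eq_zero_iff_even).2 h
      have hp : p = 1 := by
        rw [this] at hn
        revert hn; revert p; decide
      subst hp
      norm_num [ZMod.val_one]
    · rw [h.neg_one_pow]
      have : (n : ZMod 2) = 1 := (ZMod.natCast_eq_one_iff_odd).2 h
      have hp : p = 0 := by
        rw [this] at hn
        revert hn; revert p; decide
      subst hp
      simp
  constructor
  · intro h n hn
    have h1 := congrFun h n
    simp only [grade, Pi.smul_apply, hsign n hn] at h1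
    ext v
    have h2 : -(-1 : ℝ) ^ p.val * α n v = (-1 : ℝ) ^ p.val * α n v := congrArg (fun a => a v) h1
    rw [_root_.neg_mul] at h2
    exact (mul_eq_zero.1 (self_eq_neg.1 h2.symm)).resolve_left (pow_ne_zero _ (by norm_num))
  · intro h
    funext n
    by_cases hn : (n : ZMod 2) = p
    · have : (-1 : ℝ) ^ n = (-1 : ℝ) ^ p.val := by
        rw [← hn, ZMod.val_natCast, ← neg_one_pow_eq_pow_mod_two]
      simp only [grade, Pi.smul_apply, this]
    · simp only [grade, Pi.smul_apply, h n hn, smul_zero]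

omit [FiniteDimensional ℝ E] in
theorem parity_mul {p : ZMod 2} {ε α : Forms E} (hε : grade ε = ε)
    (hα : ∀ n : ℕ, (n : ZMod 2) ≠ p → α n = 0) (n : ℕ) (hn : (n : ZMod 2) ≠ p) :
    mul ε α n = 0 :=
  grade_eq_iff.1 (by rw [grade_mul, hε, grade_eq_iff.2 hα, mul_smul]) n hn

end Forms

namespace FormField

variable {f : M → N}

theorem pullback_add (α β : FormField E' N) :
    (pullback f (α + β) : FormField E M) = pullback f α + pullback f β :=
  funext fun _ => Forms.comap_add _ _ _

theorem pullback_smul (r : ℝ) (α : FormField E' N) :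
    (pullback f (r • α) : FormField E M) = r • pullback f α :=
  funext fun _ => Forms.comap_smul _ r _

theorem pullback_sub (α β : FormField E' N) :
    (pullback f (α - β) : FormField E M) = pullback f α - pullback f β := by
  have h := pullback_add (E := E) (f := f) (α - β) β
  rw [sub_add_cancel] at h
  rw [h, add_sub_cancel_right]

theorem pullback_mul (α β : FormField E' N) :
    (pullback f (mul α β) : FormField E M) = mul (pullback f α) (pullback f β) :=
  funext fun _ => Forms.comap_mul _ _ _

theorem contract_pullback {X : Π x : M, TangentSpace 𝓘(ℝ, E) x}
    {Y : Π y : N, TangentSpace 𝓘(ℝ, E') y}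
    (h : ∀ x, (Y (f x) : E') = diff (E := E) (E' := E') f x (X x)) (ρ : FormField E' N) :
    contract X (pullback f ρ) = pullback f (contract Y ρ) := by
  funext x
  refine (Forms.contract_comap (diff (E := E) (E' := E') f x) (X x) (ρ (f x))).trans ?_
  rw [← h x]
  rfl

theorem lieD_pullback (hf : ContMDiff 𝓘(ℝ, E) 𝓘(ℝ, E') ∞ f) {X : Π x : M, TangentSpace 𝓘(ℝ, E) x}
    {Y : Π y : N, TangentSpace 𝓘(ℝ, E') y}
    (hY : ContMDiff 𝓘(ℝ, E') 𝓘(ℝ, E').tangent ∞ fun y => (⟨y, Y y⟩ : TangentBundle 𝓘(ℝ, E') N))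
    (h : ∀ x, (Y (f x) : E') = diff (E := E) (E' := E') f x (X x)) {ρ : FormField E' N}
    (hρ : IsSmooth ρ) : lieD X (pullback f ρ : FormField E M) = pullback f (lieD Y ρ) := by
  rw [lieD, lieD, contract_pullback h, extD_pullback hf (isSmooth_contract hY hρ),
    extD_pullback hf hρ, contract_pullback h, pullback_add]

end FormField

namespace Morphism

variable {f : Morphism 𝒯M 𝒯N} {s₀ sM : IsotropicSplitting 𝒯M} {t₀ sN : IsotropicSplitting 𝒯N}

/-- The pull-back of a `2`-form along the underlying map. -/
def pullTwo (f : Morphism 𝒯M 𝒯N) (C : N → E' [⋀^Fin 2]→L[ℝ] ℝ) : M → E [⋀^Fin 2]→L[ℝ] ℝ :=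
  fun x => (C (f.toFun x)).compContinuousLinearMap (f.der x)

theorem pullTwo_apply (C : N → E' [⋀^Fin 2]→L[ℝ] ℝ) (x : M) (u v : E) :
    f.pullTwo C x ![u, v] = C (f.toFun x) ![f.der x u, f.der x v] :=
  twoForm_eq (C (f.toFun x)) _

theorem exp_pullTwo (C : N → E' [⋀^Fin 2]→L[ℝ] ℝ) :
    FormField.exp (ofTwo (f.pullTwo C)) = pullback f.toFun (FormField.exp (ofTwo C)) := by
  funext x
  refine Eq.symm ((Forms.comap_exp (f.der x) (Forms.ofDegree 2 (C (f.toFun x)))).trans ?_)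
  rw [Forms.comap_ofDegree]
  rfl

/-- The effect of a change of splittings on the representing `2`-form. -/
theorem Represents.shift (h : f.Represents s₀ t₀ 0) {B : M → E [⋀^Fin 2]→L[ℝ] ℝ}
    {C : N → E' [⋀^Fin 2]→L[ℝ] ℝ} (hB : IsShift s₀ sM B) (hC : IsShift t₀ sN C) :
    f.Represents sM sN (f.pullTwo C - B) := by
  refine represents_of_forall sM sN fun x e he v => ?_
  have h0 := h.defect he v
  have h1 := hB x v e.1
  have h2 := hC (f.toFun x) (f.der x v) e.2
  rw [twoForm_swap, 𝒯M.pairing_symm, map_sub] at h1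
  rw [anch_snd he, twoForm_swap, 𝒯N.pairing_symm, map_sub] at h2
  rw [defect_apply] at h0 ⊢
  rw [Pi.sub_apply, ContinuousAlternatingMap.sub_apply, pullTwo_apply]
  change _ = (0 : ℝ) at h0
  linarith

/-- Shifting `sM` by `B` replaces `b` by `b - B`; take `B = b`, which is possible because `b` is
smooth. -/
theorem exists_represents_zero (f : Morphism 𝒯M 𝒯N) (sM : IsotropicSplitting 𝒯M)
    (sN : IsotropicSplitting 𝒯N) : ∃ s₀, f.Represents s₀ sN 0 := by
  obtain ⟨b, hb⟩ := f.exists_represents sM sN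
  obtain ⟨s₀, hs₀⟩ := sM.exists_shift hb.isSmooth
  refine ⟨s₀, represents_of_forall s₀ sN fun x e he v => ?_⟩
  have h1 := hs₀ x v e.1
  have h2 := hb.defect he v
  rw [twoForm_swap, 𝒯M.pairing_symm, map_sub] at h1
  rw [defect_apply] at h2 ⊢
  change _ = (0 : ℝ)
  linarith

theorem Represents.pullback_twist (h : f.Represents s₀ t₀ 0) :
    (fun x => Forms.ofDegree 3 (s₀.twist x)) =
      pullback f.toFun (fun y => Forms.ofDegree 3 (t₀.twist y)) := by
  funext x
  refine Eq.trans ?_ (Forms.comap_ofDegree (f.der x) 3 (t₀.twist (f.toFun x))).symm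
  congr 1
  ext v
  rw [threeForm_eq, h.twist]
  exact (threeForm_eq (t₀.twist (f.toFun x)) fun i => f.der x (v i)).symm

/-- The sections `𝔛` and `𝔜` are related by the morphism. -/
def Related (f : Morphism 𝒯M 𝒯N) (𝔛 : ContMDiffSection 𝓘(ℝ, E) F ∞ V)
    (𝔜 : ContMDiffSection 𝓘(ℝ, E') F' ∞ W) : Prop :=
  ∀ x, (𝔛 x, 𝔜 (f.toFun x)) ∈ f.str x

variable {𝔛 : ContMDiffSection 𝓘(ℝ, E) F ∞ V} {𝔜 : ContMDiffSection 𝓘(ℝ, E') F' ∞ W}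

theorem Related.vectorPart (h𝔛 : f.Related 𝔛 𝔜) (x : M) :
    (𝒯N.vectorPart 𝔜 (f.toFun x) : E') =
      diff (E := E) (E' := E') f.toFun x (𝒯M.vectorPart 𝔛 x) := anch_snd (h𝔛 x)

theorem Related.formPart (h𝔛 : f.Related 𝔛 𝔜) (h : f.Represents s₀ t₀ 0) :
    s₀.formPart 𝔛 = pullback f.toFun (t₀.formPart 𝔜) := by
  funext x
  refine Eq.trans ?_ (Forms.comap_ofDegree (f.der x) 1 _).symm
  refine congrArg (Forms.ofDegree 1) ?_
  ext v
  have h1 := h.defect (h𝔛 x) (v 0)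
  rw [defect_apply] at h1
  change _ = (0 : ℝ) at h1
  change 2 * 𝒯M.pairing x (𝔛 x) (s₀.lin x (v 0)) =
    2 * 𝒯N.pairing (f.toFun x) (𝔜 (f.toFun x)) (t₀.lin (f.toFun x) (f.der x (v 0)))
  linarith

/-- In splittings with `b = 0` the twisting form is pulled back, so `f^*` commutes with `d` and with
`H ∧` separately. The two following lemmas use likewise that vector and covector parts of related
sections correspond under `f`. -/
theorem dT_apply_pullback (h : f.Represents s₀ t₀ 0) {ρ : SpinorField 𝒯N} (hρ : ρ ∈ spinors 𝒯N)
    {η : SpinorField 𝒯M} (hη : η s₀ = pullback f.toFun (ρ t₀)) :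
    dT η s₀ = pullback f.toFun (dT ρ t₀) := by
  rw [dT, dT, hη, h.pullback_twist, extD_pullback f.smooth (hρ.1 t₀), pullback_sub, pullback_mul]

theorem Related.cliff_apply_pullback (h𝔛 : f.Related 𝔛 𝔜) (h : f.Represents s₀ t₀ 0)
    {ρ : SpinorField 𝒯N} {η : SpinorField 𝒯M}
    (hη : η s₀ = pullback f.toFun (ρ t₀)) :
    cliff 𝔛 η s₀ = pullback f.toFun (cliff 𝔜 ρ t₀) := by
  rw [cliff, cliff, hη, contract_pullback h𝔛.vectorPart, h𝔛.formPart h, pullback_add, pullback_mul]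

theorem Related.lieT_apply_pullback (h𝔛 : f.Related 𝔛 𝔜) (h : f.Represents s₀ t₀ 0)
    {ρ : SpinorField 𝒯N} (hρ : ρ ∈ spinors 𝒯N) {η : SpinorField 𝒯M}
    (hη : η s₀ = pullback f.toFun (ρ t₀)) :
    lieT 𝔛 η s₀ = pullback f.toFun (lieT 𝔜 ρ t₀) := by
  rw [lieT, lieT, hη, lieD_pullback f.smooth (𝒯N.anchor_smooth 𝔜) h𝔛.vectorPart (hρ.1 t₀),
    h.pullback_twist, contract_pullback h𝔛.vectorPart, h𝔛.formPart h,
    extD_pullback f.smooth (t₀.isSmooth_formPart 𝔜), pullback_add, pullback_mul, pullback_sub]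
  rfl

/-- The pull-back is prescribed as the representative in `s₀`; linearity holds because a spinor is
determined by that representative. -/
theorem exists_spinorMap_of_splittings (f : Morphism 𝒯M 𝒯N) (s₀ : IsotropicSplitting 𝒯M)
    (t₀ : IsotropicSplitting 𝒯N) :
    ∃ T : spinors 𝒯N →ₗ[ℝ] spinors 𝒯M, ∀ ρ, (T ρ).1 s₀ = pullback f.toFun (ρ.1 t₀) := by
  choose T hT hT' using fun ρ : spinors 𝒯N =>
    exists_spinor s₀ (isSmooth_pullback (E := E) f.smooth (ρ.2.1 t₀))
  refine ⟨{ toFun := fun ρ => ⟨T ρ, hT ρ⟩, map_add' := fun ρ η => ?_, map_smul' := fun r ρ => ?_ },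
    hT'⟩
  · refine Subtype.ext (spinor_ext (hT _) (add_mem (hT ρ) (hT η)) s₀ ?_)
    exact (hT' _).trans ((pullback_add _ _).trans (by rw [← hT' ρ, ← hT' η]; rfl))
  · refine Subtype.ext (spinor_ext (hT _) ((spinors 𝒯M).smul_mem r (hT ρ)) s₀ ?_)
    exact (hT' _).trans ((pullback_smul _ _).trans (by rw [← hT' ρ]; rfl))

/-- The map of spinors induced by a morphism. -/
theorem exists_spinorMap (f : Morphism 𝒯M 𝒯N) : ∃ T : spinors 𝒯N →ₗ[ℝ] spinors 𝒯M,
    (∀ (sM : IsotropicSplitting 𝒯M) (sN : IsotropicSplitting 𝒯N),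
      ∃ b : M → E [⋀^Fin 2]→L[ℝ] ℝ, IsSmooth (fun x => Forms.ofDegree 2 (b x)) ∧
        f.Represents sM sN b ∧ ∀ (ρ : spinors 𝒯N) (x : M), (T ρ).1 sM x =
          Forms.mul (Forms.exp (Forms.ofDegree 2 (-b x))) (pullback f.toFun (ρ.1 sN) x)) ∧
    (∀ ρ : spinors 𝒯N, dT (T ρ).1 = (T (dTLinear 𝒯N ρ)).1) ∧
    (∀ 𝔛 𝔜, f.Related 𝔛 𝔜 → ∀ ρ : spinors 𝒯N,
      cliff 𝔛 (T ρ).1 = (T (cliffLinear 𝒯N 𝔜 ρ)).1) ∧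
    (∀ 𝔛 𝔜, f.Related 𝔛 𝔜 → ∀ ρ : spinors 𝒯N,
      lieT 𝔛 (T ρ).1 = (T ⟨lieT 𝔜 ρ.1, lieT_mem 𝔜 ρ.2⟩).1) ∧
    ∀ (p : ZMod 2) (ρ : spinors 𝒯N),
      (∀ s x (n : ℕ), (n : ZMod 2) ≠ p → ρ.1 s x n = 0) →
      ∀ s x (n : ℕ), (n : ZMod 2) ≠ p → (T ρ).1 s x n = 0 := by
  by_cases hs : Nonempty (IsotropicSplitting 𝒯M) ∧ Nonempty (IsotropicSplitting 𝒯N)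
  · obtain ⟨⟨s⟩, ⟨t₀⟩⟩ := hs
    obtain ⟨s₀, h⟩ := f.exists_represents_zero s t₀
    obtain ⟨T, hT⟩ := exists_spinorMap_of_splittings f s₀ t₀
    refine ⟨T, fun sM sN => ?_, fun ρ => ?_, fun 𝔛 𝔜 h𝔛 ρ => ?_, fun 𝔛 𝔜 h𝔛 ρ => ?_,
      fun p ρ hρ sM x => ?_⟩
    · obtain ⟨B, hB⟩ := exists_isShift s₀ sM
      obtain ⟨C, hC⟩ := exists_isShift t₀ sN
      have hb := h.shift hB hC
      refine ⟨_, hb.isSmooth, hb, fun ρ => congrFun (?_ : (T ρ).1 sM = FormField.mul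
        (FormField.exp (ofTwo (-(f.pullTwo C - B)))) (pullback f.toFun (ρ.1 sN)))⟩
      -- Both sides equal `e^B ∧ f^* ρ_{t₀}`, since `ρ_{sN} = e^C ∧ ρ_{t₀}` and `-(f^*C - B) + f^*C
      -- = B`.
      rw [(mem_spinors.1 (T ρ).2).2 hB, hT, (mem_spinors.1 ρ.2).2 hC, pullback_mul, ← exp_pullTwo,
        ← FormField.mul_assoc, ← exp_ofTwo_add]
      congr 3
      abel
    · exact spinor_ext (dT_mem (T ρ).2) (T _).2 s₀
        ((dT_apply_pullback h ρ.2 (hT ρ)).trans (hT (dTLinear 𝒯N ρ)).symm)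
    · exact spinor_ext (cliff_mem 𝔛 (T ρ).2) (T _).2 s₀
        ((h𝔛.cliff_apply_pullback h (hT ρ)).trans (hT (cliffLinear 𝒯N 𝔜 ρ)).symm)
    · exact spinor_ext (lieT_mem 𝔛 (T ρ).2) (T _).2 s₀
        ((h𝔛.lieT_apply_pullback h ρ.2 (hT ρ)).trans (hT ⟨lieT 𝔜 ρ.1, lieT_mem 𝔜 ρ.2⟩).symm)
    · obtain ⟨B, hB⟩ := exists_isShift s₀ sM
      rw [(mem_spinors.1 (T ρ).2).2 hB]
      refine Forms.parity_mul (congrFun (grade_exp_ofTwo B) x) fun n hn => ?_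
      rw [hT]
      change (ρ.1 t₀ (f.toFun x) n).compContinuousLinearMap (f.der x) = 0
      rw [hρ t₀ (f.toFun x) n hn]
      rfl
  -- If one side has no isotropic splitting, the formula in splittings is vacuous and the zero map
  -- satisfies all the other conditions.
  · have h0 : dT (0 : SpinorField 𝒯M) = 0 := by simpa using dT_smul (0 : ℝ) (0 : SpinorField 𝒯M)
    refine ⟨0, fun sM sN => (hs ⟨⟨sM⟩, ⟨sN⟩⟩).elim, fun ρ => h0, fun 𝔛 𝔜 _ ρ => ?_,
      fun 𝔛 𝔜 _ ρ => ?_, fun _ _ _ _ _ _ _ => rfl⟩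
    · simpa using cliff_smul (0 : ℝ) 𝔛 (0 : SpinorField 𝒯M)
    · simpa using lieT_smul (0 : ℝ) 𝔛 (0 : SpinorField 𝒯M)

end Morphism

end SpinorMap

/-! ### Formal series, Cartan complexes and cohomology. -/

section CartanComplex

variable {E F M : Type*} [NormedAddCommGroup E] [NormedSpace ℝ E] [FiniteDimensional ℝ E]
  [TopologicalSpace M] [T2Space M] [ChartedSpace E M] [IsManifold 𝓘(ℝ, E) ∞ M]
  [NormedAddCommGroup F] [NormedSpace ℝ F] [FiniteDimensional ℝ F]
  {V : M → Type*} [TopologicalSpace (TotalSpace F V)]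
  [∀ x, TopologicalSpace (V x)] [∀ x, AddCommGroup (V x)] [∀ x, Module ℝ (V x)]
  [FiberBundle F V] [VectorBundle ℝ F V] [ContMDiffVectorBundle ∞ F V 𝓘(ℝ, E)]
  {E' F' N : Type*} [NormedAddCommGroup E'] [NormedSpace ℝ E'] [FiniteDimensional ℝ E']
  [TopologicalSpace N] [T2Space N] [ChartedSpace E' N] [IsManifold 𝓘(ℝ, E') ∞ N]
  [NormedAddCommGroup F'] [NormedSpace ℝ F'] [FiniteDimensional ℝ F']
  {W : N → Type*} [TopologicalSpace (TotalSpace F' W)]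
  [∀ y, TopologicalSpace (W y)] [∀ y, AddCommGroup (W y)] [∀ y, Module ℝ (W y)]
  [FiberBundle F' W] [VectorBundle ℝ F' W] [ContMDiffVectorBundle ∞ F' W 𝓘(ℝ, E')]
  {𝒯M : ExtendedTangentBundle E F V} {𝒯N : ExtendedTangentBundle E' F' W}
  {𝔤 : Type*} [LieRing 𝔤] [LieAlgebra ℝ 𝔤]

omit [T2Space M] [ContMDiffVectorBundle ∞ F V 𝓘(ℝ, E)] [FiniteDimensional ℝ F] [T2Space N]
  [ContMDiffVectorBundle ∞ F' W 𝓘(ℝ, E')] [FiniteDimensional ℝ F'] in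
theorem mapSeries_mem_formalSeries (T : spinors 𝒯N →ₗ[ℝ] spinors 𝒯M)
    {ρ : ℕ → 𝔤 → spinors 𝒯N} (hρ : ρ ∈ formalSeries 𝔤 𝒯N) :
    mapSeries T ρ ∈ formalSeries 𝔤 𝒯M := fun k => by
  obtain ⟨P, hP⟩ := hρ k
  exact ⟨T.compMultilinearMap P, fun τ => congrArg T (hP τ)⟩

namespace ExtendedAction

variable (σ : ExtendedAction 𝔤 𝒯M) (σ' : ExtendedAction 𝔤 𝒯N)

/-- The Cartan differential, as a series with values in the spinors. -/
def cartanSeries (ρ : ℕ → 𝔤 → spinors 𝒯M) : ℕ → 𝔤 → spinors 𝒯M := fun k τ =>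
  match k with
  | 0 => dTLinear 𝒯M (ρ 0 τ)
  | k + 1 => dTLinear 𝒯M (ρ (k + 1) τ) - cliffLinear 𝒯M (σ.δ τ) (ρ k τ)

theorem cartanSeries_coe (ρ : ℕ → 𝔤 → spinors 𝒯M) (k : ℕ) (τ : 𝔤) :
    (σ.cartanSeries ρ k τ).1 = σ.cartanD ρ k τ := by
  cases k <;> rfl

theorem cartanSeries_mem {ρ : ℕ → 𝔤 → spinors 𝒯M} (hρ : ρ ∈ formalSeries 𝔤 𝒯M) :
    σ.cartanSeries ρ ∈ formalSeries 𝔤 𝒯M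
  | 0 => by
    obtain ⟨P, hP⟩ := hρ 0
    exact ⟨(dTLinear 𝒯M).compMultilinearMap P, fun τ => congrArg (dTLinear 𝒯M) (hP τ)⟩
  | k + 1 => by
    obtain ⟨P, hP⟩ := hρ (k + 1)
    obtain ⟨Q, hQ⟩ := hρ k
    -- The term `ι_{δ(τ)} ρ_k(τ)` is homogeneous of degree `k + 1`: the Clifford action is linear in
    -- `τ`, so uncurrying adds one slot to the multilinear map that gives `ρ_k`.
    let R : 𝔤 →ₗ[ℝ] MultilinearMap ℝ (fun _ : Fin k => 𝔤) (spinors 𝒯M) :=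
      { toFun := fun τ => (cliffLinear 𝒯M (σ.δ τ)).compMultilinearMap Q
        map_add' := fun τ τ' => by
          ext1 v
          change cliffLinear 𝒯M (σ.δ (τ + τ')) (Q v) =
            cliffLinear 𝒯M (σ.δ τ) (Q v) + cliffLinear 𝒯M (σ.δ τ') (Q v)
          rw [map_add, map_add, LinearMap.add_apply]
        map_smul' := fun r τ => by
          ext1 v
          change cliffLinear 𝒯M (σ.δ (r • τ)) (Q v) = r • cliffLinear 𝒯M (σ.δ τ) (Q v)
          rw [map_smul, map_smul, LinearMap.smul_apply] }
    refine ⟨(dTLinear 𝒯M).compMultilinearMap P - LinearMap.uncurryLeft R, fun τ => ?_⟩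
    change dTLinear 𝒯M (ρ (k + 1) τ) - cliffLinear 𝒯M (σ.δ τ) (ρ k τ) =
      dTLinear 𝒯M (P fun _ => τ) - cliffLinear 𝒯M (σ.δ τ) (Q fun _ => τ)
    rw [hP, hQ]

variable {σ σ'} {T : spinors 𝒯N →ₗ[ℝ] spinors 𝒯M}

theorem cartanD_mapSeries (hd : ∀ ρ : spinors 𝒯N, dT (T ρ).1 = (T (dTLinear 𝒯N ρ)).1)
    (hc : ∀ (τ : 𝔤) (ρ : spinors 𝒯N),
      cliff (σ.δ τ) (T ρ).1 = (T (cliffLinear 𝒯N (σ'.δ τ) ρ)).1)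
    (ρ : ℕ → 𝔤 → spinors 𝒯N) (k : ℕ) (τ : 𝔤) :
    σ.cartanD (mapSeries T ρ) k τ = (T (σ'.cartanSeries ρ k τ)).1 := by
  cases k with
  | zero => exact hd (ρ 0 τ)
  | succ k =>
    change dT (T (ρ (k + 1) τ)).1 - cliff (σ.δ τ) (T (ρ k τ)).1 =
      (T (dTLinear 𝒯N (ρ (k + 1) τ) - cliffLinear 𝒯N (σ'.δ τ) (ρ k τ))).1
    rw [hd, hc, map_sub]
    rfl

theorem mapSeries_mem_cartanComplex
    (hl : ∀ (τ : 𝔤) (ρ : spinors 𝒯N),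
      lieT (σ.δ τ) (T ρ).1 = (T ⟨lieT (σ'.δ τ) ρ.1, lieT_mem (σ'.δ τ) ρ.2⟩).1)
    {p : ZMod 2} (hp : ∀ ρ : spinors 𝒯N, (∀ s x (n : ℕ), (n : ZMod 2) ≠ p → ρ.1 s x n = 0) →
      ∀ s x (n : ℕ), (n : ZMod 2) ≠ p → (T ρ).1 s x n = 0)
    {ρ : ℕ → 𝔤 → spinors 𝒯N} (hρ : ρ ∈ σ'.cartanComplex p) :
    mapSeries T ρ ∈ σ.cartanComplex p := by
  refine ⟨mapSeries_mem_formalSeries T hρ.1, fun k τ => ?_, fun k τ => hp _ (hρ.2.2 k τ)⟩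
  have h0 : (⟨lieT (σ'.δ τ) (ρ k τ).1, lieT_mem (σ'.δ τ) (ρ k τ).2⟩ : spinors 𝒯N) = 0 :=
    Subtype.ext (hρ.2.1 k τ)
  refine (hl τ (ρ k τ)).trans ?_
  rw [h0, map_zero]
  rfl

/-- Compatibility with the differential sends cocycles to cocycles. A primitive `ρ` of a coboundary
is sent to the primitive `mapSeries T ρ`, so the map descends to the quotient. -/
theorem exists_cohomologyMap
    (hd : ∀ ρ k τ, σ.cartanD (mapSeries T ρ) k τ = (T (σ'.cartanSeries ρ k τ)).1)
    (hC : ∀ p, ∀ ρ ∈ σ'.cartanComplex p, mapSeries T ρ ∈ σ.cartanComplex p) (p : ZMod 2) :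
    ∃ h : ∀ z ∈ σ'.cocycles p, mapSeries T z ∈ σ.cocycles p,
      ∃ Φ : σ'.Cohomology p →ₗ[ℝ] σ.Cohomology p, ∀ z : σ'.cocycles p,
        Φ (Submodule.Quotient.mk z) = Submodule.Quotient.mk ⟨mapSeries T z.1, h z.1 z.2⟩ := by
  have h : ∀ z ∈ σ'.cocycles p, mapSeries T z ∈ σ.cocycles p := fun z hz =>
    ⟨hC p z hz.1, by
      funext k τ
      have h0 : σ'.cartanSeries z k τ = 0 := Subtype.ext
        ((σ'.cartanSeries_coe z k τ).trans (congrFun (congrFun hz.2 k) τ))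
      rw [hd, h0, map_zero]
      rfl⟩
  let L : σ'.cocycles p →ₗ[ℝ] σ.cocycles p :=
    { toFun := fun z => ⟨mapSeries T z.1, h z.1 z.2⟩
      map_add' := fun z w => Subtype.ext (funext fun k => funext fun τ => map_add T _ _)
      map_smul' := fun r z => Subtype.ext (funext fun k => funext fun τ => map_smul T r _) }
  refine ⟨h, Submodule.mapQ _ _ L ?_, fun z => rfl⟩
  rintro z ⟨ρ, hρ, hz⟩
  refine ⟨mapSeries T ρ, hC _ ρ hρ, fun k τ => ?_⟩
  have h0 : z.1 k τ = σ'.cartanSeries ρ k τ :=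
    Subtype.ext ((hz k τ).trans (σ'.cartanSeries_coe ρ k τ).symm)
  rw [hd, ← h0]
  rfl

end ExtendedAction

end CartanComplex

end Courant

end

theorem mainTheorem11
    {E F M : Type*} [NormedAddCommGroup E] [NormedSpace ℝ E] [FiniteDimensional ℝ E]
    [TopologicalSpace M] [T2Space M] [SigmaCompactSpace M]
    [ChartedSpace E M] [IsManifold 𝓘(ℝ, E) ∞ M]
    [NormedAddCommGroup F] [NormedSpace ℝ F] [FiniteDimensional ℝ F]
    {V : M → Type*} [TopologicalSpace (TotalSpace F V)]
    [∀ x, TopologicalSpace (V x)] [∀ x, AddCommGroup (V x)] [∀ x, Module ℝ (V x)]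
    [FiberBundle F V] [VectorBundle ℝ F V] [ContMDiffVectorBundle ∞ F V 𝓘(ℝ, E)]
    {E' F' N : Type*} [NormedAddCommGroup E'] [NormedSpace ℝ E'] [FiniteDimensional ℝ E']
    [TopologicalSpace N] [T2Space N] [SigmaCompactSpace N]
    [ChartedSpace E' N] [IsManifold 𝓘(ℝ, E') ∞ N]
    [NormedAddCommGroup F'] [NormedSpace ℝ F'] [FiniteDimensional ℝ F']
    {W : N → Type*} [TopologicalSpace (TotalSpace F' W)]
    [∀ y, TopologicalSpace (W y)] [∀ y, AddCommGroup (W y)] [∀ y, Module ℝ (W y)]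
    [FiberBundle F' W] [VectorBundle ℝ F' W] [ContMDiffVectorBundle ∞ F' W 𝓘(ℝ, E')]
    {EG G : Type*} [NormedAddCommGroup EG] [NormedSpace ℝ EG] [FiniteDimensional ℝ EG]
    [TopologicalSpace G] [ChartedSpace EG G] [Group G] [LieGroup 𝓘(ℝ, EG) ∞ G]
    [MulAction G M] [ContMDiffSMul 𝓘(ℝ, EG) 𝓘(ℝ, E) ∞ G M]
    [MulAction G N] [ContMDiffSMul 𝓘(ℝ, EG) 𝓘(ℝ, E') ∞ G N]
    {𝒯M : Courant.ExtendedTangentBundle E F V} {𝒯N : Courant.ExtendedTangentBundle E' F' W}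
    (σM : Courant.ExtendedGroupAction EG G 𝒯M) (σN : Courant.ExtendedGroupAction EG G 𝒯N)
    (f : Courant.Morphism 𝒯M 𝒯N) (hf : f.IsEquivariant σM σN) :
    ∃ T : Courant.spinors 𝒯N →ₗ[ℝ] Courant.spinors 𝒯M,
      -- in terms of splittings, `T` is the map `ρ ↦ e^{-b} ∧ f^* ρ`
      (∀ (sM : Courant.IsotropicSplitting 𝒯M) (sN : Courant.IsotropicSplitting 𝒯N),
        ∃ b : M → E [⋀^Fin 2]→L[ℝ] ℝ,
          Courant.FormField.IsSmooth (fun x => Courant.Forms.ofDegree 2 (b x)) ∧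
          f.Represents sM sN b ∧
          ∀ (ρ : Courant.spinors 𝒯N) (x : M), (T ρ).1 sM x =
            Courant.Forms.mul (Courant.Forms.exp (Courant.Forms.ofDegree 2 (-b x)))
              (Courant.FormField.pullback f.toFun (ρ.1 sN) x)) ∧
      -- `T` commutes with the Lie derivatives along the generating sections
      (∀ (τ : GroupLieAlgebra 𝓘(ℝ, EG) G) (ρ : Courant.spinors 𝒯N),
        ∃ η : Courant.spinors 𝒯N, η.1 = Courant.lieT (σN.δ τ) ρ.1 ∧
          Courant.lieT (σM.δ τ) (T ρ).1 = (T η).1) ∧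
      -- `T` acts on formal series, and commutes with the Cartan differentials
      (∀ ρ ∈ Courant.formalSeries (GroupLieAlgebra 𝓘(ℝ, EG) G) 𝒯N,
        Courant.mapSeries T ρ ∈ Courant.formalSeries (GroupLieAlgebra 𝓘(ℝ, EG) G) 𝒯M ∧
        ∃ η ∈ Courant.formalSeries (GroupLieAlgebra 𝓘(ℝ, EG) G) 𝒯N,
          (∀ k τ, (η k τ).1 = σN.toExtendedAction.cartanD ρ k τ) ∧
          ∀ k τ, σM.toExtendedAction.cartanD (Courant.mapSeries T ρ) k τ = (T (η k τ)).1) ∧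
      -- `T` preserves the Cartan complexes, and induces a map of the cohomology in each parity
      ∀ p : ZMod 2,
        (∀ ρ ∈ σN.toExtendedAction.cartanComplex p,
          Courant.mapSeries T ρ ∈ σM.toExtendedAction.cartanComplex p) ∧
        ∃ h : ∀ z ∈ σN.toExtendedAction.cocycles p,
            Courant.mapSeries T z ∈ σM.toExtendedAction.cocycles p,
          ∃ Φ : σN.toExtendedAction.Cohomology p →ₗ[ℝ] σM.toExtendedAction.Cohomology p,
            ∀ z : σN.toExtendedAction.cocycles p,
              Φ (Submodule.Quotient.mk z) =
                Submodule.Quotient.mk ⟨Courant.mapSeries T z.1, h z.1 z.2⟩ := by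
  obtain ⟨T, h, hd, hc, hl, hp⟩ := Courant.Morphism.exists_spinorMap f
  -- For every `τ` the generating sections are related by the morphism, so the intertwining
  -- properties of `T` apply to `δ_M(τ)` and `δ_N(τ)`.
  have hrel := hf.generator_mem
  have hD := Courant.ExtendedAction.cartanD_mapSeries (σ := σM.toExtendedAction)
    (σ' := σN.toExtendedAction) hd fun τ => hc (σM.δ τ) (σN.δ τ) (hrel τ)
  have hC : ∀ p, ∀ ρ ∈ σN.toExtendedAction.cartanComplex p,
      Courant.mapSeries T ρ ∈ σM.toExtendedAction.cartanComplex p := fun p ρ hρ =>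
    Courant.ExtendedAction.mapSeries_mem_cartanComplex
      (fun τ => hl (σM.δ τ) (σN.δ τ) (hrel τ)) (hp p) hρ
  exact ⟨T, h, fun τ ρ => ⟨⟨Courant.lieT (σN.δ τ) ρ.1, Courant.lieT_mem (σN.δ τ) ρ.2⟩, rfl,
      hl (σM.δ τ) (σN.δ τ) (hrel τ) ρ⟩,
    fun ρ hρ => ⟨Courant.mapSeries_mem_formalSeries T hρ,
      σN.toExtendedAction.cartanSeries ρ, σN.toExtendedAction.cartanSeries_mem hρ,
      σN.toExtendedAction.cartanSeries_coe ρ, hD ρ⟩,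
    fun p => ⟨hC p, Courant.ExtendedAction.exists_cohomologyMap hD hC p⟩⟩
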